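/- A \emph{blueprint} $B=(A,\mathcal R)$ is a commutative monoid $A$ with an equivalence relation $\mathcal R$ (written $\equiv$) on the semiring $\mathbb N[A]$ of finite formal sums that is closed under addition and multiplication. A morphism is a monoid morphism that respects these relations. $B$ is \emph{proper} if $a\equiv b$ implies $a=b$ for $a,b\in A$; \emph{cancellative} if $x+z\equiv y+z$ implies $x\equiv y$; \emph{with a zero} if $a\equiv 0$ (the empty sum) for some $a\in A$; \emph{with inverses} if for every $a\in A$ there is $b\in A$ with $a+b\equiv 0$. A (semi)ring $R$, commutative with $1$, is considered as the blueprint $(R,\cdot)$ with $\sum a_i\equiv\sum b_j$ iff $\sum a_i=\sum b_j$ in $R$. The localization of $B$ at a submonoid $S$ of $A$ is $S^{-1}B=(S^{-1}A,S^{-1}\mathcal R)$. An \emph{ideal} of $B$ is a subset $I\subseteq A$ with $IA\subseteq I$ that contains every zero of $B$ and every $a\in A$ with $a\sim_I b$ for some $b\in I$; here $\sim_I$ is the restriction to $A$ of the equivalence relation on $\mathbb N[A]$ generated by $\equiv$ and by $\sum_i c_i\sim\sum_i d_i$ whenever for each $i$ either $c_i=d_i$ or $c_i,d_i\in I$. It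 is prime if $A\setminus I$ is a submonoid. $\operatorname{Spec}B$ is the set of prime ideals, with the topology generated by the sets $U_h=\{\mathfrak p\mid h\notin\mathfrak p\}$ and with the sheaf of blueprints whose sections over $U$ are the families $(s(\mathfrak p))_{\mathfrak p\in U}$, $s(\mathfrak p)\in B_{\mathfrak p}$, that are locally, on sets $U_h\subseteq U$, given by one fraction $a/h^n$; products and relations of sections are pointwise. A \emph{locally blueprinted space} is a topological space with a sheaf of blueprints all of whose stalks have a unique maximal ideal; morphisms are continuous maps with a morphism of sheaves that on stalks maps maximal ideal into maximal ideal. A \emph{blue scheme} is a locally blueprinted space that has an open cover by spectra of blueprints. For a full subcategory $\mathcal C$ of blueprints, a \emph{$\mathcal C$-scheme} is a blue scheme that has an open cover by spectra of blueprints in $\mathcal C$. \textbf{Proposition.} Let $\mathcal C$ be a full subcategory of the category of blueprints that contains (up to isomorphism) all localizations of its objects and whose inclusion functor has a left adjoint. Assume moreover that all objects of $\mathcal C$ are proper or that $\mathcal C$ is closed under colimits of directed diagrams. Then for every blue scheme $X$ there are a $\mathcal C$-scheme $\mathcal G(X)$ and a morphism $\beta:\mathcal G(X)\to X$ of blue schemes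 such that every morphism from a $\mathcal C$-scheme to $X$ factors uniquely through $\beta$. Each of the following full subcategories contains all localizations of its objects, its inclusion has a left adjoint, and for every blue scheme $X$ a universal morphism as above exists: rings (giving the Grothendieck scheme $X_{\mathbb Z}\to X$), semirings (giving the semiring scheme $X_{\mathbb N}\to X$), cancellative blueprints, proper blueprints, proper blueprints with inverses, proper blueprints with a zero (giving $X_{\mathrm{canc}}$, $X_{\mathrm{prop}}$, $X_{\mathrm{inv}}$, $X_0$). -/

import Mathlib

open CategoryTheory CategoryTheory.Limits TopologicalSpace Opposite AlgebraicGeometry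

universe u

/-! ### Blueprints -/

/-- A blueprint: a commutative monoid `A` with a pre-addition, i.e. an equivalence relation on the
semiring `ℕ[A]` of finite formal sums of elements of `A` that is additive and multiplicative. -/
structure Blpr : Type (u + 1) where
  carrier : Type u
  [monoid : CommMonoid carrier]
  rel : RingCon (MonoidAlgebra ℕ carrier)

namespace Blpr

instance : CoeSort Blpr.{u} (Type u) := ⟨Blpr.carrier⟩

instance (B : Blpr.{u}) : CommMonoid B := B.monoid

/-- The semiring morphism `ℕ[A₁] → ℕ[A₂]` induced by a monoid morphism. -/
noncomputable abbrev mapSum {A₁ A₂ : Type*} [CommMonoid A₁] [CommMonoid A₂] (f : A₁ →* A₂) :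
    MonoidAlgebra ℕ A₁ →+* MonoidAlgebra ℕ A₂ :=
  MonoidAlgebra.mapDomainRingHom ℕ f

/-- An element of the monoid as a formal sum with one term. -/
noncomputable abbrev el {A : Type*} (a : A) : MonoidAlgebra ℕ A := MonoidAlgebra.single a 1

/-- A morphism of blueprints: a monoid morphism that respects the pre-additions. -/
@[ext]
structure Hom (B C : Blpr.{u}) where
  toMonoidHom : B →* C
  map_rel : ∀ x y, B.rel x y → C.rel (mapSum toMonoidHom x) (mapSum toMonoidHom y)

instance : Category Blpr.{u} where
  Hom := Hom
  id B := ⟨MonoidHom.id B, fun x y h => by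
    rw [mapSum, MonoidAlgebra.mapDomainRingHom_id]; exact h⟩
  comp f g := ⟨g.toMonoidHom.comp f.toMonoidHom, fun x y h => by
    rw [mapSum, MonoidAlgebra.mapDomainRingHom_comp]; exact g.map_rel _ _ (f.map_rel _ _ h)⟩

@[ext]
theorem hom_ext {B C : Blpr.{u}} {f g : B ⟶ C} (h : ∀ a, f.toMonoidHom a = g.toMonoidHom a) :
    f = g :=
  Hom.ext (MonoidHom.ext h)

@[simp]
theorem id_apply (B : Blpr.{u}) (a : B) : (𝟙 B : B ⟶ B).toMonoidHom a = a := rfl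

@[simp]
theorem comp_apply {B C D : Blpr.{u}} (f : B ⟶ C) (g : C ⟶ D) (a : B) :
    (f ≫ g).toMonoidHom a = g.toMonoidHom (f.toMonoidHom a) := rfl

/-- (A6) -/
def IsCancellative (B : Blpr.{u}) : Prop :=
  ∀ x y z : MonoidAlgebra ℕ B, B.rel (x + z) (y + z) → B.rel x y

/-- (A7) -/
def HasInverses (B : Blpr.{u}) : Prop := ∀ a : B, ∃ b : B, B.rel (el a + el b) 0

/-- The element `e` is a zero of `B`, i.e. `e` is related to the empty sum. -/
def IsZeroElem (B : Blpr.{u}) (e : B) : Prop := B.rel (el e) 0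

/-- (A8) -/
def HasZeroElem (B : Blpr.{u}) : Prop := ∃ e : B, B.IsZeroElem e

/-- (A9) -/
def IsProper (B : Blpr.{u}) : Prop := ∀ a b : B, B.rel (el a) (el b) → a = b

/-- The blueprint of a commutative semiring `R`: the multiplicative monoid of `R`, with
`∑ aᵢ ≡ ∑ bⱼ` if and only if the two sums are equal in `R`. -/
noncomputable def ofSemiring (R : Type u) [CommSemiring R] : Blpr.{u} where
  carrier := R
  rel := RingCon.ker (MonoidAlgebra.lift ℕ R R (MonoidHom.id R) : MonoidAlgebra ℕ R →+* R)

/-- Cancellative blueprints. -/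
def canc : ObjectProperty Blpr.{u} := fun B => B.IsCancellative

/-- Proper blueprints. -/
def prop : ObjectProperty Blpr.{u} := fun B => B.IsProper

/-- Proper blueprints with inverses. -/
def inv : ObjectProperty Blpr.{u} := fun B => B.IsProper ∧ B.HasInverses

/-- Proper blueprints with a zero. -/
def zero : ObjectProperty Blpr.{u} := fun B => B.IsProper ∧ B.HasZeroElem

/-- The essential image of the category of semirings. -/
def semirings : ObjectProperty Blpr.{u} := fun B =>
  ∃ (R : Type u) (_ : CommSemiring R), Nonempty (B ≅ ofSemiring R)

/-- The essential image of the category of rings. -/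
def rings : ObjectProperty Blpr.{u} := fun B =>
  ∃ (R : Type u) (_ : CommRing R), Nonempty (B ≅ ofSemiring R)

/-! ### Colimits of blueprints -/

section Colimits

variable {J : Type u} [SmallCategory J] (F : J ⥤ Blpr.{u})

/-- The relations that define the colimit of the underlying monoids. -/
inductive ColimRel : Multiplicative (Multiset (Σ j, F.obj j)) →
    Multiplicative (Multiset (Σ j, F.obj j)) → Prop
  | one (j : J) : ColimRel (Multiplicative.ofAdd {⟨j, 1⟩}) 1
  | mul (j : J) (a b : F.obj j) : ColimRel (Multiplicative.ofAdd {⟨j, a * b⟩})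
      (Multiplicative.ofAdd {⟨j, a⟩} * Multiplicative.ofAdd {⟨j, b⟩})
  | map {j k : J} (f : j ⟶ k) (a : F.obj j) : ColimRel (Multiplicative.ofAdd {⟨j, a⟩})
      (Multiplicative.ofAdd {⟨k, (F.map f).toMonoidHom a⟩})

/-- The colimit of the underlying monoids. -/
abbrev ColimMonoid : Type u := (conGen (ColimRel F)).Quotient

/-- The canonical map into the colimit of the underlying monoids. -/
def colimι (j : J) : F.obj j →* ColimMonoid F where
  toFun a := (conGen (ColimRel F)).mk' (Multiplicative.ofAdd {⟨j, a⟩})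
  map_one' := (Con.eq _).2 (ConGen.Rel.of _ _ (ColimRel.one j))
  map_mul' a b := by
    rw [← map_mul]
    exact (Con.eq _).2 (ConGen.Rel.of _ _ (ColimRel.mul j a b))

/-- The colimit of blueprints: the colimit of the monoids with the pre-addition that is generated
by the images of the given pre-additions. -/
noncomputable def colim : Blpr.{u} where
  carrier := ColimMonoid F
  rel := ringConGen fun x y => ∃ (j : J) (v w : MonoidAlgebra ℕ (F.obj j)),
    (F.obj j).rel v w ∧ x = mapSum (colimι F j) v ∧ y = mapSum (colimι F j) w

/-- The colimit cocone. -/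
noncomputable def colimCocone : Cocone F where
  pt := colim F
  ι :=
    { app := fun j => ⟨colimι F j, fun x y h => RingConGen.Rel.of _ _ ⟨j, x, y, h, rfl, rfl⟩⟩
      naturality := fun j k f => by
        apply hom_ext
        intro a
        exact ((Con.eq _).2 (ConGen.Rel.of _ _ (ColimRel.map f a))).symm }

/-- The monoid morphism out of the colimit. -/
def colimDescMonoid (s : Cocone F) : ColimMonoid F →* s.pt :=
  Con.lift (conGen (ColimRel F))
    { toFun := fun m => (Multiset.map (fun a => (s.ι.app a.1).toMonoidHom a.2) m.toAdd).prod
      map_one' := by simp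
      map_mul' := fun x y => by simp }
    (by
      refine Con.conGen_le.2 ?_
      intro x y h
      cases h with
      | one j => simp [Con.ker_rel]
      | mul j a b => simp [Con.ker_rel]
      | map f a =>
        have h : (s.ι.app _).toMonoidHom ((F.map f).toMonoidHom a) = (s.ι.app _).toMonoidHom a :=
          congrArg (fun g => Hom.toMonoidHom g a) (s.w f)
        simp [Con.ker_rel, h])

theorem colimDescMonoid_ι (s : Cocone F) (j : J) :
    (colimDescMonoid F s).comp (colimι F j) = (s.ι.app j).toMonoidHom := by
  ext a
  simp [colimDescMonoid, colimι]

theorem colimι_ext {M : Type*} [CommMonoid M] {f g : ColimMonoid F →* M}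
    (h : ∀ j, f.comp (colimι F j) = g.comp (colimι F j)) : f = g := by
  refine MonoidHom.ext fun m => ?_
  induction m using Con.induction_on with
  | H m =>
    change f ((conGen (ColimRel F)).mk' (Multiplicative.ofAdd m.toAdd)) =
      g ((conGen (ColimRel F)).mk' (Multiplicative.ofAdd m.toAdd))
    induction m.toAdd using Multiset.induction_on with
    | empty => simp
    | cons a s ih =>
      rw [← Multiset.singleton_add, ofAdd_add, map_mul, map_mul, map_mul, ih]
      congr 1
      exact DFunLike.congr_fun (h a.1) a.2

/-- The colimit cocone is a colimit. -/
noncomputable def colimIsColimit : IsColimit (colimCocone F) where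
  desc s := ⟨colimDescMonoid F s, by
    change (colim F).rel ≤ s.pt.rel.comap (mapSum (colimDescMonoid F s))
    refine RingCon.ringConGen_le.2 ?_
    rintro x y ⟨j, v, w, h, rfl, rfl⟩
    rw [RingCon.comap_rel, ← RingHom.comp_apply, ← RingHom.comp_apply,
      ← MonoidAlgebra.mapDomainRingHom_comp, colimDescMonoid_ι]
    exact (s.ι.app j).map_rel _ _ h⟩
  fac s j := by
    apply hom_ext
    intro a
    exact DFunLike.congr_fun (colimDescMonoid_ι F s j) a
  uniq s m hm := by
    refine Hom.ext (colimι_ext F fun j => ?_)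
    rw [colimDescMonoid_ι, ← hm j]
    rfl

instance : HasColimits Blpr.{u} where
  has_colimits_of_shape _ _ := { has_colimit := fun F => ⟨⟨colimCocone F, colimIsColimit F⟩⟩ }

end Colimits

/-! ### Localizations -/

section Localization

variable (B : Blpr.{u}) (S : Submonoid B)

/-- The monoid morphism `a ↦ a / 1`. -/
abbrev locMap : B →* Localization S := (Localization.monoidOf S).toMonoidHom

theorem mapSum_el {A₁ A₂ : Type*} [CommMonoid A₁] [CommMonoid A₂] (f : A₁ →* A₂) (a : A₁) :
    mapSum f (el a) = el (f a) := by
  simp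

theorem el_mul {A : Type*} [CommMonoid A] (a b : A) : el (a * b) = el a * el b := by
  simp [MonoidAlgebra.single_mul_single]

theorem exists_common_denominator (x : MonoidAlgebra ℕ (Localization S)) :
    ∃ t : S, ∃ v : MonoidAlgebra ℕ B, el (B.locMap S t) * x = mapSum (B.locMap S) v := by
  induction x using MonoidAlgebra.induction_linear with
  | zero => exact ⟨1, 0, by simp⟩
  | add x y hx hy =>
    obtain ⟨t, v, h⟩ := hx
    obtain ⟨t', v', h'⟩ := hy
    refine ⟨t * t', el (t' : B) * v + el (t : B) * v', ?_⟩
    rw [Submonoid.coe_mul, map_mul, el_mul, map_add, map_mul, map_mul, ← h, ← h', mapSum_el,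
      mapSum_el]
    ring
  | single a n =>
    induction a using Localization.induction_on with
    | H y =>
      refine ⟨y.2, MonoidAlgebra.single y.1 n, ?_⟩
      have e : B.locMap S y.2 * Localization.mk y.1 y.2 = B.locMap S y.1 := by
        change (Localization.monoidOf S) _ * _ = (Localization.monoidOf S) _
        rw [Localization.mk_eq_monoidOf_mk'_apply, Submonoid.LocalizationMap.mul_mk'_eq_mk'_of_mul]
        exact Submonoid.LocalizationMap.mk'_mul_cancel_left _ _ _
      rw [MonoidAlgebra.single_mul_single, e, one_mul, mapSum,
        MonoidAlgebra.mapDomainRingHom_apply, MonoidAlgebra.mapDomain_single]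

theorem exists_of_locMap_eq (s : Finset (B × B)) :
    ∃ t : S, ∀ p ∈ s, B.locMap S p.1 = B.locMap S p.2 → (t : B) * p.1 = t * p.2 := by
  classical
  induction s using Finset.induction_on with
  | empty => exact ⟨1, by simp⟩
  | insert p s _ ih =>
    obtain ⟨t, ht⟩ := ih
    by_cases hp : B.locMap S p.1 = B.locMap S p.2
    · obtain ⟨c, hc⟩ := (Localization.monoidOf S).eq_iff_exists.1 hp
      refine ⟨t * c, fun q hq h => ?_⟩
      rcases Finset.mem_insert.1 hq with rfl | hq
      · rw [Submonoid.coe_mul, mul_assoc, mul_assoc, hc]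
      · rw [Submonoid.coe_mul, mul_comm (t : B), mul_assoc, mul_assoc, ht q hq h]
    · refine ⟨t, fun q hq h => ?_⟩
      rcases Finset.mem_insert.1 hq with rfl | hq
      · exact absurd h hp
      · exact ht q hq h

theorem exists_of_mapSum_eq (v w : MonoidAlgebra ℕ B)
    (h : mapSum (B.locMap S) v = mapSum (B.locMap S) w) :
    ∃ t : S, el (t : B) * v = el (t : B) * w := by
  classical
  let s : Finset B := v.coeff.support ∪ w.coeff.support
  obtain ⟨t, ht⟩ := B.exists_of_locMap_eq S (s ×ˢ s)
  let g : Localization S → B := fun z =>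
    if hz : ∃ a ∈ s, B.locMap S a = z then (t : B) * hz.choose else 1
  have hg : ∀ a ∈ s, g (B.locMap S a) = t * a := fun a ha => by
    have hz : ∃ b ∈ s, B.locMap S b = B.locMap S a := ⟨a, ha, rfl⟩
    simp only [g, dif_pos hz]
    exact ht (hz.choose, a) (Finset.mem_product.2 ⟨hz.choose_spec.1, ha⟩) hz.choose_spec.2
  have key : ∀ x : MonoidAlgebra ℕ B, x.coeff.support ⊆ s →
      el (t : B) * x = MonoidAlgebra.mapDomain g (mapSum (B.locMap S) x) := fun x hx => by
    have h₁ : el (t : B) * x = MonoidAlgebra.mapDomain (fun a => (t : B) * a) x := by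
      clear hx
      induction x using MonoidAlgebra.induction_linear with
      | zero => simp
      | add x y hx hy => rw [mul_add, hx, hy, MonoidAlgebra.mapDomain_add]
      | single a n => simp [MonoidAlgebra.single_mul_single]
    rw [h₁, mapSum, MonoidAlgebra.mapDomainRingHom_apply]
    refine congrArg MonoidAlgebra.ofCoeff ?_
    refine (Finsupp.mapDomain_congr fun a ha => (hg a (hx ha)).symm).trans ?_
    exact Finsupp.mapDomain_comp (f := B.locMap S) (g := g) (v := x.coeff)
  refine ⟨t, ?_⟩
  rw [key v Finset.subset_union_left, key w Finset.subset_union_right, h]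

/-- The pre-addition of the localization: two formal sums of fractions are related if they become,
after multiplication with a common denominator `t ∈ S`, the images of two related formal sums of
elements of `B`. -/
noncomputable def locRel : RingCon (MonoidAlgebra ℕ (Localization S)) where
  r x y := ∃ t : S, ∃ v w : MonoidAlgebra ℕ B, B.rel v w ∧
    el (B.locMap S t) * x = mapSum (B.locMap S) v ∧ el (B.locMap S t) * y = mapSum (B.locMap S) w
  iseqv :=
    { refl := fun x => by
        obtain ⟨t, v, h⟩ := B.exists_common_denominator S x
        exact ⟨t, v, v, B.rel.refl v, h, h⟩
      symm := by
        rintro x y ⟨t, v, w, h, h₁, h₂⟩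
        exact ⟨t, w, v, B.rel.symm h, h₂, h₁⟩
      trans := by
        rintro x y z ⟨t, v, w, h, h₁, h₂⟩ ⟨t', v', w', h', h₁', h₂'⟩
        obtain ⟨s, hs⟩ := B.exists_of_mapSum_eq S (el (t' : B) * w) (el (t : B) * v') (by
          rw [map_mul, map_mul, ← h₂, ← h₁', mapSum_el, mapSum_el]
          ring)
        refine ⟨s * (t * t'), el (s : B) * (el (t' : B) * v), el (s : B) * (el (t : B) * w'),
          B.rel.trans (B.rel.mul (B.rel.refl _) (B.rel.mul (B.rel.refl _) h)) ?_, ?_, ?_⟩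
        · rw [hs]
          exact B.rel.mul (B.rel.refl _) (B.rel.mul (B.rel.refl _) h')
        · rw [Submonoid.coe_mul, Submonoid.coe_mul, map_mul, map_mul, el_mul, el_mul, map_mul,
            map_mul, ← h₁, mapSum_el, mapSum_el]
          ring
        · rw [Submonoid.coe_mul, Submonoid.coe_mul, map_mul, map_mul, el_mul, el_mul, map_mul,
            map_mul, ← h₂', mapSum_el, mapSum_el]
          ring }
  mul' := by
    rintro x y x' y' ⟨t, v, w, h, h₁, h₂⟩ ⟨t', v', w', h', h₁', h₂'⟩
    refine ⟨t * t', v * v', w * w', B.rel.mul h h', ?_, ?_⟩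
    · rw [Submonoid.coe_mul, map_mul, el_mul, map_mul, ← h₁, ← h₁']
      ring
    · rw [Submonoid.coe_mul, map_mul, el_mul, map_mul, ← h₂, ← h₂']
      ring
  add' := by
    rintro x y x' y' ⟨t, v, w, h, h₁, h₂⟩ ⟨t', v', w', h', h₁', h₂'⟩
    refine ⟨t * t', el (t' : B) * v + el (t : B) * v', el (t' : B) * w + el (t : B) * w',
      B.rel.add (B.rel.mul (B.rel.refl _) h) (B.rel.mul (B.rel.refl _) h'), ?_, ?_⟩
    · rw [Submonoid.coe_mul, map_mul, el_mul, map_add, map_mul, map_mul, ← h₁, ← h₁', mapSum_el,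
        mapSum_el]
      ring
    · rw [Submonoid.coe_mul, map_mul, el_mul, map_add, map_mul, map_mul, ← h₂, ← h₂', mapSum_el,
        mapSum_el]
      ring

/-- The localization `S⁻¹B`. -/
noncomputable def localization : Blpr.{u} where
  carrier := Localization S
  rel := B.locRel S

end Localization

/-! ### Ideals -/

section Ideals

variable (B : Blpr.{u})

/-- The formal sum of a finite family of elements. -/
noncomputable def formalSum {A : Type*} (s : Multiset A) : MonoidAlgebra ℕ A := (s.map el).sum

/-- The relation `∑ aᵢ ∼ ∑ bᵢ` if `aᵢ ∼ bᵢ` for all `i`. -/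
def linearExt {A : Type*} (r : A → A → Prop) (x y : MonoidAlgebra ℕ A) : Prop :=
  ∃ s : Multiset (A × A), (∀ p ∈ s, r p.1 p.2) ∧
    x = formalSum (s.map Prod.fst) ∧ y = formalSum (s.map Prod.snd)

/-- The relation on `B` induced by a subset `I`: the restriction to `B` of the smallest
equivalence relation on formal sums that contains both the pre-addition and the linear extension
of the relation "`a = b`, or both `a` and `b` are in `I`". -/
def idealRel (I : Set B) (a b : B) : Prop :=
  Relation.EqvGen
    (fun x y => B.rel x y ∨ linearExt (fun c d : B => c = d ∨ (c ∈ I ∧ d ∈ I)) x y) (el a) (el b)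

/-- Ideals of a blueprint. -/
structure IsIdeal (I : Set B) : Prop where
  mul_mem : ∀ a b : B, a ∈ I → a * b ∈ I
  zero_mem : ∀ e : B, B.IsZeroElem e → e ∈ I
  mem_of_rel : ∀ a b : B, B.idealRel I a b → b ∈ I → a ∈ I

/-- Prime ideals: the complement is a submonoid. -/
structure IsPrimeIdeal (p : Set B) : Prop extends IsIdeal B p where
  one_notMem : (1 : B) ∉ p
  mul_notMem : ∀ a b : B, a ∉ p → b ∉ p → a * b ∉ p

/-- Maximal ideals: maximal among the ideals different from `B`. -/
structure IsMaximalIdeal (m : Set B) : Prop extends IsIdeal B m where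
  ne_univ : m ≠ Set.univ
  eq_of_subset : ∀ I : Set B, B.IsIdeal I → I ≠ Set.univ → m ⊆ I → m = I

/-- Local blueprints. -/
def IsLocal : Prop := ∃! m : Set B, B.IsMaximalIdeal m

end Ideals

/-! ### The spectrum -/

section Spectrum

/-- The set of prime ideals of a blueprint. -/
@[ext]
structure PrimeSpec (B : Blpr.{u}) : Type u where
  ideal : Set B
  isPrime : B.IsPrimeIdeal ideal

variable {B : Blpr.{u}}

/-- The complement of a prime ideal. -/
def PrimeSpec.compl (p : PrimeSpec B) : Submonoid B where
  carrier := p.idealᶜ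
  one_mem' := p.isPrime.one_notMem
  mul_mem' := fun {a b} ha hb => p.isPrime.mul_notMem a b ha hb

variable (B) in
/-- The basic open subset of all prime ideals that do not contain `h`. -/
def basicOpen (h : B) : Set (PrimeSpec B) := {p | h ∉ p.ideal}

instance : TopologicalSpace (PrimeSpec B) :=
  TopologicalSpace.generateFrom (Set.range (basicOpen B))

theorem basicOpen_mul (g h : B) : basicOpen B (g * h) = basicOpen B g ∩ basicOpen B h := by
  ext p
  refine ⟨fun hp => ⟨fun hg => hp (p.isPrime.mul_mem _ _ hg), fun hh => hp ?_⟩,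
    fun hp => p.isPrime.mul_notMem _ _ hp.1 hp.2⟩
  rw [mul_comm]
  exact p.isPrime.mul_mem _ _ hh

theorem exists_basicOpen_subset {U : Set (PrimeSpec B)} (hU : IsOpen U) {p : PrimeSpec B}
    (hp : p ∈ U) : ∃ h : B, p ∈ basicOpen B h ∧ basicOpen B h ⊆ U := by
  induction hU with
  | basic s hs =>
    obtain ⟨h, rfl⟩ := hs
    exact ⟨h, hp, subset_rfl⟩
  | univ => exact ⟨1, p.isPrime.one_notMem, Set.subset_univ _⟩
  | inter s t _ _ ihs iht =>
    obtain ⟨g, hg, hgs⟩ := ihs hp.1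
    obtain ⟨h, hh, hht⟩ := iht hp.2
    refine ⟨g * h, ?_, ?_⟩
    · rw [basicOpen_mul]
      exact ⟨hg, hh⟩
    · rw [basicOpen_mul]
      exact Set.inter_subset_inter hgs hht
  | sUnion S _ ih =>
    obtain ⟨s, hs, hps⟩ := hp
    obtain ⟨h, hh, hhs⟩ := ih s hs hps
    exact ⟨h, hh, hhs.trans (Set.subset_sUnion_of_mem hs)⟩

/-- The fraction `a / hⁿ` in the localization `B_q`, for a prime ideal `q` that does not
contain `h`. -/
def fraction (a h : B) (n : ℕ) (q : PrimeSpec B) (hq : q ∈ basicOpen B h) :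
    Localization q.compl :=
  Localization.mk a ⟨h ^ n, pow_mem (show h ∈ q.compl from hq) n⟩

/-- A family of elements of the localizations `B_p` is locally represented on `U` if every
point `p` of `U` has a neighbourhood `U_h ⊆ U` on which it is given by a fraction `a / hⁿ`. -/
def IsLocallyRepresented (U : Set (PrimeSpec B)) (s : ∀ p : U, Localization p.1.compl) : Prop :=
  ∀ p ∈ U, ∃ (h a : B) (n : ℕ) (hU : basicOpen B h ⊆ U), p ∈ basicOpen B h ∧
    ∀ (q : PrimeSpec B) (hq : q ∈ basicOpen B h), s ⟨q, hU hq⟩ = fraction a h n q hq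

theorem isLocallyRepresented_one {U : Set (PrimeSpec B)} (hU : IsOpen U) :
    IsLocallyRepresented U 1 := by
  intro p hp
  obtain ⟨h, hh, hhU⟩ := exists_basicOpen_subset hU hp
  refine ⟨h, 1, 0, hhU, hh, fun q hq => ?_⟩
  simp only [Pi.one_apply, fraction, pow_zero]
  exact Localization.mk_one.symm

theorem isLocallyRepresented_mul {U : Set (PrimeSpec B)} {s t : ∀ p : U, Localization p.1.compl}
    (hs : IsLocallyRepresented U s) (ht : IsLocallyRepresented U t) :
    IsLocallyRepresented U (s * t) := by
  intro p hp
  obtain ⟨g, a, n, hgU, hpg, hs⟩ := hs p hp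
  obtain ⟨h, b, m, hhU, hph, ht⟩ := ht p hp
  have hgh := basicOpen_mul g h
  refine ⟨g * h, a * b * g ^ m * h ^ n, n + m, ?_, ?_, fun q hq => ?_⟩
  · rw [hgh]
    exact Set.inter_subset_left.trans hgU
  · rw [hgh]
    exact ⟨hpg, hph⟩
  · have hq' := hq
    rw [hgh] at hq'
    rw [Pi.mul_apply, hs q hq'.1, ht q hq'.2, fraction, fraction, fraction, Localization.mk_mul,
      Localization.mk_eq_mk_iff, Localization.r_iff_exists]
    refine ⟨1, ?_⟩
    simp only [Submonoid.coe_mul, OneMemClass.coe_one, one_mul, mul_pow, pow_add]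
    ac_rfl

theorem isLocallyRepresented_restrict {U V : Set (PrimeSpec B)} (hV : IsOpen V) (hVU : V ⊆ U)
    {s : ∀ p : U, Localization p.1.compl} (hs : IsLocallyRepresented U s) :
    IsLocallyRepresented V (fun p => s ⟨p.1, hVU p.2⟩) := by
  intro p hp
  obtain ⟨g, a, n, hgU, hpg, hs⟩ := hs p (hVU hp)
  obtain ⟨h, hph, hhV⟩ := exists_basicOpen_subset hV hp
  have hgh := basicOpen_mul g h
  refine ⟨g * h, a * h ^ n, n, ?_, ?_, fun q hq => ?_⟩
  · rw [hgh]
    exact Set.inter_subset_right.trans hhV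
  · rw [hgh]
    exact ⟨hpg, hph⟩
  · have hq' := hq
    rw [hgh] at hq'
    refine (hs q hq'.1).trans ?_
    rw [fraction, fraction, Localization.mk_eq_mk_iff, Localization.r_iff_exists]
    refine ⟨1, ?_⟩
    simp only [OneMemClass.coe_one, one_mul, mul_pow]
    ac_rfl

variable (B)

/-- The monoid of sections of the structure sheaf over `U`. -/
def sectionsSubmonoid (U : Opens (PrimeSpec B)) :
    Submonoid (∀ p : (U : Set (PrimeSpec B)), Localization p.1.compl) where
  carrier := {s | IsLocallyRepresented (U : Set (PrimeSpec B)) s}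
  one_mem' := isLocallyRepresented_one U.isOpen
  mul_mem' := isLocallyRepresented_mul

/-- The blueprint of sections over `U`: multiplication is pointwise, and two formal sums of
sections are related if and only if their values are related in `B_p` for all `p ∈ U`. -/
noncomputable def sections (U : Opens (PrimeSpec B)) : Blpr.{u} where
  carrier := B.sectionsSubmonoid U
  rel :=
    { r := fun x y => ∀ p : (U : Set (PrimeSpec B)), ((B.locRel p.1.compl).comap
        (mapSum ((Pi.evalMonoidHom _ p).comp (B.sectionsSubmonoid U).subtype))) x y
      iseqv := ⟨fun _ _ => RingCon.refl _ _, fun h p => RingCon.symm _ (h p),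
        fun h h' p => RingCon.trans _ (h p) (h' p)⟩
      mul' := fun h h' p => RingCon.mul _ (h p) (h' p)
      add' := fun h h' p => RingCon.add _ (h p) (h' p) }

/-- The value of a section at a point. -/
def evalAt (U : Opens (PrimeSpec B)) (p : (U : Set (PrimeSpec B))) :
    B.sections U →* B.localization p.1.compl :=
  (Pi.evalMonoidHom _ p).comp (B.sectionsSubmonoid U).subtype

theorem sections_rel {U : Opens (PrimeSpec B)} {x y : MonoidAlgebra ℕ (B.sections U)} :
    (B.sections U).rel x y ↔ ∀ p : (U : Set (PrimeSpec B)),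
      (B.localization p.1.compl).rel (mapSum (B.evalAt U p) x) (mapSum (B.evalAt U p) y) :=
  Iff.rfl

theorem mapSum_mapSum {A₁ A₂ A₃ : Type*} [CommMonoid A₁] [CommMonoid A₂] [CommMonoid A₃]
    (f : A₁ →* A₂) (g : A₂ →* A₃) (x : MonoidAlgebra ℕ A₁) :
    mapSum g (mapSum f x) = mapSum (g.comp f) x := by
  rw [mapSum, mapSum, mapSum, MonoidAlgebra.mapDomainRingHom_comp]
  rfl

/-- Restriction of sections, as a monoid morphism. -/
def restrictMonoidHom {U V : Opens (PrimeSpec B)} (h : V ≤ U) :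
    B.sections U →* B.sections V where
  toFun s := ⟨fun p => s.1 ⟨p.1, h p.2⟩, isLocallyRepresented_restrict V.isOpen h s.2⟩
  map_one' := rfl
  map_mul' _ _ := rfl

/-- Restriction of sections. -/
noncomputable def sectionsRestrict {U V : Opens (PrimeSpec B)} (h : V ≤ U) :
    B.sections U ⟶ B.sections V where
  toMonoidHom := B.restrictMonoidHom h
  map_rel x y hxy := by
    rw [sections_rel] at hxy ⊢
    intro p
    rw [mapSum_mapSum, mapSum_mapSum]
    exact hxy ⟨p.1, h p.2⟩

/-- The structure presheaf. -/
noncomputable def structurePresheaf : TopCat.Presheaf Blpr.{u} (TopCat.of (PrimeSpec B)) where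
  obj U := B.sections U.unop
  map f := B.sectionsRestrict f.unop.le

theorem structurePresheaf_isSheaf : (structurePresheaf B).IsSheaf := by
  intro E U S hS x hx
  have hcov : ∀ p : (U : Set (PrimeSpec B)), ∃ (V : Opens (PrimeSpec B)) (f : V ⟶ U),
      S f ∧ p.1 ∈ V := fun p => hS p.1 p.2
  choose V f hf hV using hcov
  let val : ∀ {W : Opens (PrimeSpec B)} (g : W ⟶ U), S g → ∀ p : (W : Set (PrimeSpec B)), E →
      Localization p.1.compl := fun {W} g hg p e => ((x g hg).toMonoidHom e).1 p
  have hval : ∀ {W W' : Opens (PrimeSpec B)} (g : W ⟶ U) (hg : S g) (g' : W' ⟶ U) (hg' : S g')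
      (p : PrimeSpec B) (hp : p ∈ W) (hp' : p ∈ W') (e : E),
      val g hg ⟨p, hp⟩ e = val g' hg' ⟨p, hp'⟩ e := by
    intro W W' g hg g' hg' p hp hp' e
    have h := hx (homOfLE inf_le_left : W ⊓ W' ⟶ W) (homOfLE inf_le_right : W ⊓ W' ⟶ W') hg hg'
      (Subsingleton.elim _ _)
    exact congrFun (congrArg (fun k : E ⟶ B.sections (W ⊓ W') => (k.toMonoidHom e).1) h)
      ⟨p, hp, hp'⟩
  let glue : E →* B.sections U :=
    { toFun := fun e => ⟨fun p => val (f p) (hf p) ⟨p.1, hV p⟩ e, by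
        intro p hp
        obtain ⟨h, a, n, hhV, hph, hs⟩ := ((x (f ⟨p, hp⟩) (hf ⟨p, hp⟩)).toMonoidHom e).2 p
          (hV ⟨p, hp⟩)
        refine ⟨h, a, n, hhV.trans (f ⟨p, hp⟩).le, hph, fun q hq => ?_⟩
        let q' : (U : Set (PrimeSpec B)) := ⟨q, (f ⟨p, hp⟩).le (hhV hq)⟩
        exact (hval (f q') (hf q') (f ⟨p, hp⟩) (hf ⟨p, hp⟩) q (hV q') (hhV hq) e).trans (hs q hq)⟩
      map_one' := Subtype.ext (funext fun p =>
        congrFun (congrArg Subtype.val (map_one (x (f p) (hf p)).toMonoidHom)) ⟨p.1, hV p⟩)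
      map_mul' := fun e e' => Subtype.ext (funext fun p =>
        congrFun (congrArg Subtype.val (map_mul (x (f p) (hf p)).toMonoidHom e e')) ⟨p.1, hV p⟩) }
  refine ⟨(⟨glue, fun v w h => ?_⟩ : E ⟶ B.sections U), fun W g hg => ?_, fun y hy => ?_⟩
  · rw [sections_rel]
    intro p
    let k : E ⟶ B.sections (V p) := x (f p) (hf p)
    have hr := (B.sections_rel).1 (k.map_rel v w h) ⟨p.1, hV p⟩
    rw [mapSum_mapSum, mapSum_mapSum] at hr ⊢
    exact hr
  · apply hom_ext
    intro e
    exact Subtype.ext (funext fun p => hval _ _ g hg p.1 _ p.2 e)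
  · apply hom_ext
    intro e
    refine Subtype.ext (funext fun p => ?_)
    exact congrFun (congrArg (fun k : E ⟶ B.sections (V p) => (k.toMonoidHom e).1)
      (hy (f p) (hf p))) ⟨p.1, hV p⟩

/-- The spectrum of a blueprint, as a space with a sheaf of blueprints. -/
noncomputable def Spec : SheafedSpace Blpr.{u} where
  carrier := TopCat.of (PrimeSpec B)
  presheaf := structurePresheaf B
  IsSheaf := structurePresheaf_isSheaf B

end Spectrum

end Blpr

/-! ### Blue schemes -/

/-- A locally blueprinted space: a topological space with a sheaf of blueprints all of whose stalks
are local blueprints. -/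
structure LocBlprSp : Type (u + 1) extends SheafedSpace Blpr.{u} where
  isLocal : ∀ x : carrier, (presheaf.stalk x).IsLocal

namespace LocBlprSp

/-- A local morphism: a morphism of spaces with a sheaf of blueprints such that the induced
morphisms between stalks map the maximal ideal into the maximal ideal. -/
@[ext]
structure Hom (X Y : LocBlprSp.{u}) where
  toShHom : X.toSheafedSpace ⟶ Y.toSheafedSpace
  map_maximalIdeal : ∀ (x : X.carrier)
    (m : Set (Y.presheaf.stalk (toShHom.hom.base x))) (n : Set (X.presheaf.stalk x)),
    Blpr.IsMaximalIdeal _ m → Blpr.IsMaximalIdeal _ n →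
      Set.MapsTo (toShHom.hom.stalkMap x).toMonoidHom m n

instance : Category LocBlprSp.{u} where
  Hom := Hom
  id X := ⟨𝟙 X.toSheafedSpace, fun x m n hm hn => by
    have h : (𝟙 X.toSheafedSpace : X.toSheafedSpace ⟶ _).hom.stalkMap x = 𝟙 (X.presheaf.stalk x) :=
      PresheafedSpace.stalkMap.id X.toPresheafedSpace x
    have h' : m = n := (X.isLocal x).unique hm hn
    intro a ha
    have h'' : ((𝟙 X.toSheafedSpace : X.toSheafedSpace ⟶ _).hom.stalkMap x).toMonoidHom a = a :=
      congrArg (fun k : X.presheaf.stalk x ⟶ X.presheaf.stalk x => k.toMonoidHom a) h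
    rw [h'', ← h']
    exact ha⟩
  comp {X Y Z} f g := ⟨f.toShHom ≫ g.toShHom, fun x m n hm hn => by
    obtain ⟨k, hk, -⟩ := Y.isLocal (f.toShHom.hom.base x)
    have h : (f.toShHom ≫ g.toShHom).hom.stalkMap x =
        g.toShHom.hom.stalkMap (f.toShHom.hom.base x) ≫ f.toShHom.hom.stalkMap x :=
      PresheafedSpace.stalkMap.comp f.toShHom.hom g.toShHom.hom x
    rw [h]
    exact (f.map_maximalIdeal x k n hk hn).comp (g.map_maximalIdeal _ m k hm hk)⟩

/-- The open subset `U` of `X`, with the restricted structure sheaf, is isomorphic to the spectrum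
of a blueprint in `C`. (An isomorphism of spaces with a sheaf of blueprints identifies the maximal
ideals of the stalks, so it is an isomorphism of locally blueprinted spaces.) -/
def IsSpecOf (C : ObjectProperty Blpr.{u}) (X : LocBlprSp.{u}) (U : Opens X.carrier) : Prop :=
  ∃ B : Blpr.{u}, C B ∧ Nonempty (X.toSheafedSpace.restrict U.isOpenEmbedding ≅ B.Spec)

/-- `X` has an open cover by spectra of blueprints in `C`. -/
def HasCover (C : ObjectProperty Blpr.{u}) (X : LocBlprSp.{u}) : Prop :=
  ∀ x : X.carrier, ∃ U : Opens X.carrier, x ∈ U ∧ X.IsSpecOf C U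

end LocBlprSp

/-- The category of blue schemes: the full subcategory of the locally blueprinted spaces that have
an open cover by spectra of blueprints. -/
abbrev BSch : Type (u + 1) := ObjectProperty.FullSubcategory (LocBlprSp.HasCover.{u} ⊤)

/-- `C`-schemes: blue schemes that have an open cover by spectra of blueprints in `C`. -/
def IsScheme (C : ObjectProperty Blpr.{u}) (X : BSch.{u}) : Prop := X.obj.HasCover C

/-- The class `C` contains, up to isomorphism, all localizations of its members. -/
def StableUnderLocalization (C : ObjectProperty Blpr.{u}) : Prop :=
  ∀ B : Blpr.{u}, C B → ∀ S : Submonoid B, C.isoClosure (B.localization S)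

/-- The class `C` contains, up to isomorphism, all colimits of directed diagrams in it. -/
def StableUnderDirectedColimits (C : ObjectProperty Blpr.{u}) : Prop :=
  ∀ (J : Type u) [Preorder J] [IsDirectedOrder J] [Nonempty J],
    C.isoClosure.IsClosedUnderColimitsOfShape J

/-- The morphism `β : Z ⟶ X` is universal among the morphisms from `C`-schemes to `X`: its source
is a `C`-scheme, and every morphism from a `C`-scheme to `X` factors uniquely through `β`. -/
def IsUniversalFrom (C : ObjectProperty Blpr.{u}) {Z X : BSch.{u}} (β : Z ⟶ X) : Prop :=
  IsScheme C Z ∧ ∀ Y : BSch.{u}, IsScheme C Y → ∀ φ : Y ⟶ X, ∃! ψ : Y ⟶ Z, ψ ≫ β = φ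

/-! Let `G` be the reflection onto `C`. Over an affine piece `Spec B` of `X` the answer has to be
`Spec G(B)`: for a local blueprint `L` in `C`, morphisms `B → L` and `G(B) → L` correspond, and a
morphism to a spectrum is determined by such morphisms at the stalks. Instead of gluing these
spectra, the proof writes down the universal space globally and recovers the spectra as its charts.

The language is that of spaces with regular functions (`PreSp`): a space, a blueprint at each point,
and a notion of regularity for families of elements. When the blueprints are those of germs of
regular functions (`IsGood`), such spaces with their morphisms are the same as spaces with a sheaf
of blueprints (`shMap_ofSh`, `ofSh_shMap`, `isoConc`), and `Spec B` becomes `specC B`.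
`exists_universal` transports the universal problem back. In the stalks of a blue scheme the maximal
ideal is the set of non-units (`atPrime_isStrictlyLocal`), so local morphisms are those whose stalk
maps reflect units.

A point of the universal space is a point `x` of `X` with a prime ideal `q` of `G(O_x)` that
contains the image of the maximal ideal; its stalk is `G(O_x)_q`. Every local point of `X` with
values in a local `L` in `C` lifts uniquely (`zPt`, `zPt_ext`). Topology and regular functions are
the final ones for the lifts of all local morphisms `Spec D → X` with `D` in `C`. The universal
property then follows easily, since continuity and regularity of a lift can be tested on affine
charts of its source (`existsUnique_lift`).

The work lies in proving that this space is a `C`-scheme. A chart `Spec B → X` induces `Spec G(B)` →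
universal space. Comparing local points shows that it is injective with invertible stalk maps. That
it is open and detects regularity comes down to `lift_mem_secSubmonoid`: if morphisms `f_y : B →
D_y` have values that are regular in `y`, so do their extensions `G(B) → D_y`. The regular functions
are not known to form an object of `C`, so one cannot simply lift to them. Instead, the product of
the stalks, which lies in `C`, is mapped to a blueprint `R` in `C` that sees functions only near a
given point `p` (`exists_germ_hom`). If `C` is closed under directed colimits, `R` is the colimit of
the products over the neighbourhoods of `p`; if its objects are proper, `R` is the localization of
the product at the functions equal to one near `p`. Two morphisms `G(B) → R` that agree on `B` are
equal, and this forces the extended function to be a fraction near `p`.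

For the six examples the reflections are explicit: submonoids of `ℕ[A]/≡` or of its ring completion,
and a coarser pre-addition on the same monoid in the cancellative case. All but the last consist of
proper blueprints; cancellative blueprints are closed under directed colimits. -/

open scoped Topology

/-! ### Basic facts on blueprints -/

namespace Blpr

instance {B C : Blpr.{u}} : CoeFun (B ⟶ C) fun _ => B → C := ⟨fun f => f.toMonoidHom⟩

theorem hom_congr {B C : Blpr.{u}} {f g : B ⟶ C} (h : f = g) (a : B) : f a = g a := by rw [h]

/-- The coefficients are natural numbers, on which any two semiring morphisms agree. -/
theorem mapSum_ringHom_ext {A R : Type*} [CommMonoid A] [CommSemiring R]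
    {f g : MonoidAlgebra ℕ A →+* R} (h : ∀ a, f (el a) = g (el a)) : f = g := by
  refine MonoidAlgebra.ringHom_ext (fun r => ?_) h
  have e : (MonoidAlgebra.single (1 : A) r : MonoidAlgebra ℕ A) = (r : MonoidAlgebra ℕ A) := by
    rw [MonoidAlgebra.natCast_def]
    rfl
  rw [e, map_natCast, map_natCast]

theorem mapSum_id {A : Type*} [CommMonoid A] (x : MonoidAlgebra ℕ A) :
    mapSum (MonoidHom.id A) x = x := by
  rw [mapSum, MonoidAlgebra.mapDomainRingHom_id]
  rfl

theorem mapSum_comp {B C D : Blpr.{u}} (f : B ⟶ C) (g : C ⟶ D) (x : MonoidAlgebra ℕ B) :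
    mapSum (f ≫ g).toMonoidHom x = mapSum g.toMonoidHom (mapSum f.toMonoidHom x) :=
  (mapSum_mapSum _ _ x).symm

theorem induction_sum {A : Type*} {motive : MonoidAlgebra ℕ A → Prop}
    (x : MonoidAlgebra ℕ A) (zero : motive 0)
    (add : ∀ x y, motive x → motive y → motive (x + y)) (el : ∀ a, motive (Blpr.el a)) :
    motive x := by
  induction x using MonoidAlgebra.induction_linear with
  | zero => exact zero
  | add x y hx hy => exact add x y hx hy
  | single a n =>
    induction n with
    | zero => simpa using zero
    | succ n ih =>
      rw [MonoidAlgebra.single_add]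
      exact add _ _ ih (el a)

/-- A bijective morphism that reflects the pre-addition is an isomorphism. -/
theorem isIso_of_bijective {B C : Blpr.{u}} (f : B ⟶ C) (hf : Function.Bijective f)
    (hr : ∀ x y, C.rel (mapSum f.toMonoidHom x) (mapSum f.toMonoidHom y) → B.rel x y) :
    IsIso f := by
  let e : B ≃* C := MulEquiv.ofBijective f.toMonoidHom hf
  have he : ∀ x, mapSum f.toMonoidHom (mapSum e.symm.toMonoidHom x) = x := fun x => by
    rw [mapSum_mapSum]
    convert mapSum_id x using 3
    ext a
    exact e.apply_symm_apply a
  refine ⟨⟨⟨e.symm.toMonoidHom, fun x y h => hr _ _ ?_⟩, ?_, ?_⟩⟩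
  · rwa [he, he]
  · apply hom_ext
    intro a
    exact e.symm_apply_apply a
  · apply hom_ext
    intro a
    exact e.apply_symm_apply a

/-! ### Isomorphisms reflect units and relations -/

section Iso

variable {B C : Blpr.{u}} (f : B ⟶ C) [IsIso f]

theorem inv_apply_apply (a : B) : (CategoryTheory.inv f) (f a) = a :=
  hom_congr (IsIso.hom_inv_id f) a

theorem apply_inv_apply (a : C) : f ((CategoryTheory.inv f) a) = a :=
  hom_congr (IsIso.inv_hom_id f) a

theorem bijective_of_isIso : Function.Bijective f :=
  ⟨Function.LeftInverse.injective (inv_apply_apply f),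
    Function.RightInverse.surjective (apply_inv_apply f)⟩

theorem rel_of_isIso {x y : MonoidAlgebra ℕ B}
    (h : C.rel (mapSum f.toMonoidHom x) (mapSum f.toMonoidHom y)) : B.rel x y := by
  have h' := (CategoryTheory.inv f).map_rel _ _ h
  rw [← mapSum_comp, ← mapSum_comp, IsIso.hom_inv_id] at h'
  rwa [show mapSum (Hom.toMonoidHom (𝟙 B)) x = x from mapSum_id x,
    show mapSum (Hom.toMonoidHom (𝟙 B)) y = y from mapSum_id y] at h'

theorem isUnit_of_isIso {a : B} (h : IsUnit (f a)) : IsUnit a := by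
  have := h.map (CategoryTheory.inv f).toMonoidHom
  rwa [inv_apply_apply] at this

end Iso

/-! ### The semiring of a blueprint -/

/-- The semiring morphism `ℕ[A] → R` induced by a monoid morphism. -/
noncomputable def sumLift {A R : Type*} [CommMonoid A] [CommSemiring R] (f : A →* R) :
    MonoidAlgebra ℕ A →+* R := (MonoidAlgebra.lift ℕ R A f : MonoidAlgebra ℕ A →+* R)

@[simp]
theorem sumLift_el {A R : Type*} [CommMonoid A] [CommSemiring R] (f : A →* R) (a : A) :
    sumLift f (el a) = f a := by
  change MonoidAlgebra.lift ℕ R A f (el a) = f a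
  rw [MonoidAlgebra.lift_single, one_smul]

theorem sumLift_mapSum {A A' R : Type*} [CommMonoid A] [CommMonoid A'] [CommSemiring R]
    (f : A →* A') (g : A' →* R) (x : MonoidAlgebra ℕ A) :
    sumLift g (mapSum f x) = sumLift (g.comp f) x := by
  rw [← RingHom.comp_apply]
  congr 1
  refine mapSum_ringHom_ext fun a => ?_
  rw [RingHom.comp_apply, mapSum_el, sumLift_el, sumLift_el]
  rfl

theorem map_sumLift {A R R' : Type*} [CommMonoid A] [CommSemiring R] [CommSemiring R']
    (f : A →* R) (g : R →+* R') (x : MonoidAlgebra ℕ A) :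
    g (sumLift f x) = sumLift ((g : R →* R').comp f) x := by
  rw [← RingHom.comp_apply]
  congr 1
  refine mapSum_ringHom_ext fun a => ?_
  rw [RingHom.comp_apply, sumLift_el, sumLift_el]
  rfl

/-- The elements of the blueprint of `R`, as elements of `R`. -/
def unSemiring (R : Type u) [CommSemiring R] : ofSemiring R →* R := MonoidHom.id R

theorem ofSemiring_rel {R : Type u} [CommSemiring R] {x y : MonoidAlgebra ℕ (ofSemiring R)} :
    (ofSemiring R).rel x y ↔ sumLift (unSemiring R) x = sumLift (unSemiring R) y :=
  RingCon.ker_apply _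

/-- A morphism to the blueprint of a semiring. -/
noncomputable def toSemiring {B : Blpr.{u}} {R : Type u} [CommSemiring R] (f : B →* R)
    (hf : ∀ x y, B.rel x y → sumLift f x = sumLift f y) : B ⟶ ofSemiring R where
  toMonoidHom := f
  map_rel x y h :=
    ofSemiring_rel.2 ((sumLift_mapSum (A' := ofSemiring R) f (unSemiring R) x).trans
      ((hf x y h).trans (sumLift_mapSum (A' := ofSemiring R) f (unSemiring R) y).symm))

theorem toSemiring_rel {B : Blpr.{u}} {R : Type u} [CommSemiring R] (f : B ⟶ ofSemiring R)
    (x y : MonoidAlgebra ℕ B) (h : B.rel x y) :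
    sumLift ((unSemiring R).comp f.toMonoidHom) x =
      sumLift ((unSemiring R).comp f.toMonoidHom) y := by
  rw [← sumLift_mapSum, ← sumLift_mapSum]
  exact ofSemiring_rel.1 (f.map_rel x y h)

/-- The semiring `ℕ[A]/≡`. -/
abbrev Plus (B : Blpr.{u}) : Type u := B.rel.Quotient

noncomputable instance (B : Blpr.{u}) : CommSemiring B.Plus :=
  inferInstanceAs (CommSemiring B.rel.Quotient)

/-- The monoid morphism `A → ℕ[A]/≡`. -/
noncomputable def toPlus (B : Blpr.{u}) : B →* B.Plus :=
  (B.rel.mk' : MonoidAlgebra ℕ B →* B.Plus).comp (MonoidAlgebra.of ℕ B)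

theorem toPlus_apply (B : Blpr.{u}) (a : B) : B.toPlus a = B.rel.mk' (el a) := rfl

theorem sumLift_toPlus (B : Blpr.{u}) : sumLift B.toPlus = B.rel.mk' :=
  mapSum_ringHom_ext fun a => by rw [sumLift_el]; rfl

theorem rel_iff (B : Blpr.{u}) {x y : MonoidAlgebra ℕ B} :
    B.rel x y ↔ B.rel.mk' x = B.rel.mk' y := B.rel.eq.symm

/-- Turns relations between formal sums into equations in `ℕ[A]/≡`, where semiring arguments apply.
-/
theorem rel_iff_sumLift (B : Blpr.{u}) {x y : MonoidAlgebra ℕ B} :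
    B.rel x y ↔ sumLift B.toPlus x = sumLift B.toPlus y := by
  rw [rel_iff, sumLift_toPlus]

theorem plus_hom_ext {B : Blpr.{u}} {R : Type*} [CommSemiring R] {f g : B.Plus →+* R}
    (h : ∀ a, f (B.toPlus a) = g (B.toPlus a)) : f = g :=
  RingCon.Quotient.hom_ext (mapSum_ringHom_ext h)

/-- Semiring morphisms out of `ℕ[A]/≡`. -/
noncomputable def plusLift {B : Blpr.{u}} {R : Type*} [CommSemiring R] (f : B →* R)
    (hf : ∀ x y, B.rel x y → sumLift f x = sumLift f y) : B.Plus →+* R :=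
  B.rel.lift (sumLift f) (fun x y h => (RingCon.ker_apply _).2 (hf x y h))

theorem plusLift_toPlus {B : Blpr.{u}} {R : Type*} [CommSemiring R] (f : B →* R)
    (hf : ∀ x y, B.rel x y → sumLift f x = sumLift f y) (a : B) :
    plusLift f hf (B.toPlus a) = f a := by
  rw [toPlus_apply, plusLift, RingCon.lift_mk', sumLift_el]

theorem plusMap_aux {B C : Blpr.{u}} (f : B ⟶ C) (x y : MonoidAlgebra ℕ B) (h : B.rel x y) :
    sumLift (C.toPlus.comp f.toMonoidHom) x = sumLift (C.toPlus.comp f.toMonoidHom) y := by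
  rw [← sumLift_mapSum, ← sumLift_mapSum, ← rel_iff_sumLift]
  exact f.map_rel _ _ h

/-- The morphism of semirings induced by a morphism of blueprints. -/
noncomputable def plusMap {B C : Blpr.{u}} (f : B ⟶ C) : B.Plus →+* C.Plus :=
  plusLift (C.toPlus.comp f.toMonoidHom) (plusMap_aux f)

@[simp]
theorem plusMap_toPlus {B C : Blpr.{u}} (f : B ⟶ C) (a : B) :
    plusMap f (B.toPlus a) = C.toPlus (f a) := plusLift_toPlus _ _ _

theorem plusMap_mk {B C : Blpr.{u}} (f : B ⟶ C) (x : MonoidAlgebra ℕ B) :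
    plusMap f (B.rel.mk' x) = C.rel.mk' (mapSum f.toMonoidHom x) := by
  rw [← sumLift_toPlus, ← sumLift_toPlus, map_sumLift, sumLift_mapSum]
  congr 2
  ext a
  exact plusMap_toPlus f a

/-- A morphism of semirings as a morphism of blueprints. -/
noncomputable def ofSemiringMap {R R' : Type u} [CommSemiring R] [CommSemiring R'] (f : R →+* R') :
    ofSemiring R ⟶ ofSemiring R' :=
  toSemiring ((f : R →* R').comp (unSemiring R)) fun x y h => by
    rw [← map_sumLift, ← map_sumLift]
    exact congrArg f (ofSemiring_rel.1 h)

/-- Morphisms of semirings `ℕ[A]/≡ → R` are morphisms of blueprints to the blueprint of `R`. -/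
noncomputable def plusEquiv (B : Blpr.{u}) (R : Type u) [CommSemiring R] :
    (B.Plus →+* R) ≃ (B ⟶ ofSemiring R) where
  toFun f := toSemiring ((f : B.Plus →* R).comp B.toPlus) fun x y h => by
    rw [← map_sumLift, ← map_sumLift]
    exact congrArg _ (B.rel_iff_sumLift.1 h)
  invFun g := plusLift ((unSemiring R).comp g.toMonoidHom) (toSemiring_rel g)
  left_inv f := plus_hom_ext fun a => plusLift_toPlus _ _ a
  right_inv g := hom_ext fun a => plusLift_toPlus ((unSemiring R).comp g.toMonoidHom) (toSemiring_rel g) a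

theorem plusMap_id (B : Blpr.{u}) : plusMap (𝟙 B) = RingHom.id B.Plus :=
  plus_hom_ext fun a => plusMap_toPlus _ a

theorem plusMap_comp {B C D : Blpr.{u}} (f : B ⟶ C) (g : C ⟶ D) :
    plusMap (f ≫ g) = (plusMap g).comp (plusMap f) :=
  plus_hom_ext fun a => by
    rw [RingHom.comp_apply, plusMap_toPlus, plusMap_toPlus, plusMap_toPlus]
    rfl

/-- The functor `B ↦ ℕ[A]/≡`. -/
noncomputable def plusFunctor : Blpr.{u} ⥤ CommSemiRingCat.{u} where
  obj B := CommSemiRingCat.of B.Plus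
  map f := CommSemiRingCat.ofHom (plusMap f)
  map_id B := congrArg CommSemiRingCat.ofHom (plusMap_id B)
  map_comp f g := congrArg CommSemiRingCat.ofHom (plusMap_comp f g)

/-- The functor from semirings to blueprints. -/
noncomputable def ofSemiringFunctor : CommSemiRingCat.{u} ⥤ Blpr.{u} where
  obj R := ofSemiring R
  map f := ofSemiringMap f.hom

/-- The adjunction between blueprints and semirings. -/
noncomputable def plusAdjunction : plusFunctor.{u} ⊣ ofSemiringFunctor.{u} :=
  Adjunction.mkOfHomEquiv
    { homEquiv := fun B R =>
        { toFun := fun f => plusEquiv B R f.hom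
          invFun := fun g => CommSemiRingCat.ofHom ((plusEquiv B R).symm g)
          left_inv := fun f => CommSemiRingCat.hom_ext ((plusEquiv B R).symm_apply_apply f.hom)
          right_inv := fun g => (plusEquiv B R).apply_symm_apply g }
      homEquiv_naturality_left_symm := fun {B B' R} f g => by
        refine CommSemiRingCat.hom_ext ?_
        change (plusEquiv B R).symm (f ≫ g) = ((plusEquiv B' R).symm g).comp (plusMap f)
        rw [Equiv.symm_apply_eq]
        refine hom_ext fun a => ?_
        change g (f a) = (plusEquiv B' R).symm g (plusMap f (B.toPlus a))
        rw [plusMap_toPlus]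
        exact (plusLift_toPlus ((unSemiring R).comp g.toMonoidHom) (toSemiring_rel g) (f a)).symm
      homEquiv_naturality_right := fun _ _ => rfl }

/-- The underlying monoid. -/
def monoidFunctor : Blpr.{u} ⥤ CommMonCat.{u} where
  obj B := CommMonCat.of B
  map f := CommMonCat.ofHom f.toMonoidHom

/-- A monoid with the pre-addition that relates all formal sums. -/
noncomputable def ofMonoidTop (M : Type u) [CommMonoid M] : Blpr.{u} where
  carrier := M
  rel := ⊤

/-- The right adjoint of the functor to monoids. -/
noncomputable def ofMonoidTopFunctor : CommMonCat.{u} ⥤ Blpr.{u} where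
  obj M := ofMonoidTop M
  map f := ⟨f.hom, fun _ _ _ => trivial⟩

/-- The adjunction between blueprints and monoids. -/
noncomputable def monoidAdjunction : monoidFunctor.{u} ⊣ ofMonoidTopFunctor.{u} :=
  Adjunction.mkOfHomEquiv
    { homEquiv := fun _ _ =>
        { toFun := fun f => ⟨f.hom, fun _ _ _ => trivial⟩
          invFun := fun g => CommMonCat.ofHom g.toMonoidHom
          left_inv := fun _ => rfl
          right_inv := fun _ => rfl }
      homEquiv_naturality_left_symm := fun _ _ => rfl
      homEquiv_naturality_right := fun _ _ => rfl }

/-! ### Filtered colimits -/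

section Filtered

variable {J : Type u} [SmallCategory J] [IsFiltered J] {F : J ⥤ Blpr.{u}} {c : Cocone F}
  (hc : IsColimit c)

include hc in
-- The functor to monoids is a left adjoint, so the monoid of the colimit is the filtered colimit of
-- the monoids, which is computed on underlying sets.
theorem filtered_exists_rep (a : c.pt) : ∃ (j : J) (b : F.obj j), c.ι.app j b = a := by
  have := monoidAdjunction.{u}.leftAdjoint_preservesColimits
  exact Concrete.isColimit_exists_rep (F ⋙ monoidFunctor)
    (isColimitOfPreserves monoidFunctor hc) a

include hc in
theorem filtered_exists_eq {j : J} {a b : F.obj j} (h : c.ι.app j a = c.ι.app j b) :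
    ∃ (k : J) (f : j ⟶ k), F.map f a = F.map f b := by
  have := monoidAdjunction.{u}.leftAdjoint_preservesColimits
  obtain ⟨k, f, g, e⟩ := Concrete.isColimit_exists_of_rep_eq (F ⋙ monoidFunctor)
    (isColimitOfPreserves monoidFunctor hc) (i := j) (j := j) a b h
  -- The elements become equal along two possibly different transition maps; coequalizing these
  -- leaves a single one.
  refine ⟨IsFiltered.coeq f g, f ≫ IsFiltered.coeqHom f g, ?_⟩
  have e₁ : F.map (f ≫ IsFiltered.coeqHom f g) a = F.map (IsFiltered.coeqHom f g) (F.map f a) := by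
    rw [F.map_comp]; rfl
  have e₂ : F.map (f ≫ IsFiltered.coeqHom f g) b = F.map (IsFiltered.coeqHom f g) (F.map g b) := by
    rw [IsFiltered.coeq_condition, F.map_comp]; rfl
  rw [e₁, e₂]
  exact congrArg _ e

include hc in
-- A relation is an equation in `ℕ[A]/≡`. The functor `B ↦ ℕ[A]/≡` is a left adjoint, so the
-- equation lives in a filtered colimit of semirings and already holds at some stage.
theorem filtered_exists_rel {j : J} {v w : MonoidAlgebra ℕ (F.obj j)}
    (h : c.pt.rel (mapSum (c.ι.app j).toMonoidHom v) (mapSum (c.ι.app j).toMonoidHom w)) :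
    ∃ (k : J) (f : j ⟶ k),
      (F.obj k).rel (mapSum (F.map f).toMonoidHom v) (mapSum (F.map f).toMonoidHom w) := by
  have := plusAdjunction.{u}.leftAdjoint_preservesColimits
  rw [rel_iff, ← plusMap_mk, ← plusMap_mk] at h
  obtain ⟨k, f, g, e⟩ := Concrete.isColimit_exists_of_rep_eq (F ⋙ plusFunctor)
    (isColimitOfPreserves plusFunctor hc) (i := j) (j := j)
    ((F.obj j).rel.mk' v) ((F.obj j).rel.mk' w) h
  refine ⟨IsFiltered.coeq f g, f ≫ IsFiltered.coeqHom f g, ?_⟩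
  replace e : plusMap (F.map f) ((F.obj j).rel.mk' v) = plusMap (F.map g) ((F.obj j).rel.mk' w) := e
  rw [plusMap_mk, plusMap_mk, ← rel_iff] at e
  have e₁ := (F.map (IsFiltered.coeqHom f g)).map_rel _ _ e
  rw [← mapSum_comp, ← mapSum_comp, ← F.map_comp, ← F.map_comp, ← IsFiltered.coeq_condition] at e₁
  exact e₁

end Filtered

end Blpr

namespace Blpr

/-! ### The universal property of localizations -/

section Localization

variable (B : Blpr.{u}) (S : Submonoid B)

/-- The canonical morphism `B → S⁻¹B`. -/
noncomputable def locHom : B ⟶ B.localization S where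
  toMonoidHom := B.locMap S
  map_rel x y h := ⟨1, x, y, h,
    by rw [Submonoid.coe_one, map_one]; exact one_mul _,
    by rw [Submonoid.coe_one, map_one]; exact one_mul _⟩

theorem isUnit_locHom (s : S) : IsUnit (B.locHom S s) :=
  (Localization.monoidOf S).map_units s

theorem mk_mul_locHom (a : B) (s : S) :
    (Localization.mk a s : Localization S) * B.locMap S s = B.locMap S a := by
  rw [Localization.mk_eq_monoidOf_mk']
  exact (Localization.monoidOf S).mk'_spec a s

variable {B S}

theorem exists_mul_locHom (x : B.localization S) : ∃ (a : B) (s : S),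
    x * B.locHom S s = B.locHom S a := by
  induction x using Localization.induction_on with
  | H y => exact ⟨y.1, y.2, mk_mul_locHom B S _ _⟩

theorem locHom_eq_iff {a b : B} :
    B.locHom S a = B.locHom S b ↔ ∃ s : S, (s : B) * a = s * b :=
  (Localization.monoidOf S).eq_iff_exists

theorem localization_hom_ext {R : Blpr.{u}} {f g : B.localization S ⟶ R}
    (h : B.locHom S ≫ f = B.locHom S ≫ g) : f = g := by
  refine hom_ext fun x => ?_
  obtain ⟨a, s, e⟩ := exists_mul_locHom x
  have h₁ := congrArg f.toMonoidHom e
  have h₂ := congrArg g.toMonoidHom e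
  have h₃ : ∀ b, f (B.locHom S b) = g (B.locHom S b) := hom_congr h
  rw [map_mul] at h₁ h₂
  rw [h₃, h₃, ← h₂] at h₁
  exact ((isUnit_locHom B S s).map g.toMonoidHom).mul_right_cancel h₁

/-- The universal property of the localization. -/
noncomputable def locLift {R : Blpr.{u}} (f : B ⟶ R) (hf : ∀ s : S, IsUnit (f s)) :
    B.localization S ⟶ R where
  toMonoidHom := (Localization.monoidOf S).lift (g := f.toMonoidHom) hf
  map_rel := by
    rintro (x : MonoidAlgebra ℕ (Localization S)) (y : MonoidAlgebra ℕ (Localization S))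
      ⟨t, v, w, h, hv, hw⟩
    let φ : Localization S →* R := (Localization.monoidOf S).lift (g := f.toMonoidHom) hf
    have e : φ.comp (B.locMap S) = f.toMonoidHom := by
      ext a
      exact (Localization.monoidOf S).lift_eq hf a
    have et : φ (B.locMap S t) = f t := (Localization.monoidOf S).lift_eq hf t
    have key : ∀ (x : MonoidAlgebra ℕ (Localization S)) (v : MonoidAlgebra ℕ B),
        el (B.locMap S t) * x = mapSum (B.locMap S) v →
        el (f t) * mapSum φ x = mapSum f.toMonoidHom v := fun x v h => by
      rw [← et, ← e, ← mapSum_mapSum, ← h, map_mul, mapSum_el]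
    have hv' := key x v hv
    have hw' := key y w hw
    obtain ⟨u, hu⟩ := hf t
    have h' := R.rel.mul (R.rel.refl (el (↑u⁻¹ : R))) (f.map_rel _ _ h)
    rw [← hv', ← hw', ← mul_assoc, ← mul_assoc, ← el_mul, ← hu, Units.inv_mul] at h'
    have e1 : el (1 : R) = 1 := rfl
    rwa [e1, one_mul, one_mul] at h'

theorem locHom_locLift {R : Blpr.{u}} (f : B ⟶ R) (hf : ∀ s : S, IsUnit (f s)) :
    B.locHom S ≫ locLift f hf = f :=
  hom_ext fun a => (Localization.monoidOf S).lift_eq hf a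

theorem locLift_locHom {R : Blpr.{u}} (f : B ⟶ R) (hf : ∀ s : S, IsUnit (f s)) (a : B) :
    locLift f hf (B.locHom S a) = f a :=
  hom_congr (locHom_locLift f hf) a

/-- The definition of `locRel` allows any lifts of the two sums. Lifts of equal sums agree after
multiplication by a further element of `S` (`exists_of_mapSum_eq`), so they can be traded for `v`
and `w`. -/
theorem localization_rel_iff {v w : MonoidAlgebra ℕ B} :
    (B.localization S).rel (mapSum (B.locHom S).toMonoidHom v) (mapSum (B.locHom S).toMonoidHom w) ↔
      ∃ t : S, B.rel (el (t : B) * v) (el (t : B) * w) := by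
  constructor
  · rintro ⟨t, v', w', h, hv, hw⟩
    obtain ⟨s, hs⟩ := B.exists_of_mapSum_eq S (el (t : B) * v) v' (by
      rw [map_mul, mapSum_el]; exact hv)
    obtain ⟨s', hs'⟩ := B.exists_of_mapSum_eq S (el (t : B) * w) w' (by
      rw [map_mul, mapSum_el]; exact hw)
    refine ⟨s * s' * t, ?_⟩
    have e₁ : el ((s * s' * t : S) : B) * v = el (s' : B) * (el (s : B) * v') := by
      rw [← hs]
      simp only [Submonoid.coe_mul, el_mul]
      ring
    have e₂ : el ((s * s' * t : S) : B) * w = el (s : B) * (el (s' : B) * w') := by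
      rw [← hs']
      simp only [Submonoid.coe_mul, el_mul]
      ring
    rw [e₁, e₂, mul_left_comm]
    exact B.rel.mul (B.rel.refl _) (B.rel.mul (B.rel.refl _) h)
  · rintro ⟨t, h⟩
    exact ⟨t, _, _, h, by rw [map_mul, mapSum_el]; rfl, by rw [map_mul, mapSum_el]; rfl⟩

/-- The localizations of isomorphic blueprints are isomorphic. -/
theorem exists_localization_iso {B' : Blpr.{u}} (e : B ≅ B') (S : Submonoid B) :
    ∃ S' : Submonoid B', Nonempty (B.localization S ≅ B'.localization S') := by
  refine ⟨S.map e.hom.toMonoidHom, ⟨⟨locLift (e.hom ≫ B'.locHom _) ?_,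
    locLift (e.inv ≫ B.locHom _) ?_, ?_, ?_⟩⟩⟩
  · exact fun s => isUnit_locHom B' (S.map e.hom.toMonoidHom)
      ⟨e.hom s, Submonoid.mem_map_of_mem _ s.2⟩
  · rintro ⟨_, s, hs, rfl⟩
    have : e.inv (e.hom s) = s := hom_congr e.hom_inv_id s
    change IsUnit (B.locHom S (e.inv (e.hom s)))
    rw [this]
    exact isUnit_locHom B S ⟨s, hs⟩
  · refine localization_hom_ext ?_
    rw [← Category.assoc, locHom_locLift, Category.assoc, locHom_locLift, ← Category.assoc,
      e.hom_inv_id, Category.id_comp, Category.comp_id]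
  · refine localization_hom_ext ?_
    rw [← Category.assoc, locHom_locLift, Category.assoc, locHom_locLift, ← Category.assoc,
      e.inv_hom_id, Category.id_comp, Category.comp_id]

end Localization

/-! ### Products -/

section Product

variable {ι : Type u} (F : ι → Blpr.{u})

/-- The product of a family of blueprints. -/
noncomputable def pi : Blpr.{u} where
  carrier := ∀ i, F i
  rel :=
    { r := fun x y => ∀ i, ((F i).rel.comap (mapSum (Pi.evalMonoidHom (fun i => F i) i))) x y
      iseqv := ⟨fun _ _ => RingCon.refl _ _, fun h p => RingCon.symm _ (h p),
        fun h h' p => RingCon.trans _ (h p) (h' p)⟩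
      mul' := fun h h' p => RingCon.mul _ (h p) (h' p)
      add' := fun h h' p => RingCon.add _ (h p) (h' p) }

/-- The projections of the product. -/
noncomputable def piProj (i : ι) : pi F ⟶ F i :=
  ⟨Pi.evalMonoidHom (fun i => F i) i, fun _ _ h => h i⟩

theorem pi_rel {x y : MonoidAlgebra ℕ (pi F)} : (pi F).rel x y ↔
    ∀ i, (F i).rel (mapSum (piProj F i).toMonoidHom x) (mapSum (piProj F i).toMonoidHom y) :=
  Iff.rfl

variable {F}

/-- The universal property of the product. -/
noncomputable def piLift {B : Blpr.{u}} (f : ∀ i, B ⟶ F i) : B ⟶ pi F where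
  toMonoidHom := MonoidHom.pi fun i => (f i).toMonoidHom
  map_rel x y h := (pi_rel F).2 fun i => by
    have e : ∀ x, mapSum (piProj F i).toMonoidHom (mapSum (A₂ := pi F)
        (MonoidHom.pi fun i => (f i).toMonoidHom) x) = mapSum (f i).toMonoidHom x :=
      fun x => mapSum_mapSum (A₂ := pi F) _ _ x
    exact (e x).symm ▸ (e y).symm ▸ (f i).map_rel x y h

theorem pi_hom_ext {B : Blpr.{u}} {f g : B ⟶ pi F} (h : ∀ i, f ≫ piProj F i = g ≫ piProj F i) :
    f = g :=
  hom_ext fun b => funext fun i => hom_congr (h i) b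

end Product

/-! ### Ideals -/

section Ideals

theorem formalSum_add {A : Type*} (s t : Multiset A) :
    formalSum (s + t) = formalSum s + formalSum t := by
  simp [formalSum]

theorem sumLift_formalSum {A R : Type*} [CommMonoid A] [CommSemiring R] (f : A →* R)
    (s : Multiset A) : sumLift f (formalSum s) = (s.map f).sum := by
  rw [formalSum, map_multiset_sum, Multiset.map_map]
  congr 1
  exact Multiset.map_congr rfl fun a _ => sumLift_el f a

theorem el_mul_formalSum {A : Type*} [CommMonoid A] (a : A) (s : Multiset A) :
    el a * formalSum s = formalSum (s.map (a * ·)) := by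
  rw [formalSum, formalSum, ← Multiset.sum_map_mul_left, Multiset.map_map]
  congr 1
  exact Multiset.map_congr rfl fun b _ => (el_mul a b).symm

theorem linearExt_add {A : Type*} {r : A → A → Prop} {x y x' y' : MonoidAlgebra ℕ A}
    (h : linearExt r x y) (h' : linearExt r x' y') : linearExt r (x + x') (y + y') := by
  obtain ⟨s, hs, rfl, rfl⟩ := h
  obtain ⟨t, ht, rfl, rfl⟩ := h'
  refine ⟨s + t, fun p hp => (Multiset.mem_add.1 hp).elim (hs p) (ht p), ?_, ?_⟩ <;>
    rw [Multiset.map_add, formalSum_add]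

theorem linearExt_refl {A : Type*} {r : A → A → Prop} (hr : ∀ a, r a a)
    (x : MonoidAlgebra ℕ A) : linearExt r x x := by
  induction x using induction_sum with
  | zero => exact ⟨0, by simp, by simp [formalSum], by simp [formalSum]⟩
  | add x y hx hy => exact linearExt_add hx hy
  | el a => exact ⟨{(a, a)}, by simp [hr], by simp [formalSum], by simp [formalSum]⟩

theorem linearExt_el_mul {A : Type*} [CommMonoid A] {r : A → A → Prop}
    (hr : ∀ a b c, r b c → r (a * b) (a * c)) (a : A) {x y : MonoidAlgebra ℕ A}
    (h : linearExt r x y) : linearExt r (el a * x) (el a * y) := by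
  obtain ⟨s, hs, rfl, rfl⟩ := h
  refine ⟨s.map fun p => (a * p.1, a * p.2), fun p hp => ?_, ?_, ?_⟩
  · obtain ⟨q, hq, rfl⟩ := Multiset.mem_map.1 hp
    exact hr _ _ _ (hs q hq)
  · rw [el_mul_formalSum, Multiset.map_map, Multiset.map_map]; rfl
  · rw [el_mul_formalSum, Multiset.map_map, Multiset.map_map]; rfl

variable {B : Blpr.{u}}

/-- The elementary relations that generate `∼_I`. -/
def idealStep (I : Set B) (x y : MonoidAlgebra ℕ B) : Prop :=
  B.rel x y ∨ linearExt (fun c d : B => c = d ∨ (c ∈ I ∧ d ∈ I)) x y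

theorem idealStep_add {I : Set B} {x y : MonoidAlgebra ℕ B} (z : MonoidAlgebra ℕ B)
    (h : idealStep I x y) : idealStep I (x + z) (y + z) :=
  h.imp (fun h => B.rel.add h (B.rel.refl z))
    (fun h => linearExt_add h (linearExt_refl (r := fun c d : B => c = d ∨ (c ∈ I ∧ d ∈ I))
      (fun _ => Or.inl rfl) z))

/-- Together with `eqvGen_idealStep_mul` this makes `∼_I` a congruence, so that `ℕ[A]/∼_I` is a
semiring. Ideals can then be handled through morphisms to semirings. -/
theorem eqvGen_idealStep_add {I : Set B} {x y x' y' : MonoidAlgebra ℕ B}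
    (h : Relation.EqvGen (idealStep I) x y) (h' : Relation.EqvGen (idealStep I) x' y') :
    Relation.EqvGen (idealStep I) (x + x') (y + y') := by
  have key : ∀ {x y : MonoidAlgebra ℕ B} (z : MonoidAlgebra ℕ B),
      Relation.EqvGen (idealStep I) x y → Relation.EqvGen (idealStep I) (x + z) (y + z) := by
    intro x y z h
    induction h with
    | rel x y h => exact .rel _ _ (idealStep_add z h)
    | refl x => exact .refl _
    | symm x y _ ih => exact .symm _ _ ih
    | trans x y w _ _ ih ih' => exact .trans _ _ _ ih ih'
  refine .trans _ _ _ (key x' h) ?_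
  rw [add_comm y x', add_comm y y']
  exact key y h'

/-- By additivity it suffices to multiply by a single element of `A`, and the elementary steps are
stable under this because `I` is. -/
theorem eqvGen_idealStep_mul {I : Set B} (hI : ∀ a b : B, a ∈ I → a * b ∈ I)
    {x y x' y' : MonoidAlgebra ℕ B}
    (h : Relation.EqvGen (idealStep I) x y) (h' : Relation.EqvGen (idealStep I) x' y') :
    Relation.EqvGen (idealStep I) (x * x') (y * y') := by
  have key : ∀ (z : MonoidAlgebra ℕ B) {x y : MonoidAlgebra ℕ B},
      Relation.EqvGen (idealStep I) x y → Relation.EqvGen (idealStep I) (z * x) (z * y) := by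
    intro z x y h
    induction z using induction_sum with
    | zero => rw [zero_mul, zero_mul]; exact .refl _
    | add z w hz hw => rw [add_mul, add_mul]; exact eqvGen_idealStep_add hz hw
    | el a =>
      induction h with
      | rel x y h =>
        refine .rel _ _ (h.imp (fun h => B.rel.mul (B.rel.refl _) h) fun h =>
          linearExt_el_mul ?_ a h)
        rintro a b c (h | h)
        · exact Or.inl (by rw [h])
        · exact Or.inr ⟨by rw [mul_comm]; exact hI _ _ h.1, by rw [mul_comm]; exact hI _ _ h.2⟩
      | refl x => exact .refl _
      | symm x y _ ih => exact .symm _ _ ih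
      | trans x y w _ _ ih ih' => exact .trans _ _ _ ih ih'
  refine .trans _ _ _ (key x h') ?_
  rw [mul_comm x y', mul_comm y y']
  exact key _ h

/-- A subset that is cut out by a morphism to a semiring which is constant on it is an ideal. -/
theorem isIdeal_of_hom {R : Type u} [CommSemiring R] (f : B ⟶ ofSemiring R) {I : Set B}
    (mul_mem : ∀ a b : B, a ∈ I → a * b ∈ I) (zero_mem : ∀ e : B, B.IsZeroElem e → e ∈ I)
    (hf : ∀ a ∈ I, ∀ b, b ∈ I ↔ f b = f a) : B.IsIdeal I := by
  refine ⟨mul_mem, zero_mem, fun a b h hb => (hf b hb a).2 ?_⟩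
  -- The induced map on formal sums does not see elementary steps: relations become equations, and
  -- exchanging elements of `I` changes nothing as `f` is constant on `I`.
  have key : ∀ x y, Relation.EqvGen (idealStep I) x y →
      sumLift ((unSemiring R).comp f.toMonoidHom) x =
        sumLift ((unSemiring R).comp f.toMonoidHom) y := by
    intro x y h
    induction h with
    | rel x y h =>
      rcases h with h | ⟨s, hs, rfl, rfl⟩
      · exact toSemiring_rel f _ _ h
      · rw [sumLift_formalSum, sumLift_formalSum, Multiset.map_map, Multiset.map_map]
        congr 1
        refine Multiset.map_congr rfl fun p hp => ?_
        rcases hs p hp with h | h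
        · exact congrArg _ h
        · exact congrArg (unSemiring R) ((hf p.2 h.2 p.1).1 h.1)
    | refl x => rfl
    | symm x y _ ih => exact ih.symm
    | trans x y z _ _ ih ih' => exact ih.trans ih'
  have := key _ _ h
  rwa [sumLift_el, sumLift_el] at this

/-- Every ideal is cut out by a morphism to a semiring which is constant on it. -/
theorem IsIdeal.exists_hom {I : Set B} (hI : B.IsIdeal I) :
    ∃ (R : Type u) (_ : CommSemiring R) (f : B ⟶ ofSemiring R),
      ∀ a ∈ I, ∀ b, b ∈ I ↔ f b = f a := by
  let c : RingCon (MonoidAlgebra ℕ B) :=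
    { r := Relation.EqvGen (idealStep I)
      iseqv := Relation.EqvGen.is_equivalence _
      mul' := eqvGen_idealStep_mul hI.mul_mem
      add' := eqvGen_idealStep_add }
  refine ⟨c.Quotient, inferInstance,
    toSemiring ((c.mk' : MonoidAlgebra ℕ B →* c.Quotient).comp (MonoidAlgebra.of ℕ B))
      fun x y h => ?_, fun a ha b => ?_⟩
  · have e : sumLift ((c.mk' : MonoidAlgebra ℕ B →* c.Quotient).comp (MonoidAlgebra.of ℕ B)) =
        c.mk' := mapSum_ringHom_ext (R := c.Quotient) fun a => by rw [sumLift_el]; rfl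
    rw [e]
    exact c.eq.2 (.rel _ _ (Or.inl h))
  · have e : c.mk' (el b) = c.mk' (el a) ↔ Relation.EqvGen (idealStep I) (el b) (el a) := c.eq
    refine Iff.trans ⟨fun hb => ?_, fun h => hI.mem_of_rel b a h ha⟩ e.symm
    exact .rel _ _ (Or.inr ⟨{(b, a)}, by simp [ha, hb], by simp [formalSum], by simp [formalSum]⟩)

/-- The inverse image of an ideal is an ideal. -/
theorem IsIdeal.preimage {C : Blpr.{u}} (f : B ⟶ C) {I : Set C} (hI : C.IsIdeal I) :
    B.IsIdeal (f ⁻¹' I) := by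
  obtain ⟨R, _, g, hg⟩ := hI.exists_hom
  refine isIdeal_of_hom (f ≫ g) (fun a b ha => ?_) (fun e he => hI.zero_mem _ ?_)
    fun a ha b => hg _ ha _
  · rw [Set.mem_preimage, map_mul]
    exact hI.mul_mem _ _ ha
  · have := f.map_rel _ _ he
    rwa [mapSum_el, map_zero] at this

/-- The elements that are not invertible form an ideal. -/
def IsStrictlyLocal (B : Blpr.{u}) : Prop := B.IsIdeal {a | ¬ IsUnit a}

theorem IsIdeal.eq_univ {I : Set B} (hI : B.IsIdeal I) {a : B} (ha : a ∈ I) (hu : IsUnit a) :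
    I = Set.univ := by
  refine Set.eq_univ_of_forall fun b => ?_
  obtain ⟨c, hc⟩ := hu.exists_right_inv
  have := hI.mul_mem a (c * b) ha
  rwa [← mul_assoc, hc, one_mul] at this

/-- A proper ideal contains no unit, so an ideal formed by all non-units is the largest proper
ideal. -/
theorem IsStrictlyLocal.isMaximalIdeal_iff (hB : B.IsStrictlyLocal) {m : Set B} :
    B.IsMaximalIdeal m ↔ m = {a | ¬ IsUnit a} := by
  have hne : {a : B | ¬ IsUnit a} ≠ Set.univ := fun h =>
    (h.symm ▸ Set.mem_univ (1 : B) : (1 : B) ∈ {a : B | ¬ IsUnit a}) isUnit_one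
  constructor
  · intro hm
    exact hm.eq_of_subset _ hB hne fun a ha hu => hm.ne_univ (hm.toIsIdeal.eq_univ ha hu)
  · rintro rfl
    refine ⟨hB, hne, fun I hI hI' h => h.antisymm fun a ha hu => hI' (hI.eq_univ ha hu)⟩

theorem IsStrictlyLocal.isLocal (hB : B.IsStrictlyLocal) : B.IsLocal :=
  ⟨_, hB.isMaximalIdeal_iff.2 rfl, fun _ h => hB.isMaximalIdeal_iff.1 h⟩

theorem IsStrictlyLocal.of_iso {C : Blpr.{u}} (hC : C.IsStrictlyLocal) (f : B ⟶ C) [IsIso f] :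
    B.IsStrictlyLocal := by
  have := hC.preimage f
  refine Eq.subst (motive := B.IsIdeal) (Set.ext fun a => ?_) this
  exact not_congr ⟨isUnit_of_isIso f, fun h => h.map f.toMonoidHom⟩

/-- A morphism that reflects invertible elements. -/
def IsLoc {B C : Blpr.{u}} (f : B ⟶ C) : Prop := ∀ a, IsUnit (f a) → IsUnit a

theorem IsLoc.comp {B C D : Blpr.{u}} {f : B ⟶ C} {g : C ⟶ D} (hf : IsLoc f) (hg : IsLoc g) :
    IsLoc (f ≫ g) := fun a h => hf a (hg _ h)

theorem isLoc_id (B : Blpr.{u}) : IsLoc (𝟙 B) := fun _ h => h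

theorem isLoc_of_isIso {B C : Blpr.{u}} (f : B ⟶ C) [IsIso f] : IsLoc f :=
  fun _ => isUnit_of_isIso f

theorem IsLoc.of_comp {B C D : Blpr.{u}} {f : B ⟶ C} {g : C ⟶ D} (h : IsLoc (f ≫ g)) :
    IsLoc f := fun a ha => h a (ha.map g.toMonoidHom)

/-- The prime ideal of a morphism to a strictly local blueprint. -/
def primeOf {L : Blpr.{u}} (hL : L.IsStrictlyLocal) (f : B ⟶ L) : PrimeSpec B where
  ideal := {b | ¬ IsUnit (f b)}
  isPrime :=
    { hL.preimage f with
      one_notMem := fun h => h (by rw [map_one]; exact isUnit_one)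
      mul_notMem := fun a b ha hb h => by
        refine h ?_
        rw [map_mul]
        exact (not_not.1 ha).mul (not_not.1 hb) }

/-- The local blueprint of a prime ideal. -/
noncomputable abbrev atPrime (B : Blpr.{u}) (p : PrimeSpec B) : Blpr.{u} :=
  B.localization p.compl

theorem mem_compl {p : PrimeSpec B} {a : B} : a ∈ p.compl ↔ a ∉ p.ideal := Iff.rfl

theorem mul_mem_ideal_right {p : PrimeSpec B} {a b : B} (h : b ∈ p.ideal) : a * b ∈ p.ideal := by
  rw [mul_comm]
  exact p.isPrime.mul_mem _ _ h

theorem mem_of_mul_mem {p : PrimeSpec B} {a b : B} (ha : a ∉ p.ideal) (h : a * b ∈ p.ideal) :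
    b ∈ p.ideal := by
  by_contra hb
  exact p.isPrime.mul_notMem a b ha hb h

theorem isUnit_atPrime_iff {p : PrimeSpec B} {a : B} :
    IsUnit (B.locHom p.compl a) ↔ a ∉ p.ideal := by
  refine ⟨fun h ha => ?_, fun h => isUnit_locHom B p.compl ⟨a, h⟩⟩
  obtain ⟨x, hx⟩ := h.exists_right_inv
  obtain ⟨b, s, e⟩ := exists_mul_locHom x
  have : B.locHom p.compl (a * b) = B.locHom p.compl s := by
    rw [map_mul, ← e, ← mul_assoc, hx, one_mul]
  obtain ⟨t, ht⟩ := locHom_eq_iff.1 this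
  refine p.isPrime.mul_notMem _ _ t.2 s.2 ?_
  rw [← ht]
  exact mul_mem_ideal_right (p.isPrime.mul_mem _ _ ha)

theorem isUnit_atPrime_of_mul_eq {p : PrimeSpec B} {x : B.atPrime p} {a : B} {s : p.compl}
    (h : x * B.locHom p.compl s = B.locHom p.compl a) : IsUnit x ↔ a ∉ p.ideal := by
  rw [← isUnit_atPrime_iff, ← h]
  exact ⟨fun hx => hx.mul (isUnit_locHom B _ s), fun hx => isUnit_of_mul_isUnit_left hx⟩

/-- Cut `p` out by a morphism `f : B → R` that is constant on `p`, and localize `R` at the image of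
the complement of `p`. The resulting morphism extends to `B_p`. After clearing denominators, being a
non-unit means having numerator in `p`, so the extension is constant exactly on the non-units, and
`isIdeal_of_hom` applies. -/
theorem atPrime_isStrictlyLocal (p : PrimeSpec B) : (B.atPrime p).IsStrictlyLocal := by
  obtain ⟨R, _, f, hf⟩ := p.isPrime.exists_hom
  let T : Submonoid R := p.compl.map ((unSemiring R).comp f.toMonoidHom)
  let g : B ⟶ ofSemiring (Localization T) :=
    f ≫ ofSemiringMap (algebraMap R (Localization T))
  have hg : ∀ a b, g a = g b ↔ ∃ t ∈ p.compl, f (t * a) = f (t * b) := fun a b => by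
    refine (IsLocalization.eq_iff_exists (S := Localization T) T).trans ⟨?_, ?_⟩
    · rintro ⟨⟨_, t, ht, rfl⟩, h⟩
      refine ⟨t, ht, ?_⟩
      rw [map_mul, map_mul]
      exact h
    · rintro ⟨t, ht, h⟩
      refine ⟨⟨_, t, ht, rfl⟩, ?_⟩
      rw [map_mul, map_mul] at h
      exact h
  have hu : ∀ s : p.compl, IsUnit (g s) := fun s =>
    IsLocalization.map_units (Localization T) (⟨f s, s, s.2, rfl⟩ : T)
  -- Passing to the localization does not enlarge the fibre that contains `p`, because `t * b ∈ p`
  -- with `t ∉ p` forces `b ∈ p`.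
  have hg' : ∀ a b : B, a ∈ p.ideal → (g b = g a ↔ b ∈ p.ideal) := fun a b ha => by
    rw [hg]
    constructor
    · rintro ⟨t, ht, h⟩
      exact mem_of_mul_mem ht ((hf _ (mul_mem_ideal_right ha) _).2 h)
    · intro hb
      exact ⟨1, one_mem _, by rw [one_mul, one_mul]; exact (hf a ha b).1 hb⟩
  refine isIdeal_of_hom (locLift g hu) (fun a b ha h => ha (isUnit_of_mul_isUnit_left h))
    (fun e he hu' => ?_) fun x hx y => ?_
  · obtain ⟨a, s, h⟩ := exists_mul_locHom e
    have h' : (B.atPrime p).rel (mapSum (B.locHom p.compl).toMonoidHom (el a))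
        (mapSum (B.locHom p.compl).toMonoidHom 0) := by
      rw [mapSum_el, ← h, el_mul, map_zero]
      have := (B.atPrime p).rel.mul he ((B.atPrime p).rel.refl (el (B.locHom p.compl s)))
      rwa [zero_mul] at this
    obtain ⟨t, ht⟩ := localization_rel_iff.1 h'
    rw [mul_zero, ← el_mul] at ht
    exact ((isUnit_atPrime_of_mul_eq h).1 hu') (mem_of_mul_mem t.2 (p.isPrime.zero_mem _ ht))
  · obtain ⟨a, s, h⟩ := exists_mul_locHom x
    obtain ⟨b, t, h'⟩ := exists_mul_locHom y
    have ha : a ∈ p.ideal := not_not.1 fun ha => hx ((isUnit_atPrime_of_mul_eq h).2 ha)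
    -- Both values are multiplied by the common denominator `s * t`, which reduces the comparison to
    -- numerators.
    change ¬ IsUnit y ↔ _
    rw [isUnit_atPrime_of_mul_eq h', not_not, ← (hu (s * t)).mul_left_inj]
    have e₁ : locLift g hu y * g ↑(s * t) = g (s * b) := by
      rw [Submonoid.coe_mul, map_mul, map_mul, ← locLift_locHom g hu b, ← h', map_mul,
        locLift_locHom]
      exact mul_left_comm _ _ _
    have e₂ : locLift g hu x * g ↑(s * t) = g (t * a) := by
      rw [Submonoid.coe_mul, map_mul, map_mul, ← locLift_locHom g hu a, ← h, map_mul,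
        locLift_locHom, mul_comm (g t)]
      exact (mul_assoc _ _ _).symm
    rw [e₁, e₂, hg' _ _ (mul_mem_ideal_right ha)]
    exact ⟨mul_mem_ideal_right, mem_of_mul_mem s.2⟩

end Ideals

end Blpr

namespace Blpr

/-! ### Sheaves of blueprints -/

section Presheaf

variable {X : TopCat.{u}} (F : TopCat.Presheaf Blpr.{u} X)

theorem germ_exists_rep (x : X) (a : F.stalk x) :
    ∃ (U : Opens X) (hx : x ∈ U) (s : F.obj (op U)), F.germ U x hx s = a := by
  obtain ⟨j, b, e⟩ := filtered_exists_rep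
    (colimit.isColimit ((OpenNhds.inclusion x).op ⋙ F)) a
  exact ⟨j.unop.1, j.unop.2, b, e⟩

theorem germ_exists_eq {U : Opens X} {x : X} (hx : x ∈ U) {s t : F.obj (op U)}
    (h : F.germ U x hx s = F.germ U x hx t) :
    ∃ (V : Opens X) (i : V ⟶ U), x ∈ V ∧ F.map i.op s = F.map i.op t := by
  obtain ⟨k, f, e⟩ := filtered_exists_eq
    (colimit.isColimit ((OpenNhds.inclusion x).op ⋙ F)) (j := op ⟨U, hx⟩) h
  exact ⟨k.unop.1, (OpenNhds.inclusion x).map f.unop, k.unop.2, e⟩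

theorem germ_exists_rel {U : Opens X} {x : X} (hx : x ∈ U) {v w : MonoidAlgebra ℕ (F.obj (op U))}
    (h : (F.stalk x).rel (mapSum (F.germ U x hx).toMonoidHom v)
      (mapSum (F.germ U x hx).toMonoidHom w)) :
    ∃ (V : Opens X) (i : V ⟶ U), x ∈ V ∧
      (F.obj (op V)).rel (mapSum (F.map i.op).toMonoidHom v) (mapSum (F.map i.op).toMonoidHom w) := by
  obtain ⟨k, f, e⟩ := filtered_exists_rel
    (colimit.isColimit ((OpenNhds.inclusion x).op ⋙ F)) (j := op ⟨U, hx⟩) h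
  exact ⟨k.unop.1, (OpenNhds.inclusion x).map f.unop, k.unop.2, e⟩

theorem germ_res_apply' {U V : Opens X} (i : V ⟶ U) {x : X} (hx : x ∈ V) (s : F.obj (op U)) :
    F.germ V x hx (F.map i.op s) = F.germ U x (i.le hx) s :=
  hom_congr (F.germ_res i x hx) s

/-- The blueprint freely generated by one element. -/
noncomputable def freeOne : Blpr.{u} where
  carrier := Multiplicative (ULift.{u} ℕ)
  rel := ⊥

/-- The morphism that maps the generator to a given element. -/
noncomputable def freeOneHom {B : Blpr.{u}} (b : B) : freeOne.{u} ⟶ B where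
  toMonoidHom :=
    { toFun := fun n => b ^ (Multiplicative.toAdd n).down
      map_one' := pow_zero b
      map_mul' := fun m n => pow_add b _ _ }
  map_rel x y h := by
    have h' : x = y := h
    rw [h']
    exact B.rel.refl _

/-- The generator. -/
def freeOneGen : freeOne.{u} := Multiplicative.ofAdd (ULift.up 1)

theorem freeOneHom_gen {B : Blpr.{u}} (b : B) : freeOneHom b freeOneGen = b := pow_one b

theorem freeOne_hom_ext {B : Blpr.{u}} {f g : freeOne.{u} ⟶ B} (h : f freeOneGen = g freeOneGen) :
    f = g := by
  refine hom_ext fun n => ?_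
  have e : n = freeOneGen ^ (Multiplicative.toAdd (α := ULift.{u} ℕ) n).down := by
    induction n using Multiplicative.rec with
    | ofAdd n =>
      obtain ⟨n⟩ := n
      change _ = Multiplicative.ofAdd (n • ULift.up 1)
      congr 1
      refine ULift.ext _ _ ?_
      simp
  rw [e, map_pow, map_pow, h]

variable {F} (hF : F.IsSheaf)

theorem mem_grothendieck_of_forall {U : Opens X} (S : Sieve U)
    (hS : ∀ x ∈ U, ∃ (V : Opens X) (i : V ⟶ U), x ∈ V ∧ S i) :
    S ∈ Opens.grothendieckTopology X U := fun x hx => by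
  obtain ⟨V, i, h, h'⟩ := hS x hx
  exact ⟨V, i, h', h⟩

include hF in
-- The sheaf condition concerns morphisms from an arbitrary blueprint into the sections. Taking
-- `freeOne` as source, whose morphisms are the elements of the target, gives the condition for
-- elements.
theorem sheaf_eq {U : Opens X} {s t : F.obj (op U)}
    (h : ∀ x ∈ U, ∃ (V : Opens X) (i : V ⟶ U), x ∈ V ∧ F.map i.op s = F.map i.op t) : s = t := by
  let S : Sieve U :=
    { arrows := fun V i => F.map i.op s = F.map i.op t
      downward_closed := fun {V W} i hi j => by
        have := congrArg (F.map j.op).toMonoidHom hi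
        rw [op_comp, F.map_comp]
        exact this }
  have hs := (hF freeOne S (mem_grothendieck_of_forall S h)).isSeparatedFor
  have key : freeOneHom s = freeOneHom t := by
    refine hs.ext fun V i hi => freeOne_hom_ext ?_
    change F.map i.op (freeOneHom s freeOneGen) = F.map i.op (freeOneHom t freeOneGen)
    rw [freeOneHom_gen, freeOneHom_gen]
    exact hi
  rw [← freeOneHom_gen s, key, freeOneHom_gen]

include hF in
-- Test the sheaf condition on `E`, the monoid of sections over `U` with the relations that hold on
-- all members of the sieve. The restrictions `E → F(V)` glue to a morphism `E → F(U)`. By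
-- `sheaf_eq` it is the identity on elements, so every relation of `E` holds in `F(U)`.
theorem sheaf_rel {U : Opens X} {v w : MonoidAlgebra ℕ (F.obj (op U))}
    (h : ∀ x ∈ U, ∃ (V : Opens X) (i : V ⟶ U), x ∈ V ∧ (F.obj (op V)).rel
      (mapSum (F.map i.op).toMonoidHom v) (mapSum (F.map i.op).toMonoidHom w)) :
    (F.obj (op U)).rel v w := by
  let S : Sieve U :=
    { arrows := fun V i => (F.obj (op V)).rel
        (mapSum (F.map i.op).toMonoidHom v) (mapSum (F.map i.op).toMonoidHom w)
      downward_closed := fun {V W} i hi j => by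
        have := (F.map j.op).map_rel _ _ hi
        rw [op_comp, F.map_comp, mapSum_comp, mapSum_comp]
        exact this }
  let E : Blpr.{u} :=
    { carrier := F.obj (op U)
      rel :=
        { r := fun x y => ∀ (V : Opens X) (i : V ⟶ U), S i →
            ((F.obj (op V)).rel.comap (mapSum (F.map i.op).toMonoidHom)) x y
          iseqv := ⟨fun _ _ _ _ => RingCon.refl _ _, fun h V i hi => RingCon.symm _ (h V i hi),
            fun h h' V i hi => RingCon.trans _ (h V i hi) (h' V i hi)⟩
          mul' := fun h h' V i hi => RingCon.mul _ (h V i hi) (h' V i hi)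
          add' := fun h h' V i hi => RingCon.add _ (h V i hi) (h' V i hi) } }
  let fam : Presieve.FamilyOfElements (F ⋙ coyoneda.obj (op E)) S.arrows := fun V i hi =>
    (⟨(F.map i.op).toMonoidHom, fun x y hxy => hxy V i hi⟩ : E ⟶ F.obj (op V))
  have hfam : fam.Compatible := by
    intro V W Z i j f g hf hg e
    refine hom_ext fun a => ?_
    change F.map i.op (F.map f.op a) = F.map j.op (F.map g.op a)
    have e₁ : F.map f.op ≫ F.map i.op = F.map g.op ≫ F.map j.op := by
      rw [← F.map_comp, ← F.map_comp, ← op_comp, ← op_comp, e]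
    exact hom_congr e₁ a
  obtain ⟨g, hg, -⟩ := hF E S (mem_grothendieck_of_forall S h) fam hfam
  replace hg : ∀ (V : Opens X) (i : V ⟶ U) (hi : S i),
      (g : E ⟶ F.obj (op U)) ≫ F.map i.op = fam i hi :=
    fun V i hi => hg i hi
  have hid : (g : E ⟶ F.obj (op U)).toMonoidHom = MonoidHom.id (F.obj (op U)) := by
    refine MonoidHom.ext fun a => sheaf_eq hF fun x hx => ?_
    obtain ⟨V, i, hxV, hi⟩ := h x hx
    exact ⟨V, i, hxV, hom_congr (hg V i hi) a⟩
  have := Hom.map_rel (g : E ⟶ F.obj (op U)) v w fun V i hi => hi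
  rw [hid, mapSum_id, mapSum_id] at this
  exact this

include hF in
-- The open sets on which the germs come from a section form a covering sieve. Sections with equal
-- germs are equal, so chosen ones are compatible; they glue as morphisms from `freeOne`.
theorem sheaf_glue {U : Opens X} (t : ∀ x : U, F.stalk x.1)
    (h : ∀ x ∈ U, ∃ (V : Opens X) (_ : V ⟶ U) (s : F.obj (op V)), x ∈ V ∧
      ∀ (y : X) (hy : y ∈ V) (hy' : y ∈ U), F.germ V y hy s = t ⟨y, hy'⟩) :
    ∃ s : F.obj (op U), ∀ y : U, F.germ U y.1 y.2 s = t y := by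
  let S : Sieve U :=
    { arrows := fun V i => ∃ s : F.obj (op V), ∀ (y : X) (hy : y ∈ V),
        F.germ V y hy s = t ⟨y, i.le hy⟩
      downward_closed := fun {V W} i hi j => by
        obtain ⟨s, hs⟩ := hi
        exact ⟨F.map j.op s, fun y hy => (germ_res_apply' F j hy s).trans (hs y _)⟩ }
  have hS : S ∈ Opens.grothendieckTopology X U := mem_grothendieck_of_forall S fun x hx => by
    obtain ⟨V, i, s, hxV, hs⟩ := h x hx
    exact ⟨V, i, hxV, s, fun y hy => hs y hy _⟩
  let fam : Presieve.FamilyOfElements (F ⋙ coyoneda.obj (op freeOne.{u})) S.arrows :=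
    fun V i hi => freeOneHom hi.choose
  have hfam : fam.Compatible := by
    intro V W Z i j f g hf hg e
    refine freeOne_hom_ext ?_
    change F.map i.op (freeOneHom hf.choose freeOneGen) =
      F.map j.op (freeOneHom hg.choose freeOneGen)
    rw [freeOneHom_gen, freeOneHom_gen]
    refine sheaf_eq hF fun x hx => germ_exists_eq F hx ?_
    rw [germ_res_apply', germ_res_apply', hf.choose_spec, hg.choose_spec]
  obtain ⟨(g : freeOne.{u} ⟶ F.obj (op U)), hg, -⟩ := hF freeOne S hS fam hfam
  refine ⟨g freeOneGen, fun y => ?_⟩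
  obtain ⟨V, i, s, hy, hs⟩ := h y.1 y.2
  have hi : S i := ⟨s, fun y hy => hs y hy _⟩
  have e : F.map i.op (g freeOneGen) = hi.choose :=
    (hom_congr (hg i hi : g ≫ F.map i.op = freeOneHom hi.choose)
      freeOneGen).trans (freeOneHom_gen _)
  rw [← germ_res_apply' F i hy, e]
  exact hi.choose_spec y.1 hy

end Presheaf

end Blpr

/-! ### Spaces with regular functions -/

/-- A topological space with a family of blueprints, the stalks, together with the information
which functions with values in the stalks are regular at which points. -/
structure PreSp : Type (u + 1) where
  X : Type u
  [top : TopologicalSpace X]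
  A : X → Blpr.{u}
  regAt : X → Submonoid (∀ y, A y)
  reg_nhds : ∀ {x s}, s ∈ regAt x → ∀ᶠ y in 𝓝 x, s ∈ regAt y
  reg_congr : ∀ {x s t}, s ∈ regAt x → (∀ᶠ y in 𝓝 x, s y = t y) → t ∈ regAt x

namespace PreSp

instance : CoeSort PreSp.{u} (Type u) := ⟨PreSp.X⟩

instance (X : PreSp.{u}) : TopologicalSpace X := X.top

/-- The value at `y` of functions that are regular at `x`. -/
def evalReg (X : PreSp.{u}) (x y : X) : X.regAt x →* X.A y :=
  (Pi.evalMonoidHom (fun y => X.A y) y).comp (X.regAt x).subtype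

/-- The stalks are the blueprints of germs of regular functions. -/
structure IsGood (X : PreSp.{u}) : Prop where
  surj : ∀ (x : X) (a : X.A x), ∃ s ∈ X.regAt x, s x = a
  eq : ∀ {x : X} {s t : ∀ y, X.A y}, s ∈ X.regAt x → t ∈ X.regAt x → s x = t x →
    ∀ᶠ y in 𝓝 x, s y = t y
  rel : ∀ {x : X} (v w : MonoidAlgebra ℕ (X.regAt x)),
    (X.A x).rel (Blpr.mapSum (X.evalReg x x) v) (Blpr.mapSum (X.evalReg x x) w) →
    ∀ᶠ y in 𝓝 x, (X.A y).rel (Blpr.mapSum (X.evalReg x y) v) (Blpr.mapSum (X.evalReg x y) w)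

/-- A point of `X` with values in `L`. -/
abbrev Pt (X : PreSp.{u}) (L : Blpr.{u}) : Type u := Σ x : X, (X.A x ⟶ L)

/-- The value of a function at a point with values in `L`. -/
def Pt.eval {X : PreSp.{u}} {L : Blpr.{u}} (P : X.Pt L) (s : ∀ x, X.A x) : L := P.2 (s P.1)

/-- The image of a point under a morphism of its values. -/
def Pt.push {X : PreSp.{u}} {L L' : Blpr.{u}} (P : X.Pt L) (f : L ⟶ L') : X.Pt L' :=
  ⟨P.1, P.2 ≫ f⟩

/-- Morphisms of spaces with regular functions. -/
@[ext]
structure Hom (Y X : PreSp.{u}) where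
  pt : ∀ y : Y, X.Pt (Y.A y)
  continuous : Continuous fun y => (pt y).1
  reg : ∀ {y s}, s ∈ X.regAt (pt y).1 → (fun y' => (pt y').eval s) ∈ Y.regAt y

/-- The image of a point with values in `L`. -/
def Hom.onPt {X Y : PreSp.{u}} (f : Hom Y X) {L : Blpr.{u}} (P : Y.Pt L) : X.Pt L :=
  (f.pt P.1).push P.2

instance : Category PreSp.{u} where
  Hom := Hom
  id X := ⟨fun x => ⟨x, 𝟙 _⟩, continuous_id, fun h => h⟩
  comp f g := ⟨fun y => g.onPt (f.pt y), g.continuous.comp f.continuous, fun h => f.reg (g.reg h)⟩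
  id_comp f := by
    refine Hom.ext (funext fun y => Sigma.ext rfl (heq_of_eq ?_))
    exact Category.comp_id _
  comp_id f := by
    refine Hom.ext (funext fun y => Sigma.ext rfl (heq_of_eq ?_))
    exact Category.id_comp _
  assoc f g h := by
    refine Hom.ext (funext fun y => Sigma.ext rfl (heq_of_eq ?_))
    exact (Category.assoc _ _ _).symm

theorem hom_ext {X Y : PreSp.{u}} {f g : Y ⟶ X} (h : ∀ y, f.pt y = g.pt y) : f = g :=
  Hom.ext (funext h)

/-- The map of points. -/
abbrev Hom.base {X Y : PreSp.{u}} (f : Hom Y X) (y : Y) : X := (f.pt y).1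

/-- The map of stalks. -/
abbrev Hom.map {X Y : PreSp.{u}} (f : Hom Y X) (y : Y) : X.A (f.base y) ⟶ Y.A y := (f.pt y).2

theorem onPt_comp {X Y Z : PreSp.{u}} (f : X ⟶ Y) (g : Y ⟶ Z) {L : Blpr.{u}} (P : X.Pt L) :
    Hom.onPt (f ≫ g) P = g.onPt (f.onPt P) :=
  Sigma.ext rfl (heq_of_eq (Category.assoc _ _ _))

theorem onPt_push {X Y : PreSp.{u}} (f : Y ⟶ X) {L L' : Blpr.{u}} (P : Y.Pt L) (g : L ⟶ L') :
    f.onPt (P.push g) = (f.onPt P).push g :=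
  Sigma.ext rfl (heq_of_eq (Category.assoc _ _ _).symm)

theorem onPt_eval {X Y : PreSp.{u}} (f : Y ⟶ X) {L : Blpr.{u}} (P : Y.Pt L)
    (s : ∀ x, X.A x) : (f.onPt P).eval s = P.eval fun y => (f.pt y).eval s := rfl

/-- The morphism is given by local morphisms of stalks. -/
def IsLocal {X Y : PreSp.{u}} (f : Y ⟶ X) : Prop := ∀ y, Blpr.IsLoc (f.map y)

theorem IsLocal.comp {X Y Z : PreSp.{u}} {f : X ⟶ Y} {g : Y ⟶ Z} (hf : IsLocal f)
    (hg : IsLocal g) : IsLocal (f ≫ g) := fun x => (hg _).comp (hf x)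

/-- An open embedding that identifies the stalks. -/
structure IsOpenImm {X Y : PreSp.{u}} (f : Y ⟶ X) : Prop where
  isOpenEmbedding : Topology.IsOpenEmbedding f.base
  isIso : ∀ y, IsIso (f.map y)

theorem IsOpenImm.isLocal {X Y : PreSp.{u}} {f : Y ⟶ X} (hf : IsOpenImm f) : IsLocal f := fun y =>
  have := hf.isIso y
  Blpr.isLoc_of_isIso _

theorem IsOpenImm.eventually {X Y : PreSp.{u}} {f : Y ⟶ X} (hf : IsOpenImm f) {y : Y}
    {p : X → Prop} (h : ∀ᶠ y' in 𝓝 y, p (f.base y')) : ∀ᶠ x in 𝓝 (f.base y), p x := by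
  rw [← hf.isOpenEmbedding.map_nhds_eq]
  exact h

/-- Choose a regular function with the same value as `s` at the point. Its pullback and that of `s`
are regular with equal values, hence equal nearby, and invertible stalk maps carry this equality
back to `X`. -/
theorem IsOpenImm.reg_iff {X Y : PreSp.{u}} {f : Y ⟶ X} (hf : IsOpenImm f) (hX : X.IsGood)
    (hY : Y.IsGood) {y : Y} {s : ∀ x, X.A x} :
    s ∈ X.regAt (f.base y) ↔ (fun y' => (f.pt y').eval s) ∈ Y.regAt y := by
  refine ⟨f.reg, fun h => ?_⟩
  obtain ⟨t, ht, e⟩ := hX.surj (f.base y) (s (f.base y))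
  refine X.reg_congr ht (hf.eventually ?_)
  have h' := hY.eq (f.reg ht) h (congrArg (f.map y) e)
  filter_upwards [h'] with y' hy'
  have := hf.isIso y'
  exact (Blpr.bijective_of_isIso (f.map y')).1 hy'

/-- The inverse of the value is the value of some regular function, and the product of the two has
value one, hence equals one near `x`. -/
theorem IsGood.isUnit {X : PreSp.{u}} (hX : X.IsGood) {x : X} {s : ∀ y, X.A y}
    (hs : s ∈ X.regAt x) (h : IsUnit (s x)) :
    ∃ t ∈ X.regAt x, ∀ᶠ y in 𝓝 x, s y * t y = 1 := by
  obtain ⟨b, hb⟩ := h.exists_right_inv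
  obtain ⟨t, ht, rfl⟩ := hX.surj x b
  exact ⟨t, ht, hX.eq (mul_mem hs ht) (one_mem (X.regAt x)) hb⟩

/-! ### The sheaf of regular functions -/

/-- The regular functions on `U`. -/
def secSubmonoid (X : PreSp.{u}) (U : Opens X) : Submonoid (∀ x : U, X.A x.1) where
  carrier := {s | ∀ x : U, ∃ t ∈ X.regAt x.1, ∀ y : U, t y.1 = s y}
  one_mem' x := ⟨1, one_mem _, fun _ => rfl⟩
  mul_mem' hs ht x := by
    obtain ⟨s, hs, es⟩ := hs x
    obtain ⟨t, ht, et⟩ := ht x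
    exact ⟨s * t, mul_mem hs ht, fun y => congrArg₂ _ (es y) (et y)⟩

/-- The blueprint of regular functions on `U`. -/
noncomputable def sec (X : PreSp.{u}) (U : Opens X) : Blpr.{u} where
  carrier := X.secSubmonoid U
  rel :=
    { r := fun x y => ∀ p : U, ((X.A p.1).rel.comap
        (Blpr.mapSum ((Pi.evalMonoidHom (fun p : U => X.A p.1) p).comp
          (X.secSubmonoid U).subtype))) x y
      iseqv := ⟨fun _ _ => RingCon.refl _ _, fun h p => RingCon.symm _ (h p),
        fun h h' p => RingCon.trans _ (h p) (h' p)⟩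
      mul' := fun h h' p => RingCon.mul _ (h p) (h' p)
      add' := fun h h' p => RingCon.add _ (h p) (h' p) }

/-- The value of a regular function. -/
noncomputable def ev (X : PreSp.{u}) (U : Opens X) (p : U) : X.sec U ⟶ X.A p.1 :=
  ⟨(Pi.evalMonoidHom (fun p : U => X.A p.1) p).comp (X.secSubmonoid U).subtype,
    fun _ _ h => h p⟩

theorem sec_rel {X : PreSp.{u}} {U : Opens X} {x y : MonoidAlgebra ℕ (X.sec U)} :
    (X.sec U).rel x y ↔ ∀ p : U, (X.A p.1).rel
      (Blpr.mapSum (X.ev U p).toMonoidHom x) (Blpr.mapSum (X.ev U p).toMonoidHom y) := Iff.rfl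

theorem sec_ext {X : PreSp.{u}} {U : Opens X} {s t : X.sec U} (h : ∀ p, X.ev U p s = X.ev U p t) :
    s = t := Subtype.ext (funext h)

/-- A morphism to the blueprint of regular functions that is given by its values. -/
noncomputable def secLift {X : PreSp.{u}} {U : Opens X} {B : Blpr.{u}}
    (f : ∀ p : U, B ⟶ X.A p.1)
    (hf : ∀ b, (fun p => f p b) ∈ X.secSubmonoid U) : B ⟶ X.sec U where
  toMonoidHom :=
    { toFun := fun b => ⟨fun p => f p b, hf b⟩
      map_one' := Subtype.ext (funext fun p => map_one (f p).toMonoidHom)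
      map_mul' := fun a b => Subtype.ext (funext fun p => map_mul (f p).toMonoidHom a b) }
  map_rel x y h := sec_rel.2 fun p => by
    rw [Blpr.mapSum_mapSum, Blpr.mapSum_mapSum]
    exact (f p).map_rel x y h

theorem sec_hom_ext {X : PreSp.{u}} {U : Opens X} {B : Blpr.{u}} {f g : B ⟶ X.sec U}
    (h : ∀ p, f ≫ X.ev U p = g ≫ X.ev U p) : f = g :=
  Blpr.hom_ext fun b => sec_ext fun p => Blpr.hom_congr (h p) b

open Classical in
/-- The extension of a function on `U` by one. -/
noncomputable def extend (X : PreSp.{u}) (U : Opens X) : (∀ x : U, X.A x.1) →* (∀ x, X.A x) where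
  toFun s x := if h : x ∈ U then s ⟨x, h⟩ else 1
  map_one' := by
    funext x
    by_cases h : x ∈ U <;> simp [h]
  map_mul' s t := by
    funext x
    by_cases h : x ∈ U <;> simp [h]

theorem extend_apply (X : PreSp.{u}) (U : Opens X) (s : ∀ x : U, X.A x.1) (x : U) :
    X.extend U s x.1 = s x := dif_pos x.2

theorem eventually_extend (X : PreSp.{u}) (U : Opens X) (s : ∀ x : U, X.A x.1) (t : ∀ x, X.A x)
    (x : U) (h : ∀ y : U, t y.1 = s y) : ∀ᶠ y in 𝓝 x.1, t y = X.extend U s y := by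
  filter_upwards [U.isOpen.mem_nhds x.2] with y hy
  exact (h ⟨y, hy⟩).trans (X.extend_apply U s ⟨y, hy⟩).symm

theorem mem_secSubmonoid {X : PreSp.{u}} {U : Opens X} {s : ∀ x : U, X.A x.1} :
    s ∈ X.secSubmonoid U ↔ ∀ x : U, X.extend U s ∈ X.regAt x.1 := by
  refine forall_congr' fun x => ⟨?_, fun h => ⟨_, h, fun y => X.extend_apply U s y⟩⟩
  rintro ⟨t, ht, e⟩
  exact X.reg_congr ht (X.eventually_extend U s t x e)

/-- Regularity of functions on `U` is a local property. -/
theorem mem_secSubmonoid_of_local {X : PreSp.{u}} {U : Opens X} {s : ∀ x : U, X.A x.1}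
    (h : ∀ x : U, ∃ t ∈ X.regAt x.1, ∀ᶠ y in 𝓝 x.1, ∀ hy : y ∈ U, t y = s ⟨y, hy⟩) :
    s ∈ X.secSubmonoid U := by
  rw [mem_secSubmonoid]
  intro x
  obtain ⟨t, ht, e⟩ := h x
  refine X.reg_congr ht ?_
  filter_upwards [e, U.isOpen.mem_nhds x.2] with y hy hyU
  exact (hy hyU).trans (X.extend_apply U s ⟨y, hyU⟩).symm

/-- Restriction of regular functions. -/
noncomputable def secRes (X : PreSp.{u}) {U V : Opens X} (h : V ≤ U) : X.sec U ⟶ X.sec V :=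
  secLift (fun p => X.ev U ⟨p.1, h p.2⟩) fun s x => by
    obtain ⟨t, ht, e⟩ := s.2 ⟨x.1, h x.2⟩
    exact ⟨t, ht, fun y => e ⟨y.1, h y.2⟩⟩

/-- The presheaf of regular functions. -/
noncomputable def secPresheaf (X : PreSp.{u}) : TopCat.Presheaf Blpr.{u} (TopCat.of X) where
  obj U := X.sec U.unop
  map f := X.secRes f.unop.le

theorem secPresheaf_isSheaf (X : PreSp.{u}) : X.secPresheaf.IsSheaf := by
  intro E U S hS x hx
  have hcov : ∀ p : U, ∃ (V : Opens X) (f : V ⟶ U), S f ∧ p.1 ∈ V := fun p => hS p.1 p.2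
  choose V f hf hV using hcov
  let val : ∀ {W : Opens X} (g : W ⟶ U), S g → ∀ p : W, E ⟶ X.A p.1 :=
    fun {W} g hg p => (show E ⟶ X.sec W from x g hg) ≫ X.ev W p
  have hval : ∀ {W W' : Opens X} (g : W ⟶ U) (hg : S g) (g' : W' ⟶ U) (hg' : S g')
      (p : X) (hp : p ∈ W) (hp' : p ∈ W'), val g hg ⟨p, hp⟩ = val g' hg' ⟨p, hp'⟩ := by
    intro W W' g hg g' hg' p hp hp'
    have h := hx (homOfLE inf_le_left : W ⊓ W' ⟶ W) (homOfLE inf_le_right : W ⊓ W' ⟶ W') hg hg'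
      (Subsingleton.elim _ _)
    exact congrArg (fun k : E ⟶ X.sec (W ⊓ W') => k ≫ X.ev (W ⊓ W') ⟨p, hp, hp'⟩) h
  refine ⟨(secLift (fun p => val (f p) (hf p) ⟨p.1, hV p⟩) fun e => ?_ : E ⟶ X.sec U),
    fun W g hg => ?_, fun y hy => ?_⟩
  · refine mem_secSubmonoid_of_local fun p => ?_
    obtain ⟨t, ht, et⟩ := ((show E ⟶ X.sec (V p) from x (f p) (hf p)) e).2 ⟨p.1, hV p⟩
    refine ⟨t, ht, ?_⟩
    filter_upwards [(V p).isOpen.mem_nhds (hV p)] with q hq hqU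
    refine (et ⟨q, hq⟩).trans ?_
    exact Blpr.hom_congr (hval (f p) (hf p) (f ⟨q, hqU⟩) (hf ⟨q, hqU⟩) q hq (hV ⟨q, hqU⟩)) e
  · refine sec_hom_ext (X := X) fun p => ?_
    exact hval _ _ g hg p.1 _ p.2
  · refine sec_hom_ext (X := X) fun p => ?_
    exact congrArg (fun k : E ⟶ X.sec (V p) => k ≫ X.ev (V p) ⟨p.1, hV p⟩) (hy (f p) (hf p))

/-- The space with its sheaf of regular functions. -/
noncomputable abbrev toSh (X : PreSp.{u}) : SheafedSpace Blpr.{u} where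
  carrier := TopCat.of X
  presheaf := X.secPresheaf
  IsSheaf := X.secPresheaf_isSheaf

/-- The value of a germ. -/
noncomputable def stalkEv (X : PreSp.{u}) (x : X) :
    X.secPresheaf.stalk (x : TopCat.of X) ⟶ X.A x :=
  colimit.desc ((OpenNhds.inclusion (X := TopCat.of X) x).op ⋙ X.secPresheaf)
    { pt := X.A x
      ι := { app := fun V => X.ev V.unop.1 ⟨x, V.unop.2⟩, naturality := fun _ _ _ => rfl } }

theorem germ_stalkEv (X : PreSp.{u}) (U : Opens X) (x : X) (hx : x ∈ U) :
    X.secPresheaf.germ U (x : TopCat.of X) hx ≫ X.stalkEv x = X.ev U ⟨x, hx⟩ :=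
  colimit.ι_desc _ _

theorem stalkEv_germ (X : PreSp.{u}) (U : Opens X) (x : X) (hx : x ∈ U) (s : X.sec U) :
    X.stalkEv x (X.secPresheaf.germ U (x : TopCat.of X) hx s) = X.ev U ⟨x, hx⟩ s :=
  Blpr.hom_congr (X.germ_stalkEv U x hx) s

end PreSp

namespace PreSp

/-! ### Germs of regular functions -/

/-- A function that is regular at `x` is regular on a neighbourhood of `x`. -/
theorem exists_sec (X : PreSp.{u}) {x : X} {s : ∀ y, X.A y} (hs : s ∈ X.regAt x) :
    ∃ (U : Opens X) (_ : x ∈ U) (t : X.sec U), ∀ y : U, X.ev U y t = s y.1 := by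
  obtain ⟨U, hU, ho, hx⟩ := eventually_nhds_iff.1 (X.reg_nhds hs)
  exact ⟨⟨U, ho⟩, hx, ⟨fun y => s y.1, fun y => ⟨s, hU y.1 y.2, fun _ => rfl⟩⟩, fun _ => rfl⟩

/-- Two functions agree near `x` if they agree on an open neighbourhood of `x`. -/
theorem exists_opens_of_eventually {X : PreSp.{u}} {x : X} {p : X → Prop} (U : Opens X)
    (hx : x ∈ U) (h : ∀ᶠ y in 𝓝 x, p y) : ∃ V : Opens X, V ≤ U ∧ x ∈ V ∧ ∀ y ∈ V, p y := by
  obtain ⟨V, hV, ho, hxV⟩ := eventually_nhds_iff.1 h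
  exact ⟨⟨V, ho⟩ ⊓ U, inf_le_right, ⟨hxV, hx⟩, fun y hy => hV y hy.1⟩

theorem exists_ev_eq {X : PreSp.{u}} (hX : X.IsGood) {x : X} (a : X.A x) :
    ∃ (U : Opens X) (hx : x ∈ U) (t : X.sec U), X.ev U ⟨x, hx⟩ t = a := by
  obtain ⟨s, hs, e⟩ := hX.surj x a
  obtain ⟨U, hx, t, ht⟩ := X.exists_sec hs
  exact ⟨U, hx, t, (ht ⟨x, hx⟩).trans e⟩

/-- Only finitely many germs occur in two formal sums, and these share a neighbourhood. -/
theorem exists_germ_eq₂ {X : TopCat.{u}} (F : TopCat.Presheaf Blpr.{u} X) (x : X)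
    (v w : MonoidAlgebra ℕ (F.stalk x)) :
    ∃ (U : Opens X) (hx : x ∈ U) (v' w' : MonoidAlgebra ℕ (F.obj (op U))),
      Blpr.mapSum (F.germ U x hx).toMonoidHom v' = v ∧
      Blpr.mapSum (F.germ U x hx).toMonoidHom w' = w := by
  have hres : ∀ {U V : Opens X} (i : V ⟶ U) (hx : x ∈ V) (v : MonoidAlgebra ℕ (F.obj (op U))),
      Blpr.mapSum (F.germ V x hx).toMonoidHom (Blpr.mapSum (F.map i.op).toMonoidHom v) =
        Blpr.mapSum (F.germ U x (i.le hx)).toMonoidHom v := fun i hx v => by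
    rw [← Blpr.mapSum_comp, F.germ_res]
  have hcommon : ∀ {U V : Opens X} (hU : x ∈ U) (hV : x ∈ V) (v : MonoidAlgebra ℕ (F.obj (op U)))
      (w : MonoidAlgebra ℕ (F.obj (op V))),
      ∃ (W : Opens X) (hx : x ∈ W) (v' w' : MonoidAlgebra ℕ (F.obj (op W))),
      Blpr.mapSum (F.germ W x hx).toMonoidHom v' = Blpr.mapSum (F.germ U x hU).toMonoidHom v ∧
      Blpr.mapSum (F.germ W x hx).toMonoidHom w' = Blpr.mapSum (F.germ V x hV).toMonoidHom w :=
    fun {U V} hU hV v w => ⟨U ⊓ V, ⟨hU, hV⟩, _, _, hres (homOfLE inf_le_left) ⟨hU, hV⟩ v,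
      hres (homOfLE inf_le_right) ⟨hU, hV⟩ w⟩
  have hone : ∀ v : MonoidAlgebra ℕ (F.stalk x), ∃ (U : Opens X) (hx : x ∈ U)
      (v' : MonoidAlgebra ℕ (F.obj (op U))),
      Blpr.mapSum (F.germ U x hx).toMonoidHom v' = v := fun v => by
    induction v using Blpr.induction_sum with
    | zero => exact ⟨⊤, trivial, 0, map_zero _⟩
    | add v w hv hw =>
      obtain ⟨U, hU, v, rfl⟩ := hv
      obtain ⟨V, hV, w, rfl⟩ := hw
      obtain ⟨W, hW, v', w', hv, hw⟩ := hcommon hU hV v w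
      exact ⟨W, hW, v' + w', by rw [map_add, hv, hw]⟩
    | el a =>
      obtain ⟨U, hU, s, rfl⟩ := Blpr.germ_exists_rep F x a
      exact ⟨U, hU, Blpr.el s, Blpr.mapSum_el _ _⟩
  obtain ⟨U, hU, v, rfl⟩ := hone v
  obtain ⟨V, hV, w, rfl⟩ := hone w
  exact hcommon hU hV v w

/-- The extension by one of a regular function, as a function that is regular at `x`. -/
noncomputable def secToReg (X : PreSp.{u}) (U : Opens X) (x : U) : X.sec U →* X.regAt x.1 :=
  ((X.extend U).comp (X.secSubmonoid U).subtype).codRestrict (X.regAt x.1)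
    fun s => mem_secSubmonoid.1 s.2 x

/-- Moves formal sums of sections to formal sums of functions regular at `x`, the form in which
`IsGood` speaks of relations. -/
theorem evalReg_secToReg (X : PreSp.{u}) (U : Opens X) (x y : U) :
    (X.evalReg x.1 y.1).comp (X.secToReg U x) = (X.ev U y).toMonoidHom := by
  ext s
  exact X.extend_apply U _ y

theorem secRes_ev (X : PreSp.{u}) {U V : Opens X} (h : V ≤ U) (x : V) :
    X.secRes h ≫ X.ev V x = X.ev U ⟨x.1, h x.2⟩ := rfl

/-- The three conditions of `IsGood` are what is needed: `surj` and `eq` make evaluation of germs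
bijective, and `rel` lets it reflect the pre-addition. -/
theorem isIso_stalkEv {X : PreSp.{u}} (hX : X.IsGood) (x : X) : IsIso (X.stalkEv x) := by
  have hsum : ∀ (U : Opens X) (hx : x ∈ U) (v : MonoidAlgebra ℕ (X.sec U)),
      Blpr.mapSum (X.stalkEv x).toMonoidHom (Blpr.mapSum (X.secPresheaf.germ U
        (x : TopCat.of X) hx).toMonoidHom v) =
      Blpr.mapSum (X.ev U ⟨x, hx⟩).toMonoidHom v := fun U hx v => by
    rw [← X.germ_stalkEv U x hx]
    exact (Blpr.mapSum_comp _ _ v).symm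
  have hrel : ∀ v w, (X.A x).rel (Blpr.mapSum (X.stalkEv x).toMonoidHom v)
      (Blpr.mapSum (X.stalkEv x).toMonoidHom w) →
      (X.secPresheaf.stalk (x : TopCat.of X)).rel v w := by
    suffices key : ∀ (U : Opens X) (hx : x ∈ U) (v w : MonoidAlgebra ℕ (X.sec U)),
        (X.A x).rel (Blpr.mapSum (X.ev U ⟨x, hx⟩).toMonoidHom v)
          (Blpr.mapSum (X.ev U ⟨x, hx⟩).toMonoidHom w) →
        (X.secPresheaf.stalk (x : TopCat.of X)).rel
          (Blpr.mapSum (X.secPresheaf.germ U (x : TopCat.of X) hx).toMonoidHom v)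
          (Blpr.mapSum (X.secPresheaf.germ U (x : TopCat.of X) hx).toMonoidHom w) by
      intro v w h
      obtain ⟨U, hx, v, w, rfl, rfl⟩ := exists_germ_eq₂ X.secPresheaf (x : TopCat.of X) v w
      exact key U hx v w (hsum U hx v ▸ hsum U hx w ▸ h)
    intro U hx v w h
    rw [← X.evalReg_secToReg U ⟨x, hx⟩ ⟨x, hx⟩, ← Blpr.mapSum_mapSum, ← Blpr.mapSum_mapSum] at h
    obtain ⟨V, hVU, hxV, hV⟩ := exists_opens_of_eventually U hx (hX.rel _ _ h)
    have h' : (X.sec V).rel (Blpr.mapSum (X.secRes hVU).toMonoidHom v)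
        (Blpr.mapSum (X.secRes hVU).toMonoidHom w) := by
      refine sec_rel.2 fun y => ?_
      rw [← Blpr.mapSum_comp, ← Blpr.mapSum_comp, secRes_ev, ← X.evalReg_secToReg U ⟨x, hx⟩,
        ← Blpr.mapSum_mapSum, ← Blpr.mapSum_mapSum]
      exact hV y.1 y.2
    have h'' := (X.secPresheaf.germ V (x : TopCat.of X) hxV).map_rel _ _ h'
    have e : X.secRes hVU ≫ X.secPresheaf.germ V (x : TopCat.of X) hxV =
        X.secPresheaf.germ U (x : TopCat.of X) hx :=
      X.secPresheaf.germ_res (homOfLE hVU) _ hxV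
    have e' : ∀ v, Blpr.mapSum (X.secPresheaf.germ V (x : TopCat.of X) hxV).toMonoidHom
        (Blpr.mapSum (X.secRes hVU).toMonoidHom v) =
        Blpr.mapSum (X.secPresheaf.germ U (x : TopCat.of X) hx).toMonoidHom v := fun v => by
      rw [← e]
      exact (Blpr.mapSum_comp _ _ v).symm
    exact e' v ▸ e' w ▸ h''
  refine Blpr.isIso_of_bijective _ ⟨fun a b h => ?_, fun a => ?_⟩ hrel
  · obtain ⟨U, hU, s, rfl⟩ := Blpr.germ_exists_rep X.secPresheaf _ a
    obtain ⟨V, hV, t, rfl⟩ := Blpr.germ_exists_rep X.secPresheaf _ b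
    replace h : X.ev U ⟨x, hU⟩ s = X.ev V ⟨x, hV⟩ t :=
      (X.stalkEv_germ U x hU s).symm.trans (h.trans (X.stalkEv_germ V x hV t))
    have h' := hX.eq (mem_secSubmonoid.1 (Subtype.prop (p := (· ∈ X.secSubmonoid U)) s) ⟨x, hU⟩)
      (mem_secSubmonoid.1 (Subtype.prop (p := (· ∈ X.secSubmonoid V)) t) ⟨x, hV⟩)
      ((X.extend_apply U _ ⟨x, hU⟩).trans (h.trans (X.extend_apply V _ ⟨x, hV⟩).symm))
    obtain ⟨W, hW, hxW, hs⟩ := exists_opens_of_eventually (U ⊓ V) ⟨hU, hV⟩ h'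
    have e : X.secRes (hW.trans inf_le_left) s = X.secRes (hW.trans inf_le_right) t :=
      sec_ext fun y => (X.extend_apply U _ ⟨y.1, (hW y.2).1⟩).symm.trans
        ((hs y.1 y.2).trans (X.extend_apply V _ ⟨y.1, (hW y.2).2⟩))
    have e₁ := Blpr.germ_res_apply' X.secPresheaf (homOfLE (hW.trans inf_le_left)) hxW s
    have e₂ := Blpr.germ_res_apply' X.secPresheaf (homOfLE (hW.trans inf_le_right)) hxW t
    exact e₁.symm.trans ((congrArg _ e).trans e₂)
  · obtain ⟨U, hx, t, e⟩ := exists_ev_eq hX a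
    exact ⟨_, (X.stalkEv_germ U x hx t).trans e⟩

/-! ### Morphisms -/

/-- The pullback of regular functions. -/
noncomputable def secMap {X Y : PreSp.{u}} (f : Y ⟶ X) (U : Opens X) :
    X.sec U ⟶ Y.sec (U.comap ⟨f.base, f.continuous⟩) :=
  secLift (fun p => X.ev U ⟨f.base p.1, p.2⟩ ≫ f.map p.1) fun s p => by
    obtain ⟨t, ht, e⟩ := s.2 ⟨f.base p.1, p.2⟩
    exact ⟨_, f.reg ht, fun y => congrArg (f.map y.1) (e ⟨f.base y.1, y.2⟩)⟩

/-- The morphism of spaces with a sheaf of blueprints that is induced by a morphism of spaces with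
regular functions. -/
noncomputable def shMap {X Y : PreSp.{u}} (f : Y ⟶ X) : Y.toSh ⟶ X.toSh :=
  InducedCategory.homMk
    { base := TopCat.ofHom ⟨f.base, f.continuous⟩
      c := { app := fun U => secMap f U.unop, naturality := fun _ _ _ => rfl } }

theorem shMap_comp {X Y Z : PreSp.{u}} (f : Z ⟶ Y) (g : Y ⟶ X) :
    shMap (f ≫ g) = shMap f ≫ shMap g := rfl

theorem shMap_stalkMap {X Y : PreSp.{u}} (f : Y ⟶ X) (y : Y) :
    (shMap f).hom.stalkMap y ≫ Y.stalkEv y = X.stalkEv (f.base y) ≫ f.map y := by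
  refine TopCat.Presheaf.stalk_hom_ext _ fun U hU => ?_
  have h₁ := PresheafedSpace.stalkMap_germ (shMap f).hom U y hU
  refine (Category.assoc _ _ _).symm.trans ((congrArg (· ≫ Y.stalkEv y) h₁).trans ?_)
  exact (congrArg (fun k => (shMap f).hom.c.app (op U) ≫ k)
    (Y.germ_stalkEv (U.comap ⟨f.base, f.continuous⟩) y hU)).trans
    (congrArg (fun k => k ≫ f.map y) (X.germ_stalkEv U (f.base y) hU)).symm

/-! ### Full faithfulness of the passage to sheaves -/

section Full

variable {X Y : PreSp.{u}} (hX : X.IsGood) (F : Y.toSh ⟶ X.toSh)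

/-- The map of stalks of a morphism of spaces with a sheaf of blueprints. -/
noncomputable def ofShMap (y : Y) : X.A (F.hom.base y) ⟶ Y.A y :=
  have := isIso_stalkEv hX (F.hom.base y)
  CategoryTheory.inv (X.stalkEv (F.hom.base y)) ≫ F.hom.stalkMap y ≫ Y.stalkEv y

theorem stalkEv_ofShMap (y : Y) : X.stalkEv (F.hom.base y) ≫ ofShMap hX F y =
    F.hom.stalkMap y ≫ Y.stalkEv y := by
  have := isIso_stalkEv hX (F.hom.base y)
  exact IsIso.hom_inv_id_assoc _ _

/-- This identity determines the map of stalks, since on a good space every element of a stalk is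
the value of a section. -/
theorem ev_ofShMap (U : Opens X) (y : Y) (hy : F.hom.base y ∈ U) :
    X.ev U ⟨F.hom.base y, hy⟩ ≫ ofShMap hX F y =
      F.hom.c.app (op U) ≫ Y.ev (U.comap F.hom.base.hom) ⟨y, hy⟩ := by
  have h₁ := PresheafedSpace.stalkMap_germ F.hom U y hy
  have h₂ := X.germ_stalkEv U (F.hom.base y) hy
  have h₃ := Y.germ_stalkEv (U.comap F.hom.base.hom) y hy
  refine (congrArg (· ≫ ofShMap hX F y) h₂.symm).trans ?_
  refine (Category.assoc _ _ _).trans ?_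
  rw [stalkEv_ofShMap hX F y]
  refine (Category.assoc _ _ _).symm.trans ?_
  refine (congrArg (· ≫ Y.stalkEv y) h₁).trans ?_
  exact (Category.assoc _ _ _).trans (congrArg (F.hom.c.app (op U) ≫ ·) h₃)

/-- A morphism of spaces with a sheaf of blueprints as a morphism of spaces with regular
functions. -/
noncomputable def ofSh : Y ⟶ X where
  pt y := ⟨F.hom.base y, ofShMap hX F y⟩
  continuous := F.hom.base.hom.continuous
  reg {y s} hs := by
    obtain ⟨U, hU, t, ht⟩ := X.exists_sec hs
    let t' : Y.sec (U.comap F.hom.base.hom) := F.hom.c.app (op U) t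
    obtain ⟨r, hr, e⟩ := t'.2 ⟨y, hU⟩
    refine Y.reg_congr hr ?_
    filter_upwards [(U.comap F.hom.base.hom).isOpen.mem_nhds hU] with y' hy'
    refine (e ⟨y', hy'⟩).trans ?_
    refine (Blpr.hom_congr (ev_ofShMap hX F U y' hy') t).symm.trans ?_
    exact congrArg (ofShMap hX F y') (ht ⟨F.hom.base y', hy'⟩)

theorem shMap_ofSh : shMap (ofSh hX F) = F := by
  refine InducedCategory.hom_ext ?_
  refine PresheafedSpace.hext _ _ rfl (heq_of_eq ?_)
  refine NatTrans.ext (funext fun U => ?_)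
  refine sec_hom_ext (X := Y) fun p => ?_
  exact ev_ofShMap hX F U.unop p.1 p.2

theorem ofSh_shMap (f : Y ⟶ X) : ofSh hX (shMap f) = f := by
  refine hom_ext fun y => Sigma.ext rfl (heq_of_eq ?_)
  refine Blpr.hom_ext fun a => ?_
  obtain ⟨U, hU, t, rfl⟩ := exists_ev_eq hX a
  exact Blpr.hom_congr (ev_ofShMap hX (shMap f) U y hU) t

include hX in
theorem shMap_injective {f g : Y ⟶ X} (h : shMap f = shMap g) : f = g := by
  rw [← ofSh_shMap hX f, h, ofSh_shMap hX g]

end Full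

end PreSp

/-! ### Clearing denominators -/

theorem Blpr.rel_of_isUnit_mul {R : Blpr.{u}} {a : R} (ha : IsUnit a) {x y : MonoidAlgebra ℕ R}
    (h : R.rel (Blpr.el a * x) (Blpr.el a * y)) : R.rel x y := by
  obtain ⟨b, hb⟩ := ha.exists_left_inv
  have hba := R.rel.mul (R.rel.refl (Blpr.el b)) h
  have e1 : Blpr.el (1 : R) = 1 := rfl
  rwa [← mul_assoc, ← mul_assoc, ← Blpr.el_mul, hb, e1, one_mul, one_mul] at hba

/-- The fraction `a / s`. -/
def Blpr.frac {B : Blpr.{u}} {S : Submonoid B} (a : B) (s : S) : B.localization S :=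
  (Localization.mk a s : Localization S)

theorem Blpr.frac_mul {B : Blpr.{u}} {S : Submonoid B} (a : B) (s : S) :
    Blpr.frac a s * B.locHom S s = B.locHom S a := Blpr.mk_mul_locHom B S a s

namespace PreSp

/-! ### The space of germs of a sheaf of blueprints -/

section OfSheaf

variable (X : SheafedSpace Blpr.{u})

/-- The germs of a section define a regular function. -/
def IsGermOn {U : Opens X} (t : X.presheaf.obj (op U)) (s : ∀ y, X.presheaf.stalk y) : Prop :=
  ∀ (y : X) (hy : y ∈ U), s y = X.presheaf.germ U y hy t

variable {X} in
theorem IsGermOn.res {U V : Opens X} (i : V ⟶ U) {t : X.presheaf.obj (op U)}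
    {s : ∀ y, X.presheaf.stalk y} (h : IsGermOn X t s) : IsGermOn X (X.presheaf.map i.op t) s :=
  fun y hy => (h y (i.le hy)).trans (Blpr.germ_res_apply' X.presheaf i hy t).symm

/-- The space of germs of a sheaf of blueprints. -/
noncomputable abbrev conc : PreSp.{u} where
  X := X
  A x := X.presheaf.stalk x
  regAt x :=
    { carrier := {s | ∃ (U : Opens X) (_ : x ∈ U) (t : X.presheaf.obj (op U)), IsGermOn X t s}
      one_mem' := ⟨⊤, trivial, 1, fun y hy =>
        (map_one (X.presheaf.germ ⊤ y hy).toMonoidHom).symm⟩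
      mul_mem' := by
        rintro s s' ⟨U, hU, t, h⟩ ⟨V, hV, t', h'⟩
        refine ⟨U ⊓ V, ⟨hU, hV⟩, X.presheaf.map (homOfLE inf_le_left).op t *
          X.presheaf.map (homOfLE inf_le_right).op t', fun y hy => ?_⟩
        rw [map_mul, ← h.res _ y hy, ← h'.res _ y hy]
        rfl }
  reg_nhds {x s} h := by
    obtain ⟨U, hU, t, h⟩ := h
    filter_upwards [U.isOpen.mem_nhds hU] with y hy
    exact ⟨U, hy, t, h⟩
  reg_congr {x s s'} h h' := by
    obtain ⟨U, hU, t, h⟩ := h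
    obtain ⟨V, hV, ho, hxV⟩ := eventually_nhds_iff.1 h'
    exact ⟨⟨V, ho⟩ ⊓ U, ⟨hxV, hU⟩, _, fun y hy =>
      (hV y hy.1).symm.trans (h.res (homOfLE inf_le_right) y hy)⟩

/-- The finitely many functions involved come from sections over one neighbourhood, so the formal
sums do too, with one choice of lifts serving all nearby points. -/
theorem conc_exists_sum (x : X) (v w : MonoidAlgebra ℕ ((conc X).regAt x)) :
    ∃ (U : Opens X) (_ : x ∈ U) (v' w' : MonoidAlgebra ℕ (X.presheaf.obj (op U))),
      ∀ (y : X) (hy : y ∈ U),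
      Blpr.mapSum ((conc X).evalReg x y) v =
        Blpr.mapSum (X.presheaf.germ U y hy).toMonoidHom v' ∧
      Blpr.mapSum ((conc X).evalReg x y) w =
        Blpr.mapSum (X.presheaf.germ U y hy).toMonoidHom w' := by
  have hres : ∀ {U V : Opens X} (i : V ⟶ U) (y : X) (hy : y ∈ V)
      (v : MonoidAlgebra ℕ (X.presheaf.obj (op U))),
      Blpr.mapSum (X.presheaf.germ V y hy).toMonoidHom
        (Blpr.mapSum (X.presheaf.map i.op).toMonoidHom v) =
        Blpr.mapSum (X.presheaf.germ U y (i.le hy)).toMonoidHom v := fun i y hy v => by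
    rw [← Blpr.mapSum_comp, X.presheaf.germ_res]
  have hone : ∀ v : MonoidAlgebra ℕ ((conc X).regAt x), ∃ (U : Opens X) (_ : x ∈ U)
      (v' : MonoidAlgebra ℕ (X.presheaf.obj (op U))), ∀ (y : X) (hy : y ∈ U),
      Blpr.mapSum ((conc X).evalReg x y) v =
        Blpr.mapSum (X.presheaf.germ U y hy).toMonoidHom v' := fun v => by
    induction v using Blpr.induction_sum with
    | zero => exact ⟨⊤, trivial, 0, fun y hy => by rw [map_zero, map_zero]⟩
    | add v w hv hw =>
      obtain ⟨U, hU, v', hv⟩ := hv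
      obtain ⟨V, hV, w', hw⟩ := hw
      refine ⟨U ⊓ V, ⟨hU, hV⟩, Blpr.mapSum (X.presheaf.map (homOfLE inf_le_left).op).toMonoidHom v' +
        Blpr.mapSum (X.presheaf.map (homOfLE inf_le_right).op).toMonoidHom w', fun y hy => ?_⟩
      rw [map_add, map_add, hres, hres, hv y hy.1, hw y hy.2]
    | el a =>
      obtain ⟨U, hU, t, h⟩ := a.2
      refine ⟨U, hU, Blpr.el t, fun y hy => ?_⟩
      rw [Blpr.mapSum_el, Blpr.mapSum_el]
      exact congrArg _ (h y hy)
  obtain ⟨U, hU, v', hv⟩ := hone v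
  obtain ⟨V, hV, w', hw⟩ := hone w
  refine ⟨U ⊓ V, ⟨hU, hV⟩, Blpr.mapSum (X.presheaf.map (homOfLE inf_le_left).op).toMonoidHom v',
    Blpr.mapSum (X.presheaf.map (homOfLE inf_le_right).op).toMonoidHom w', fun y hy => ?_⟩
  rw [hres, hres]
  exact ⟨hv y hy.1, hw y hy.2⟩

theorem conc_isGood : (conc X).IsGood where
  surj x a := by
    classical
    obtain ⟨U, hU, t, rfl⟩ := Blpr.germ_exists_rep X.presheaf x a
    refine ⟨fun y => if hy : y ∈ U then X.presheaf.germ U y hy t else 1, ⟨U, hU, t, fun y hy => ?_⟩,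
      ?_⟩
    · exact dif_pos hy
    · exact dif_pos hU
  eq {x s s'} hs hs' h := by
    obtain ⟨U, hU, t, ht⟩ := hs
    obtain ⟨V, hV, t', ht'⟩ := hs'
    have hx : x ∈ U ⊓ V := ⟨hU, hV⟩
    have e : X.presheaf.germ (U ⊓ V) x hx (X.presheaf.map (homOfLE inf_le_left).op t) =
        X.presheaf.germ (U ⊓ V) x hx (X.presheaf.map (homOfLE inf_le_right).op t') :=
      (ht.res _ x hx).symm.trans (Eq.trans h (ht'.res _ x hx))
    obtain ⟨W, i, hxW, e⟩ := Blpr.germ_exists_eq X.presheaf hx e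
    filter_upwards [W.isOpen.mem_nhds hxW] with y hy
    have h₁ := (ht.res (homOfLE (inf_le_left : U ⊓ V ≤ U))).res i y hy
    have h₂ := (ht'.res (homOfLE (inf_le_right : U ⊓ V ≤ V))).res i y hy
    rw [e] at h₁
    exact h₁.trans h₂.symm
  rel {x} v w h := by
    obtain ⟨U, hU, v', w', hvw⟩ := conc_exists_sum X x v w
    rw [(hvw x hU).1, (hvw x hU).2] at h
    obtain ⟨W, i, hxW, h⟩ := Blpr.germ_exists_rel X.presheaf hU h
    filter_upwards [W.isOpen.mem_nhds hxW] with y hy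
    have hgerm := (X.presheaf.germ W y hy).map_rel _ _ h
    rw [← Blpr.mapSum_comp, ← Blpr.mapSum_comp, X.presheaf.germ_res] at hgerm
    rw [(hvw y (i.le hy)).1, (hvw y (i.le hy)).2]
    exact hgerm

/-- The germs of a section as a regular function. -/
noncomputable def germSec (U : Opens X) : X.presheaf.obj (op U) ⟶ (conc X).sec U :=
  secLift (X := conc X) (fun p => X.presheaf.germ U p.1 p.2) fun t => by
    refine mem_secSubmonoid_of_local fun x => ?_
    refine ⟨(conc X).extend U fun p => X.presheaf.germ U p.1 p.2 t,
      ⟨U, x.2, t, fun y hy => (conc X).extend_apply U _ ⟨y, hy⟩⟩, Filter.Eventually.of_forall ?_⟩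
    exact fun y hy => (conc X).extend_apply U _ ⟨y, hy⟩

theorem germSec_ev (U : Opens X) (p : U) :
    germSec X U ≫ (conc X).ev U p = X.presheaf.germ U p.1 p.2 := rfl

/-- This is where the sheaf property enters: separatedness gives injectivity, gluing gives
surjectivity, and locality of relations reflects the pre-addition. -/
theorem isIso_germSec (U : Opens X) : IsIso (germSec X U) := by
  refine Blpr.isIso_of_bijective _ ⟨fun s t h => ?_, fun s => ?_⟩ fun v w h => ?_
  · refine Blpr.sheaf_eq X.IsSheaf fun x hx => Blpr.germ_exists_eq X.presheaf hx ?_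
    exact congrArg ((conc X).ev U ⟨x, hx⟩) h
  · obtain ⟨t, ht⟩ := Blpr.sheaf_glue X.IsSheaf s.1 fun x hx => by
      obtain ⟨r, ⟨V, hV, t, hr⟩, e⟩ := s.2 ⟨x, hx⟩
      refine ⟨V ⊓ U, homOfLE inf_le_right, X.presheaf.map (homOfLE inf_le_left).op t, ⟨hV, hx⟩,
        fun y hy hy' => ?_⟩
      exact (hr.res _ y hy).symm.trans (e ⟨y, hy'⟩)
    exact ⟨t, Subtype.ext (funext ht)⟩
  · refine Blpr.sheaf_rel X.IsSheaf fun x hx => Blpr.germ_exists_rel X.presheaf hx ?_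
    have := sec_rel.1 h ⟨x, hx⟩
    rw [← Blpr.mapSum_comp, ← Blpr.mapSum_comp, germSec_ev] at this
    exact this

/-- Every space with a sheaf of blueprints is isomorphic to its space of germs. -/
noncomputable def isoConc : X ≅ (conc X).toSh :=
  SheafedSpace.isoMk <| PresheafedSpace.isoOfComponents (Iso.refl _) <|
    NatIso.ofComponents (fun U =>
      @asIso _ _ _ _ (germSec X U.unop) (isIso_germSec X U.unop)) fun {U V} i => by
        refine sec_hom_ext (X := conc X) fun p => ?_
        exact X.presheaf.germ_res i.unop p.1 p.2

end OfSheaf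

/-! ### The spectrum as a space with regular functions -/

section Spec

variable (B : Blpr.{u})

theorem _root_.Blpr.isOpen_basicOpen (h : B) : IsOpen (Blpr.basicOpen B h) :=
  TopologicalSpace.isOpen_generateFrom_of_mem ⟨h, rfl⟩

variable {B} in
theorem _root_.Blpr.eventually_notMem {p : Blpr.PrimeSpec B} {h : B} (hp : h ∉ p.ideal) :
    ∀ᶠ q : Blpr.PrimeSpec B in 𝓝 p, h ∉ q.ideal :=
  (B.isOpen_basicOpen h).mem_nhds hp

/-- The spectrum as a space with regular functions. -/
noncomputable abbrev specC : PreSp.{u} where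
  X := Blpr.PrimeSpec B
  A p := B.atPrime p
  regAt p :=
    { carrier := {s | ∃ a h : B, h ∉ p.ideal ∧
        ∀ᶠ q : Blpr.PrimeSpec B in 𝓝 p, s q * B.locHom q.compl h = B.locHom q.compl a}
      one_mem' := ⟨1, 1, p.isPrime.one_notMem, Filter.Eventually.of_forall fun q => one_mul _⟩
      mul_mem' := by
        rintro s t ⟨a, h, hp, e⟩ ⟨a', h', hp', e'⟩
        refine ⟨a * a', h * h', p.isPrime.mul_notMem _ _ hp hp', ?_⟩
        filter_upwards [e, e'] with q hq hq'
        rw [map_mul, map_mul, ← hq, ← hq']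
        exact mul_mul_mul_comm _ _ _ _ }
  reg_nhds {p s} hs := by
    obtain ⟨a, h, hp, e⟩ := hs
    filter_upwards [Blpr.eventually_notMem hp, eventually_eventually_nhds.2 e] with q hq hq'
    exact ⟨a, h, hq, hq'⟩
  reg_congr {p s t} hs hst := by
    obtain ⟨a, h, hp, e⟩ := hs
    refine ⟨a, h, hp, ?_⟩
    filter_upwards [e, hst] with q hq hq'
    rw [← hq']
    exact hq

theorem specC_const_mem (p : Blpr.PrimeSpec B) (a : B) :
    (fun q : Blpr.PrimeSpec B => B.locHom q.compl a) ∈ (specC B).regAt p :=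
  ⟨a, 1, p.isPrime.one_notMem, Filter.Eventually.of_forall fun q => by rw [map_one, mul_one]⟩

/-- A common denominator for a formal sum of regular functions, valid on a whole neighbourhood. It
reduces relations between such sums to relations in `B`. -/
theorem specC_exists_sum (p : Blpr.PrimeSpec B) (v : MonoidAlgebra ℕ ((specC B).regAt p)) :
    ∃ (h : B) (v' : MonoidAlgebra ℕ B), h ∉ p.ideal ∧ ∀ᶠ q : Blpr.PrimeSpec B in 𝓝 p,
      Blpr.el (B.locHom q.compl h) * Blpr.mapSum ((specC B).evalReg p q) v =
        Blpr.mapSum (B.locHom q.compl).toMonoidHom v' := by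
  induction v using Blpr.induction_sum with
  | zero => exact ⟨1, 0, p.isPrime.one_notMem, Filter.Eventually.of_forall fun q => by
      rw [map_zero, map_zero]; exact mul_zero _⟩
  | add v w hv hw =>
    obtain ⟨h, v', hp, hv⟩ := hv
    obtain ⟨h', w', hp', hw⟩ := hw
    refine ⟨h * h', Blpr.el h' * v' + Blpr.el h * w', p.isPrime.mul_notMem _ _ hp hp', ?_⟩
    filter_upwards [hv, hw] with q hv hw
    rw [map_add, map_add, map_mul, map_mul, map_mul, ← hv, ← hw, Blpr.mapSum_el, Blpr.mapSum_el,
      Blpr.el_mul]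
    ring
  | el a =>
    obtain ⟨a, b, h, hp, e⟩ := a
    refine ⟨h, Blpr.el b, hp, ?_⟩
    filter_upwards [e] with q hq
    rw [Blpr.mapSum_el, Blpr.mapSum_el, ← hq, mul_comm (a q), Blpr.el_mul]
    rfl

/-- An equation or relation in `B_p` between fractions becomes one in `B` after multiplication by
some `t ∉ p`. It therefore holds in `B_q` for all `q` near `p`, namely where the fractions are
defined and `t` and the denominators are not in `q`. -/
theorem specC_isGood : (specC B).IsGood where
  surj p x := by
    classical
    obtain ⟨a, h, e⟩ := Blpr.exists_mul_locHom x
    -- The fraction is used wherever its denominator is invertible; the value one elsewhere is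
    -- irrelevant near `p`.
    refine ⟨fun q => if hq : h.1 ∈ q.compl then
      Blpr.frac a ⟨h.1, hq⟩ else 1, ⟨a, h.1, h.2, ?_⟩, ?_⟩
    · filter_upwards [Blpr.eventually_notMem h.2] with q hq
      rw [dif_pos (Blpr.mem_compl.2 hq)]
      exact Blpr.frac_mul a (⟨h.1, hq⟩ : q.compl)
    · refine (dif_pos h.2).trans ?_
      refine (Blpr.isUnit_locHom B _ h).mul_right_cancel (Eq.trans ?_ e.symm)
      exact Blpr.frac_mul a h
  eq {p s t} hs ht hst := by
    obtain ⟨a, h, hp, e⟩ := hs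
    obtain ⟨a', h', hp', e'⟩ := ht
    have key : B.locHom p.compl (a * h') = B.locHom p.compl (a' * h) := by
      rw [map_mul, map_mul, ← e.self_of_nhds, ← e'.self_of_nhds, hst]
      exact mul_right_comm _ _ _
    obtain ⟨t', ht'⟩ := Blpr.locHom_eq_iff.1 key
    filter_upwards [e, e', Blpr.eventually_notMem hp, Blpr.eventually_notMem hp',
      Blpr.eventually_notMem t'.2] with q hq hq' h₁ h₂ h₃
    refine (Blpr.isUnit_locHom B q.compl ⟨h, h₁⟩).mul_right_cancel
      ((Blpr.isUnit_locHom B q.compl ⟨h', h₂⟩).mul_right_cancel ?_)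
    change s q * B.locHom q.compl h * B.locHom q.compl h' =
      t q * B.locHom q.compl h * B.locHom q.compl h'
    rw [hq, mul_right_comm, hq', ← map_mul, ← map_mul]
    exact Blpr.locHom_eq_iff.2 ⟨⟨t'.1, h₃⟩, ht'⟩
  rel {p} v w hvw := by
    obtain ⟨h, v', hp, hv⟩ := specC_exists_sum B p v
    obtain ⟨h', w', hp', hw⟩ := specC_exists_sum B p w
    have h₁ := (B.atPrime p).rel.mul
      ((B.atPrime p).rel.refl (Blpr.el (B.locHom p.compl (h * h')))) hvw
    have e : ∀ {q : Blpr.PrimeSpec B} {x : MonoidAlgebra ℕ (B.atPrime q)}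
        {y : MonoidAlgebra ℕ B} {h : B} (h' : B), Blpr.el (B.locHom q.compl h) * x =
          Blpr.mapSum (B.locHom q.compl).toMonoidHom y →
        Blpr.el (B.locHom q.compl (h * h')) * x =
          Blpr.mapSum (B.locHom q.compl).toMonoidHom (Blpr.el h' * y) := by
      intro q x y h h' e
      rw [map_mul, map_mul, ← e, Blpr.mapSum_el, Blpr.el_mul]
      ring
    rw [e h' hv.self_of_nhds, mul_comm h h', e h hw.self_of_nhds] at h₁
    obtain ⟨t, ht⟩ := Blpr.localization_rel_iff.1 h₁
    filter_upwards [hv, hw, Blpr.eventually_notMem hp, Blpr.eventually_notMem hp',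
      Blpr.eventually_notMem t.2] with q hv hw hq hq' hqt
    refine Blpr.rel_of_isUnit_mul (a := B.locHom q.compl (h * h'))
      (Blpr.isUnit_locHom B q.compl ⟨h * h', q.isPrime.mul_notMem _ _ hq hq'⟩) ?_
    have hw' := e h hw
    rw [mul_comm h' h] at hw'
    rw [e h' hv, hw']
    exact Blpr.localization_rel_iff.2 ⟨⟨t.1, hqt⟩, ht⟩

/-- The two notions differ only in the neighbourhood on which a fraction represents the function. An
arbitrary one is shrunk to a basic open set `U_g`, and `a / h` is rewritten as `(a * g) / (g * h)`
on `U_{gh}`. -/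
theorem specC_sections_iff {U : Opens (Blpr.PrimeSpec B)} {s : ∀ p : U, B.atPrime p.1} :
    Blpr.IsLocallyRepresented (U : Set (Blpr.PrimeSpec B)) s ↔ s ∈ (specC B).secSubmonoid U := by
  constructor
  · intro hs
    refine mem_secSubmonoid_of_local (X := specC B) fun p => ?_
    obtain ⟨h, a, n, hU, hp, e⟩ := hs p.1 p.2
    refine ⟨(specC B).extend U s, ⟨a, h ^ n, pow_mem (show h ∈ p.1.compl from hp) n, ?_⟩,
      Filter.Eventually.of_forall fun q hq => (specC B).extend_apply U s ⟨q, hq⟩⟩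
    filter_upwards [Blpr.eventually_notMem hp] with q hq
    rw [show (specC B).extend U s q = s ⟨q, hU hq⟩ from (specC B).extend_apply U s ⟨q, hU hq⟩,
      e q hq]
    exact Blpr.mk_mul_locHom B q.compl a ⟨h ^ n, pow_mem (show h ∈ q.compl from hq) n⟩
  · intro hs p hp
    obtain ⟨t, ⟨a, h, hph, e⟩, hts⟩ := hs ⟨p, hp⟩
    obtain ⟨V, hV, ho, hpV⟩ := eventually_nhds_iff.1 e
    obtain ⟨g, hpg, hg⟩ := Blpr.exists_basicOpen_subset (ho.inter U.isOpen) ⟨hpV, hp⟩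
    have hm := Blpr.basicOpen_mul g h
    have hsub : Blpr.basicOpen B (g * h) ⊆ Blpr.basicOpen B g := by
      rw [hm]
      exact Set.inter_subset_left
    refine ⟨g * h, a * g, 1, hsub.trans (hg.trans Set.inter_subset_right),
      p.isPrime.mul_notMem _ _ hpg hph, fun q hq => ?_⟩
    have hu : g * h ∈ q.compl := hq
    have e₁ := hV q (hg (hsub hq)).1
    have e₂ : t q = s ⟨q, (hg (hsub hq)).2⟩ := hts ⟨q, (hg (hsub hq)).2⟩
    rw [e₂] at e₁
    refine (Blpr.isUnit_locHom B q.compl ⟨g * h, hu⟩).mul_right_cancel ?_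
    have e₃ := Blpr.frac_mul (a * g) (⟨(g * h) ^ 1, pow_mem hu 1⟩ : q.compl)
    rw [show B.locHom q.compl ((g * h) ^ 1) = B.locHom q.compl (g * h) by rw [pow_one]] at e₃
    refine Eq.trans ?_ e₃.symm
    rw [map_mul, map_mul, ← e₁, mul_comm (B.locHom q.compl g)]
    exact (mul_assoc _ _ _).symm

/-- The identification of the sections of the structure sheaf with regular functions. -/
noncomputable def specSec (U : Opens (Blpr.PrimeSpec B)) : B.sections U ⟶ (specC B).sec U :=
  secLift (X := specC B) (fun p => ⟨B.evalAt U p, fun _ _ h => h p⟩)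
    fun s => (specC_sections_iff B).1 s.2

theorem isIso_specSec (U : Opens (Blpr.PrimeSpec B)) : IsIso (specSec B U) := by
  refine Blpr.isIso_of_bijective _ ⟨fun s t h => ?_, fun s => ?_⟩ fun v w h => ?_
  · exact Subtype.ext (funext fun p => congrArg ((specC B).ev U p) h)
  · exact ⟨⟨s.1, (specC_sections_iff B).2 s.2⟩, rfl⟩
  · refine B.sections_rel.2 fun p => ?_
    have := sec_rel.1 h p
    rw [← Blpr.mapSum_comp, ← Blpr.mapSum_comp] at this
    exact this

/-- The spectrum is the space of regular functions on prime ideals. -/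
noncomputable def isoSpecC : B.Spec ≅ (specC B).toSh :=
  SheafedSpace.isoMk <| PresheafedSpace.isoOfComponents (Iso.refl _) <|
    NatIso.ofComponents (fun U =>
      @asIso _ _ _ _ (specSec B U.unop) (isIso_specSec B U.unop)) fun {U V} i => by
        exact sec_hom_ext (X := specC B) fun p => rfl

end Spec

end PreSp

namespace PreSp

/-! ### Open immersions and charts -/

/-- Over the image of `f`, sections can be transported point by point through the inverse stalk
maps, and `reg_iff` says that regularity is preserved. -/
theorem isIso_secMap {X Y : PreSp.{u}} (hX : X.IsGood) (hY : Y.IsGood) {f : Y ⟶ X}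
    (hf : IsOpenImm f) (V : Opens X) (hV : ∀ x ∈ V, x ∈ Set.range f.base) :
    IsIso (secMap f V) := by
  refine Blpr.isIso_of_bijective _ ⟨fun s t h => ?_, fun t => ?_⟩ fun v w h => ?_
  · refine sec_ext fun x => ?_
    obtain ⟨x, hx⟩ := x
    obtain ⟨y, rfl⟩ := hV x hx
    have := hf.isIso y
    exact (Blpr.bijective_of_isIso (f.map y)).1 (congrArg (Y.ev _ ⟨y, hx⟩) h)
  -- The element is required to fit every preimage of `x`, with a cast along the equality; there is
  -- only one preimage, so its choice plays no role later.
  · have key : ∀ x : V, ∃ a : X.A x.1, ∀ (y : Y) (e : f.base y = x.1) (hy : f.base y ∈ V),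
        f.map y (e ▸ a) = Y.ev _ ⟨y, hy⟩ t := by
      rintro ⟨x, hx⟩
      obtain ⟨y, rfl⟩ := hV x hx
      have := hf.isIso y
      refine ⟨CategoryTheory.inv (f.map y) (Y.ev _ ⟨y, hx⟩ t), fun y' e hy => ?_⟩
      obtain rfl := hf.isOpenEmbedding.injective e
      exact Blpr.apply_inv_apply _ _
    choose s hs using key
    have hs' : ∀ (y : Y) (hy : f.base y ∈ V), f.map y (s ⟨f.base y, hy⟩) = Y.ev _ ⟨y, hy⟩ t :=
      fun y hy => hs ⟨f.base y, hy⟩ y rfl hy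
    refine ⟨⟨s, mem_secSubmonoid.2 fun x => ?_⟩, sec_ext fun y => hs' y.1 y.2⟩
    obtain ⟨x, hx⟩ := x
    obtain ⟨y, rfl⟩ := hV x hx
    refine (hf.reg_iff hX hY).2 ?_
    obtain ⟨t', ht', e⟩ := t.2 ⟨y, hx⟩
    refine Y.reg_congr ht' ?_
    filter_upwards [(V.comap ⟨f.base, f.continuous⟩).isOpen.mem_nhds hx] with y' hy'
    refine (e ⟨y', hy'⟩).trans ((hs' y' hy').symm.trans ?_)
    exact congrArg (f.map y') (X.extend_apply V s ⟨f.base y', hy'⟩).symm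
  · refine sec_rel.2 fun x => ?_
    obtain ⟨x, hx⟩ := x
    obtain ⟨y, rfl⟩ := hV x hx
    have := hf.isIso y
    refine Blpr.rel_of_isIso (f.map y) ?_
    have := sec_rel.1 h ⟨y, hx⟩
    rw [← Blpr.mapSum_comp, ← Blpr.mapSum_comp] at this ⊢
    exact this

theorem isOpenImmersion_shMap {X Y : PreSp.{u}} (hX : X.IsGood) (hY : Y.IsGood)
    {f : Y ⟶ X} (hf : IsOpenImm f) :
    PresheafedSpace.IsOpenImmersion (shMap f).hom where
  base_open := hf.isOpenEmbedding
  c_iso U := isIso_secMap hX hY hf _ (by rintro _ ⟨y, -, rfl⟩; exact ⟨y, rfl⟩)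

/-- Open immersions into the same space with the same range have isomorphic sources. -/
theorem isSpecOf_of_isOpenImm {X : PreSp.{u}} (hX : X.IsGood) {B : Blpr.{u}} {i : specC B ⟶ X}
    (hi : IsOpenImm i) : Nonempty (X.toSh.restrict
      (Opens.isOpenEmbedding (X := TopCat.of X)
        ⟨Set.range i.base, hi.isOpenEmbedding.isOpen_range⟩) ≅ B.Spec) := by
  have h₁ := isOpenImmersion_shMap hX (specC_isGood B) hi
  let U : Opens (TopCat.of X) := ⟨Set.range i.base, hi.isOpenEmbedding.isOpen_range⟩
  have h₂ : PresheafedSpace.IsOpenImmersion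
      (X.toSh.toPresheafedSpace.ofRestrict U.isOpenEmbedding) := inferInstance
  have h₃ : Set.range (shMap i).hom.base =
      Set.range (X.toSh.toPresheafedSpace.ofRestrict U.isOpenEmbedding).base :=
    (Subtype.range_coe (s := Set.range i.base)).symm
  exact ⟨(isoSpecC B ≪≫ SheafedSpace.isoMk (X := (specC B).toSh)
    (Y := X.toSh.restrict U.isOpenEmbedding)
    (@PresheafedSpace.IsOpenImmersion.isoOfRangeEq _ _ _ _ _ (shMap i).hom h₁
      (X.toSh.toPresheafedSpace.ofRestrict U.isOpenEmbedding) h₂ h₃)).symm⟩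

theorem exists_isOpenImm {X : SheafedSpace Blpr.{u}} {B : Blpr.{u}} (U : Opens X)
    (e : X.restrict U.isOpenEmbedding ≅ B.Spec) :
    ∃ i : specC B ⟶ conc X, IsOpenImm i ∧ ∀ x ∈ U, x ∈ Set.range i.base := by
  let F : (specC B).toSh ⟶ (conc X).toSh :=
    (isoSpecC B).inv ≫ e.inv ≫ X.ofRestrict U.isOpenEmbedding ≫ (isoConc X).hom
  have hF : SheafedSpace.IsOpenImmersion F := inferInstance
  refine ⟨ofSh (conc_isGood X) F, ⟨hF.base_open, fun y => ?_⟩, fun x hx => ?_⟩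
  · have h₁ := isIso_stalkEv (conc_isGood X) (F.hom.base y)
    have h₂ := isIso_stalkEv (specC_isGood B) y
    have h₃ : IsIso (F.hom.stalkMap y) := PresheafedSpace.IsOpenImmersion.stalk_iso F.hom y
    change IsIso (CategoryTheory.inv ((conc X).stalkEv (F.hom.base y)) ≫ F.hom.stalkMap y ≫
      (specC B).stalkEv y)
    infer_instance
  · let x' : (X.restrict U.isOpenEmbedding : SheafedSpace Blpr.{u}) := ⟨x, hx⟩
    refine ⟨(isoSpecC B).hom.hom.base (e.hom.hom.base x'), ?_⟩
    have h : (e.hom ≫ (isoSpecC B).hom) ≫ F =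
        X.ofRestrict U.isOpenEmbedding ≫ (isoConc X).hom := by
      simp [F]
    have hbase := congrArg (fun k => k.hom.base x') h
    exact hbase

/-! ### Blue schemes as spaces with regular functions -/

/-- A space with regular functions that is covered by spectra of blueprints in `C`. -/
structure IsSch (C : ObjectProperty Blpr.{u}) (X : PreSp.{u}) : Prop where
  isGood : X.IsGood
  cover : ∀ x : X, ∃ B, C B ∧ ∃ i : specC B ⟶ X, IsOpenImm i ∧ x ∈ Set.range i.base

theorem IsSch.isStrictlyLocal {C : ObjectProperty Blpr.{u}} {X : PreSp.{u}} (hX : X.IsSch C)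
    (x : X) : (X.A x).IsStrictlyLocal := by
  obtain ⟨B, -, i, hi, y, rfl⟩ := hX.cover x
  have := hi.isIso y
  exact (Blpr.atPrime_isStrictlyLocal y).of_iso (i.map y)

theorem isSch_conc {C : ObjectProperty Blpr.{u}} {X : LocBlprSp.{u}} (hX : X.HasCover C) :
    (conc X.toSheafedSpace).IsSch C := by
  refine ⟨conc_isGood _, fun x => ?_⟩
  obtain ⟨U, hx, B, hB, ⟨e⟩⟩ := hX x
  obtain ⟨i, hi, h⟩ := exists_isOpenImm U e
  exact ⟨B, hB, i, hi, h x hx⟩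

theorem IsSch.mono {C C' : ObjectProperty Blpr.{u}} (h : C ≤ C') {X : PreSp.{u}} (hX : X.IsSch C) :
    X.IsSch C' :=
  ⟨hX.isGood, fun x => by
    obtain ⟨B, hB, hi⟩ := hX.cover x
    exact ⟨B, h _ hB, hi⟩⟩

/-- The locally blueprinted space of a space with regular functions. -/
noncomputable abbrev toLoc {C : ObjectProperty Blpr.{u}} {X : PreSp.{u}} (hX : X.IsSch C) :
    LocBlprSp.{u} where
  toSheafedSpace := X.toSh
  isLocal x :=
    have := isIso_stalkEv hX.isGood x
    ((hX.isStrictlyLocal x).of_iso (X.stalkEv x)).isLocal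

theorem toLoc_hasCover {C : ObjectProperty Blpr.{u}} {X : PreSp.{u}} (hX : X.IsSch C) :
    (toLoc hX).HasCover C := by
  intro x
  obtain ⟨B, hB, i, hi, hx⟩ := hX.cover x
  exact ⟨⟨Set.range i.base, hi.isOpenEmbedding.isOpen_range⟩, hx, B, hB,
    isSpecOf_of_isOpenImm hX.isGood hi⟩

/-- The blue scheme of a space with regular functions. -/
noncomputable def toBSch {C : ObjectProperty Blpr.{u}} {X : PreSp.{u}} (hX : X.IsSch C) :
    BSch.{u} := ⟨toLoc hX, toLoc_hasCover (hX.mono fun _ _ => trivial)⟩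

/-- With strictly local stalks the maximal ideals are the sets of non-units, so mapping one into the
other means reflecting units. -/
theorem isLoc_stalkMap_iff {X Y : LocBlprSp.{u}} (hX : ∀ x, (X.presheaf.stalk x).IsStrictlyLocal)
    (hY : ∀ x, (Y.presheaf.stalk x).IsStrictlyLocal) (F : X.toSheafedSpace ⟶ Y.toSheafedSpace) :
    (∀ x, Blpr.IsLoc (F.hom.stalkMap x)) ↔ ∀ (x : X.carrier)
      (m : Set (Y.presheaf.stalk (F.hom.base x))) (n : Set (X.presheaf.stalk x)),
      Blpr.IsMaximalIdeal _ m → Blpr.IsMaximalIdeal _ n →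
        Set.MapsTo (F.hom.stalkMap x).toMonoidHom m n := by
  refine forall_congr' fun x => ⟨fun h m n hm hn => ?_, fun h a ha => ?_⟩
  · rw [(hY _).isMaximalIdeal_iff.1 hm, (hX _).isMaximalIdeal_iff.1 hn]
    exact fun a ha hu => ha (h a hu)
  · by_contra h'
    exact h _ _ ((hY _).isMaximalIdeal_iff.2 rfl) ((hX _).isMaximalIdeal_iff.2 rfl) h' ha

theorem isLoc_of_isIso_hom {X Y : SheafedSpace Blpr.{u}} (F : X ⟶ Y) [IsIso F] (x : X) :
    Blpr.IsLoc (F.hom.stalkMap x) := by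
  have : IsIso (F.hom.stalkMap x) := PresheafedSpace.IsOpenImmersion.stalk_iso F.hom x
  exact Blpr.isLoc_of_isIso _

theorem isLoc_stalkMap_comp {X Y Z : SheafedSpace Blpr.{u}} (F : X ⟶ Y) (G : Y ⟶ Z)
    (hF : ∀ x, Blpr.IsLoc (F.hom.stalkMap x)) (hG : ∀ x, Blpr.IsLoc (G.hom.stalkMap x)) (x : X) :
    Blpr.IsLoc ((F ≫ G).hom.stalkMap x) := by
  have h : (F ≫ G).hom.stalkMap x = G.hom.stalkMap (F.hom.base x) ≫ F.hom.stalkMap x :=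
    PresheafedSpace.stalkMap.comp F.hom G.hom x
  rw [h]
  exact (hG _).comp (hF x)

theorem isLoc_shMap_iff {X Y : PreSp.{u}} (hX : X.IsGood) (hY : Y.IsGood) (f : Y ⟶ X) :
    (∀ y, Blpr.IsLoc ((shMap f).hom.stalkMap y)) ↔ IsLocal f := by
  refine forall_congr' fun y => ?_
  have h₁ := isIso_stalkEv hX (f.base y)
  have h₂ := isIso_stalkEv hY y
  have h := shMap_stalkMap f y
  constructor
  · intro h'
    have h₃ : f.map y = CategoryTheory.inv (X.stalkEv (f.base y)) ≫
        (shMap f).hom.stalkMap y ≫ Y.stalkEv y :=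
      (IsIso.eq_inv_comp _).2 h.symm
    rw [h₃]
    exact (Blpr.isLoc_of_isIso _).comp (h'.comp (Blpr.isLoc_of_isIso _))
  · intro h'
    have h₃ : Blpr.IsLoc (X.stalkEv (f.base y) ≫ f.map y) :=
      (@Blpr.isLoc_of_isIso _ _ _ h₁).comp h'
    exact Blpr.IsLoc.of_comp ((congrArg Blpr.IsLoc h).mpr h₃)

/-- A solution of the universal problem for spaces with regular functions gives a solution for
blue schemes. -/
theorem exists_universal {C : ObjectProperty Blpr.{u}} (X : BSch.{u}) {Z : PreSp.{u}}
    (hZ : Z.IsSch C) (β : Z ⟶ conc X.obj.toSheafedSpace) (hβ : IsLocal β)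
    (huniv : ∀ Y : PreSp.{u}, Y.IsSch C → ∀ φ : Y ⟶ conc X.obj.toSheafedSpace, IsLocal φ →
      ∃ ψ : Y ⟶ Z, IsLocal ψ ∧ ψ ≫ β = φ ∧ ∀ ψ' : Y ⟶ Z, IsLocal ψ' → ψ' ≫ β = φ → ψ' = ψ) :
    ∃ (GX : BSch.{u}) (β : GX ⟶ X), IsUniversalFrom C β := by
  have hXs := isSch_conc X.property
  have hstX : ∀ x, (X.obj.presheaf.stalk x).IsStrictlyLocal := fun x => hXs.isStrictlyLocal x
  have hstZ : ∀ x, ((toLoc hZ).presheaf.stalk x).IsStrictlyLocal := fun x =>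
    have := isIso_stalkEv hZ.isGood x
    (hZ.isStrictlyLocal x).of_iso (Z.stalkEv x)
  let jX := isoConc X.obj.toSheafedSpace
  let βs : (toLoc hZ).toSheafedSpace ⟶ X.obj.toSheafedSpace := shMap β ≫ jX.inv
  have hβs := (isLoc_stalkMap_iff hstZ hstX βs).1 (isLoc_stalkMap_comp _ _
    ((isLoc_shMap_iff hXs.isGood hZ.isGood β).2 hβ) (isLoc_of_isIso_hom jX.inv))
  let βb : toBSch hZ ⟶ X := ObjectProperty.homMk (⟨βs, hβs⟩ : LocBlprSp.Hom _ _)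
  refine ⟨toBSch hZ, βb, toLoc_hasCover hZ, fun Y hY φ => ?_⟩
  have hYs : (conc Y.obj.toSheafedSpace).IsSch C := isSch_conc hY
  have hstY : ∀ x, (Y.obj.presheaf.stalk x).IsStrictlyLocal := fun x => hYs.isStrictlyLocal x
  let jY := isoConc Y.obj.toSheafedSpace
  let φs : Y.obj.toSheafedSpace ⟶ X.obj.toSheafedSpace := φ.hom.toShHom
  have hφs := (isLoc_stalkMap_iff hstY hstX φs).2 φ.hom.map_maximalIdeal
  let φ' : conc Y.obj.toSheafedSpace ⟶ conc X.obj.toSheafedSpace :=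
    ofSh hXs.isGood (jY.inv ≫ φs ≫ jX.hom)
  have eφ : shMap φ' = jY.inv ≫ φs ≫ jX.hom := shMap_ofSh _ _
  have hφ' : IsLocal φ' := by
    rw [← isLoc_shMap_iff hXs.isGood hYs.isGood, eφ]
    exact isLoc_stalkMap_comp _ _ (isLoc_of_isIso_hom _)
      (isLoc_stalkMap_comp _ _ hφs (isLoc_of_isIso_hom _))
  obtain ⟨ψ, hψ, e, hu⟩ := huniv _ hYs φ' hφ'
  let ψs : Y.obj.toSheafedSpace ⟶ (toLoc hZ).toSheafedSpace := jY.hom ≫ shMap ψ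
  have hψs := (isLoc_stalkMap_iff hstY hstZ ψs).1 (isLoc_stalkMap_comp _ _
    (isLoc_of_isIso_hom jY.hom) ((isLoc_shMap_iff hZ.isGood hYs.isGood ψ).2 hψ))
  refine ⟨ObjectProperty.homMk (⟨ψs, hψs⟩ : LocBlprSp.Hom _ _), ?_, fun ψ' hψ' => ?_⟩
  · refine ObjectProperty.hom_ext _ (LocBlprSp.Hom.ext ?_)
    change (jY.hom ≫ shMap ψ) ≫ shMap β ≫ jX.inv = φs
    have e' : shMap ψ ≫ shMap β = jY.inv ≫ φs ≫ jX.hom := by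
      rw [← shMap_comp, e, eφ]
    rw [Category.assoc, ← Category.assoc (shMap ψ), e', Category.assoc, Category.assoc,
      jX.hom_inv_id, Category.comp_id, jY.hom_inv_id_assoc]
  · refine ObjectProperty.hom_ext _ (LocBlprSp.Hom.ext ?_)
    let ψs' : Y.obj.toSheafedSpace ⟶ Z.toSh := ψ'.hom.toShHom
    have hloc := (isLoc_stalkMap_iff hstY hstZ ψs').2 ψ'.hom.map_maximalIdeal
    let ψ₁ : conc Y.obj.toSheafedSpace ⟶ Z := ofSh hZ.isGood (jY.inv ≫ ψs')
    have e₁ : shMap ψ₁ = jY.inv ≫ ψs' := shMap_ofSh _ _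
    have h₁ : IsLocal ψ₁ := by
      rw [← isLoc_shMap_iff hZ.isGood hYs.isGood, e₁]
      exact isLoc_stalkMap_comp _ _ (isLoc_of_isIso_hom _) hloc
    have h₂ : ψs' ≫ shMap β ≫ jX.inv = φs :=
      congrArg (fun k => LocBlprSp.Hom.toShHom (InducedCategory.Hom.hom k)) hψ'
    have h₃ : ψ₁ ≫ β = φ' := by
      refine shMap_injective hXs.isGood ?_
      rw [shMap_comp, e₁, eφ, ← h₂]
      simp
    have h₄ := hu ψ₁ h₁ h₃
    change ψs' = jY.hom ≫ shMap ψ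
    rw [← h₄, e₁, jY.hom_inv_id_assoc]

end PreSp

/-! ### Reflections -/

/-- A reflection of the category of blueprints onto `C`. -/
structure Reflection (C : ObjectProperty Blpr.{u}) where
  G : Blpr.{u} → Blpr.{u}
  mem : ∀ B, C (G B)
  η : ∀ B, B ⟶ G B
  lift : ∀ {B R : Blpr.{u}}, C.isoClosure R → (B ⟶ R) → (G B ⟶ R)
  fac : ∀ {B R : Blpr.{u}} (hR : C.isoClosure R) (f : B ⟶ R), η B ≫ lift hR f = f
  hom_ext : ∀ {B R : Blpr.{u}}, C.isoClosure R → ∀ {f g : G B ⟶ R}, η B ≫ f = η B ≫ g → f = g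

namespace Reflection

variable {C : ObjectProperty Blpr.{u}}

/-- The adjunction gives extensions to objects of `C`; conjugating by an isomorphism covers objects
that are only isomorphic to one. -/
theorem nonempty (h : C.ι.IsRightAdjoint) : Nonempty (Reflection C) := by
  let adj := Adjunction.ofIsRightAdjoint C.ι
  let L := C.ι.leftAdjoint
  refine ⟨⟨fun B => (L.obj B).obj, fun B => (L.obj B).property, fun B => adj.unit.app B,
    fun {B R} hR f => ((adj.homEquiv B ⟨_, hR.choose_spec.1⟩).symm
      (f ≫ hR.choose_spec.2.some.hom)).hom ≫ hR.choose_spec.2.some.inv, ?_, ?_⟩⟩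
  · intro B R hR f
    have h := (adj.homEquiv B ⟨_, hR.choose_spec.1⟩).apply_symm_apply
      (f ≫ hR.choose_spec.2.some.hom)
    rw [Adjunction.homEquiv_unit] at h
    rw [← Category.assoc]
    refine (congrArg (· ≫ hR.choose_spec.2.some.inv) h).trans ?_
    rw [Category.assoc, Iso.hom_inv_id, Category.comp_id]
  · rintro B R ⟨R', hR', ⟨e⟩⟩ f g h
    let f' : L.obj B ⟶ (⟨R', hR'⟩ : C.FullSubcategory) := ObjectProperty.homMk (f ≫ e.hom)
    let g' : L.obj B ⟶ (⟨R', hR'⟩ : C.FullSubcategory) := ObjectProperty.homMk (g ≫ e.hom)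
    have h' : f' = g' := by
      refine (adj.homEquiv B ⟨R', hR'⟩).injective ?_
      rw [Adjunction.homEquiv_unit, Adjunction.homEquiv_unit]
      change adj.unit.app B ≫ f ≫ e.hom = adj.unit.app B ≫ g ≫ e.hom
      rw [← Category.assoc, ← Category.assoc]
      exact congrArg (· ≫ e.hom) h
    have h'' : f ≫ e.hom = g ≫ e.hom := congrArg (fun k => InducedCategory.Hom.hom k) h'
    exact (cancel_mono e.hom).1 h''

variable (ρ : Reflection C)

theorem mem_isoClosure (B : Blpr.{u}) : C.isoClosure (ρ.G B) := C.le_isoClosure _ (ρ.mem B)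

theorem fac_apply {B R : Blpr.{u}} (hR : C.isoClosure R) (f : B ⟶ R) (b : B) :
    ρ.lift hR f (ρ.η B b) = f b := Blpr.hom_congr (ρ.fac hR f) b

include ρ in
/-- A blueprint is in `C` if morphisms to it extend uniquely along the reflection. -/
theorem isoClosure_of_lift {R : Blpr.{u}} (r : ρ.G R ⟶ R) (hr : ρ.η R ≫ r = 𝟙 R) :
    C.isoClosure R := by
  refine ⟨ρ.G R, ρ.mem R, ⟨⟨ρ.η R, r, hr, ?_⟩⟩⟩
  refine ρ.hom_ext (ρ.mem_isoClosure R) ?_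
  rw [← Category.assoc, hr, Category.id_comp, Category.comp_id]

include ρ in
/-- Products of members of `C` are in `C`. -/
theorem isoClosure_pi {ι : Type u} (F : ι → Blpr.{u}) (hF : ∀ i, C.isoClosure (F i)) :
    C.isoClosure (Blpr.pi F) := by
  refine ρ.isoClosure_of_lift (Blpr.piLift fun i => ρ.lift (hF i) (Blpr.piProj F i)) ?_
  refine Blpr.pi_hom_ext fun i => ?_
  rw [Category.assoc, Category.id_comp]
  exact ρ.fac (hF i) (Blpr.piProj F i)

end Reflection

theorem StableUnderLocalization.isoClosure {C : ObjectProperty Blpr.{u}}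
    (hC : StableUnderLocalization C) {B : Blpr.{u}} (hB : C.isoClosure B) (S : Submonoid B) :
    C.isoClosure (B.localization S) := by
  obtain ⟨B', hB', ⟨e⟩⟩ := hB
  obtain ⟨S', ⟨e'⟩⟩ := Blpr.exists_localization_iso e S
  obtain ⟨R, hR, ⟨e''⟩⟩ := hC B' hB' S'
  exact ⟨R, hR, ⟨e' ≪≫ e''⟩⟩

theorem Blpr.IsProper.of_iso {B B' : Blpr.{u}} (hB : B.IsProper) (e : B' ≅ B) : B'.IsProper := by
  intro a b h
  refine (Blpr.bijective_of_isIso e.hom).1 (hB _ _ ?_)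
  have := e.hom.map_rel _ _ h
  rwa [Blpr.mapSum_el, Blpr.mapSum_el] at this

/-! ### Regularity of reflected functions -/

namespace Blpr

variable {D : Blpr.{u}} (V : Opens (PrimeSpec D))

/-- The product of the stalks over `V`. -/
noncomputable abbrev stalkProd : Blpr.{u} := pi fun y : V => D.atPrime y.1

/-- The fractions with denominator one. -/
noncomputable abbrev diag : D ⟶ stalkProd V := piLift fun y : V => D.locHom y.1.compl

variable {V}

/-- Over a blueprint without zero, an equation between regular functions propagates from a
nonempty open subset; over a proper blueprint with a zero it can be multiplied by zero. -/
theorem exists_mul_eq_mul {p : V} (hproper : ∀ q : V, (D.atPrime q.1).IsProper)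
    {x : ∀ q : V, D.atPrime q.1} (hx : x ∈ (PreSp.specC D).secSubmonoid V) {a s : D}
    (h : ∀ᶠ q in 𝓝 p.1, ∀ hq : q ∈ V, x ⟨q, hq⟩ * D.locHom q.compl s = D.locHom q.compl a)
    (q : V) : ∃ t : D.atPrime q.1,
      t * (x q * D.locHom q.1.compl s) = t * D.locHom q.1.compl a := by
  by_cases hD : D.HasZeroElem
  -- The multiplier is the zero `e`: all its multiples are related to the empty sum, hence equal in
  -- the proper stalk.
  · obtain ⟨e, he⟩ := hD
    have key : ∀ y z : D.atPrime q.1,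
        D.locHom q.1.compl e * y = D.locHom q.1.compl e * z := fun y z => by
      refine hproper q _ _ ?_
      have h₀ : (D.atPrime q.1).rel (el (D.locHom q.1.compl e)) 0 := by
        have := (D.locHom q.1.compl).map_rel _ _ he
        rwa [mapSum_el, map_zero] at this
      have h₁ : ∀ y : D.atPrime q.1, (D.atPrime q.1).rel (el (D.locHom q.1.compl e * y)) 0 :=
        fun y => by
          have := (D.atPrime q.1).rel.mul h₀ ((D.atPrime q.1).rel.refl (el y))
          rwa [zero_mul, ← el_mul] at this
      exact (D.atPrime q.1).rel.trans (h₁ y) ((D.atPrime q.1).rel.symm (h₁ z))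
    exact ⟨_, key _ _⟩
  -- Without a zero the empty set is a prime ideal. It lies in every nonempty open set, so what
  -- holds near some point holds at `g`.
  · let g : PrimeSpec D :=
      { ideal := ∅
        isPrime :=
          { mul_mem := fun _ _ h => h.elim
            zero_mem := fun e he => (hD ⟨e, he⟩).elim
            mem_of_rel := fun _ _ _ h => h.elim
            one_notMem := fun h => h
            mul_notMem := fun _ _ _ _ h => h } }
    have hg : ∀ {r : PrimeSpec D} {P : PrimeSpec D → Prop}, (∀ᶠ y in 𝓝 r, P y) → P g :=
      fun {r P} h => by
        obtain ⟨W, hW, ho, hr⟩ := eventually_nhds_iff.1 h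
        obtain ⟨b, -, hb⟩ := exists_basicOpen_subset ho hr
        exact hW g (hb (show b ∉ g.ideal from fun h => h))
    have hgV : g ∈ V := hg (V.isOpen.mem_nhds p.2)
    have e₁ := hg h hgV
    obtain ⟨x', ⟨b, c, hc, hx'⟩, e⟩ := hx q
    have e₂ := hg hx'
    rw [show x' g = x ⟨g, hgV⟩ from e ⟨g, hgV⟩] at e₂
    -- At `g` both representations of `x` are available: `a / s` from near `p` and `b / c` from near
    -- `q`. Their equality is witnessed by a single `t` in `D`, which is the multiplier at `q`.
    have e₃ : D.locHom g.compl (c * a) = D.locHom g.compl (b * s) := by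
      rw [map_mul, map_mul, ← e₁, ← e₂, mul_left_comm]
      exact (mul_assoc _ _ _).symm
    obtain ⟨t, ht⟩ := locHom_eq_iff.1 e₃
    refine ⟨D.locHom q.1.compl t, (isUnit_locHom D q.1.compl ⟨c, hc⟩).mul_left_cancel ?_⟩
    have e₄ := hx'.self_of_nhds
    rw [show x' q.1 = x q from e q] at e₄
    have e₅ := congrArg (D.locHom q.1.compl).toMonoidHom ht
    simp only [map_mul] at e₅
    rw [← e₄] at e₅
    have aux : ∀ {M : Type u} [CommMonoid M] (t c a x s : M), t * (c * a) = t * (x * c * s) →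
        c * (t * (x * s)) = c * (t * a) := fun t c a x s h => by
      rw [mul_left_comm c t a, h]
      ac_rfl
    exact aux _ _ _ _ _ e₅

/-- A substitute in `C` for the blueprint of germs at `p` of arbitrary functions. -/
theorem exists_germ_hom {C : ObjectProperty Blpr.{u}} (hC : StableUnderLocalization C)
    (ρ : Reflection C)
    (h : (∀ B : Blpr.{u}, C B → B.IsProper) ∨ StableUnderDirectedColimits C)
    (hD : C.isoClosure D) (p : V) :
    ∃ (R : Blpr.{u}) (_ : C.isoClosure R) (α : stalkProd V ⟶ R),
      (∀ s, s ∉ p.1.ideal → IsUnit (α (diag V s))) ∧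
      (∀ x y : stalkProd V, α x = α y → ∀ᶠ q in 𝓝 p.1, ∀ hq : q ∈ V, x ⟨q, hq⟩ = y ⟨q, hq⟩) ∧
      ∀ (x : stalkProd V) (a s : D), x ∈ (PreSp.specC D).secSubmonoid V →
        (∀ᶠ q in 𝓝 p.1, ∀ hq : q ∈ V, x ⟨q, hq⟩ * D.locHom q.compl s = D.locHom q.compl a) →
        α (x * diag V s) = α (diag V a) := by
  classical
  have hst : ∀ q : PrimeSpec D, C.isoClosure (D.atPrime q) := fun q => hC.isoClosure hD _
  -- An element outside `p` is invertible as a function near `p`; its inverse is continued by one.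
  have hunit : ∀ s, s ∉ p.1.ideal → ∃ y : stalkProd V, ∀ᶠ q in 𝓝 p.1, ∀ hq : q ∈ V,
      (diag V s * y) ⟨q, hq⟩ = 1 := fun s hs => by
    refine ⟨fun q => if hq : s ∉ q.1.ideal then
      (isUnit_atPrime_iff.2 hq).exists_right_inv.choose else 1, ?_⟩
    filter_upwards [eventually_notMem hs] with q hq hqV
    refine (congrArg (D.locHom q.compl s * ·) (dif_pos hq)).trans ?_
    exact (isUnit_atPrime_iff.2 hq).exists_right_inv.choose_spec
  rcases h with h | h
  -- Proper case: functions equal to one near `p` are inverted. The localization stays in `C`, and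
  -- functions identified in it agree near `p`.
  · let T : Submonoid (stalkProd V) :=
      { carrier := {t | ∀ᶠ q in 𝓝 p.1, ∀ hq : q ∈ V, t ⟨q, hq⟩ = 1}
        one_mem' := Filter.Eventually.of_forall fun _ _ => rfl
        mul_mem' := fun {t t'} ht ht' => by
          filter_upwards [ht, ht'] with q hq hq' hqV
          change t ⟨q, hqV⟩ * t' ⟨q, hqV⟩ = 1
          rw [hq hqV, hq' hqV, mul_one] }
    refine ⟨(stalkProd V).localization T,
      hC.isoClosure (ρ.isoClosure_pi _ fun q : V => hst q.1) T, (stalkProd V).locHom T, ?_, ?_, ?_⟩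
    · intro s hs
      obtain ⟨y, hy⟩ := hunit s hs
      have := isUnit_locHom (stalkProd V) T ⟨_, hy⟩
      rw [map_mul] at this
      exact isUnit_of_mul_isUnit_left this
    · intro x y hxy
      obtain ⟨t, ht⟩ := locHom_eq_iff.1 hxy
      filter_upwards [t.2] with q hq hqV
      have := congrFun ht ⟨q, hqV⟩
      change t.1 ⟨q, hqV⟩ * x ⟨q, hqV⟩ = t.1 ⟨q, hqV⟩ * y ⟨q, hqV⟩ at this
      rwa [hq hqV, one_mul, one_mul] at this
    · intro x a s hx hxs
      have hproper : ∀ q : V, (D.atPrime q.1).IsProper := fun q => by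
        obtain ⟨R, hR, ⟨e⟩⟩ := hst q.1
        exact (h R hR).of_iso e
      choose t ht using exists_mul_eq_mul (p := p) hproper hx hxs
      -- The denominator is one where the equation holds, in particular near `p`, and elsewhere the
      -- multiplier that makes both sides equal.
      let t' : stalkProd V := fun q =>
        if x q * D.locHom q.1.compl s = D.locHom q.1.compl a then 1 else t q
      refine locHom_eq_iff.2 ⟨⟨t', ?_⟩, funext fun q => ?_⟩
      · filter_upwards [hxs] with q hq hqV
        exact if_pos (hq hqV)
      · by_cases hq : x q * D.locHom q.1.compl s = D.locHom q.1.compl a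
        · exact congrArg (t' q * ·) hq
        · refine (congrArg (· * _) (if_neg hq)).trans ((ht q).trans ?_)
          exact (congrArg (· * _) (if_neg hq)).symm
  -- Colimit case: the products of the stalks over the neighbourhoods of `p` inside `V` form a
  -- directed system in `C`, whose colimit identifies functions exactly when they agree near `p`.
  · let J : Type u := {W : Opens (PrimeSpec D) // p.1 ∈ W ∧ W ≤ V}ᵒᵈ
    let top : J := OrderDual.toDual ⟨V, p.2, le_rfl⟩
    have : Nonempty J := ⟨top⟩
    have : IsDirectedOrder J := ⟨fun W W' =>
      ⟨OrderDual.toDual ⟨W.1 ⊓ W'.1, ⟨W.2.1, W'.2.1⟩, inf_le_left.trans W.2.2⟩,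
        (inf_le_left : W.1 ⊓ W'.1 ≤ W.1), (inf_le_right : W.1 ⊓ W'.1 ≤ W'.1)⟩⟩
    let F : J ⥤ Blpr.{u} :=
      { obj := fun W => stalkProd W.1
        map := fun {W W'} i => piLift fun y : W'.1 =>
          piProj (fun y : W.1 => D.atPrime y.1) ⟨y.1, (show W'.1 ≤ W.1 from leOfHom i) y.2⟩ }
    have hF : ∀ W : J, C.isoClosure (F.obj W) := fun W => ρ.isoClosure_pi _ fun q => hst q.1
    have hR := @ObjectProperty.prop_of_isColimit _ _ _ _ _ (h J) F _ (colimIsColimit F) hF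
    let α : stalkProd V ⟶ (colimCocone F).pt := (colimCocone F).ι.app top
    have hα : ∀ x y : stalkProd V, (∀ᶠ q in 𝓝 p.1, ∀ hq : q ∈ V, x ⟨q, hq⟩ = y ⟨q, hq⟩) →
        α x = α y := fun x y hxy => by
      obtain ⟨W, hW, ho, hpW⟩ := eventually_nhds_iff.1 hxy
      let k : J := OrderDual.toDual ⟨⟨W, ho⟩ ⊓ V, ⟨hpW, p.2⟩, inf_le_right⟩
      let i : top ⟶ k := homOfLE (show (⟨W, ho⟩ ⊓ V : Opens _) ≤ V from inf_le_right)
      have e : F.map i x = F.map i y := funext fun q => hW q.1 q.2.1 q.2.2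
      have e₁ := hom_congr ((colimCocone F).w i) x
      have e₂ := hom_congr ((colimCocone F).w i) y
      exact e₁.symm.trans ((congrArg ((colimCocone F).ι.app k) e).trans e₂)
    refine ⟨_, hR, α, fun s hs => ?_, fun x y hxy => ?_,
      fun x a s _ hx => hα _ _ hx⟩
    · obtain ⟨y, hy⟩ := hunit s hs
      have e := hα _ 1 hy
      rw [map_mul, map_one] at e
      exact IsUnit.of_mul_eq_one _ e
    · obtain ⟨k, i, e⟩ := filtered_exists_eq (colimIsColimit F) hxy
      filter_upwards [k.1.isOpen.mem_nhds k.2.1] with q hq hqV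
      exact congrFun e ⟨q, hq⟩

/-- The extension to the reflection of a morphism to regular functions has values in regular
functions. -/
theorem lift_mem_secSubmonoid {C : ObjectProperty Blpr.{u}} (hC : StableUnderLocalization C)
    (ρ : Reflection C)
    (h : (∀ B : Blpr.{u}, C B → B.IsProper) ∨ StableUnderDirectedColimits C)
    (hD : C.isoClosure D) {B : Blpr.{u}} (f : ∀ y : V, B ⟶ D.atPrime y.1)
    (hf : ∀ b, (fun y => f y b) ∈ (PreSp.specC D).secSubmonoid V) (c : ρ.G B) :
    (fun y => ρ.lift (hC.isoClosure hD y.1.compl) (f y) c) ∈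
      (PreSp.specC D).secSubmonoid V := by
  have hst : ∀ q : PrimeSpec D, C.isoClosure (D.atPrime q) := fun q => hC.isoClosure hD _
  refine PreSp.mem_secSubmonoid.2 fun p => ?_
  obtain ⟨R, hR, α, h₁, h₂, h₃⟩ := exists_germ_hom hC ρ h hD p
  let fc : ∀ y : V, ρ.G B ⟶ D.atPrime y.1 := fun y => ρ.lift (hst y.1) (f y)
  let δ : D.atPrime p.1 ⟶ R := locLift (diag V ≫ α) fun s => h₁ s s.2
  -- The whole family near `p` and its value at `p` alone give the same morphism to `R`. On `B` this
  -- holds because `f y b` is one fraction near `p`; the uniqueness of extensions gives it on `G B`.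
  have key : piLift fc ≫ α = fc p ≫ δ := by
    refine ρ.hom_ext hR ?_
    have e : ρ.η B ≫ piLift fc = piLift f := pi_hom_ext fun i => ρ.fac (hst i.1) (f i)
    rw [← Category.assoc, e, ← Category.assoc, ρ.fac (hst p.1) (f p)]
    refine Blpr.hom_ext fun b => ?_
    obtain ⟨x, ⟨a, s, hs, hx⟩, e⟩ := hf b p
    have h₄ : ∀ᶠ q in 𝓝 p.1, ∀ hq : q ∈ V,
        (piLift f b : stalkProd V) ⟨q, hq⟩ * D.locHom q.compl s = D.locHom q.compl a := by
      filter_upwards [hx] with q hq hqV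
      exact (congrArg (· * _) (e ⟨q, hqV⟩).symm).trans hq
    have h₅ := h₃ (piLift f b) a s (hf b) h₄
    have h₆ : f p b * D.locHom p.1.compl s = D.locHom p.1.compl a := h₄.self_of_nhds p.2
    have h₇ := congrArg δ.toMonoidHom h₆
    rw [map_mul, locLift_locHom, locLift_locHom] at h₇
    rw [map_mul] at h₅
    exact (h₁ s hs).mul_right_cancel (h₅.trans h₇.symm)
  -- Write the value at `p` as `a / s`. By `key` the same equation holds in `R` for the whole
  -- family, and equality in `R` means equality near `p`.
  obtain ⟨a, s, e⟩ := exists_mul_locHom (fc p c)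
  have h₄ := congrArg δ.toMonoidHom e
  rw [map_mul, locLift_locHom, locLift_locHom] at h₄
  have h₅ : α (piLift fc c * diag V s) = α (diag V a) := by
    rw [map_mul]
    exact (congrArg (· * _) (hom_congr key c)).trans h₄
  refine ⟨a, s, s.2, ?_⟩
  filter_upwards [h₂ _ _ h₅, V.isOpen.mem_nhds p.2] with q hq hqV
  refine Eq.trans ?_ (hq hqV)
  exact congrArg (· * D.locHom q.compl s) ((PreSp.specC D).extend_apply V _ ⟨q, hqV⟩)

end Blpr

namespace Blpr

/-! ### Points of spectra -/

section SpecPt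

variable {B L : Blpr.{u}} (hL : L.IsStrictlyLocal)

/-- The point of the spectrum of `B` with values in `L` that is defined by a morphism `B ⟶ L`. -/
noncomputable def specPt (f : B ⟶ L) : (PreSp.specC B).Pt L :=
  ⟨primeOf hL f, locLift f fun s => not_not.1 s.2⟩

theorem locHom_specPt (f : B ⟶ L) : B.locHom (specPt hL f).1.compl ≫ (specPt hL f).2 = f :=
  locHom_locLift _ _

theorem specPt_locHom (f : B ⟶ L) (b : B) :
    (specPt hL f).2 (B.locHom (specPt hL f).1.compl b) = f b :=
  hom_congr (locHom_specPt hL f) b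

theorem notMem_specPt {f : B ⟶ L} {b : B} : b ∉ (specPt hL f).1.ideal ↔ IsUnit (f b) := not_not

theorem specPt_isLoc (f : B ⟶ L) : IsLoc (specPt hL f).2 := by
  intro x hx
  obtain ⟨a, s, h⟩ := exists_mul_locHom x
  refine (isUnit_atPrime_of_mul_eq h).2 ((notMem_specPt hL).2 ?_)
  have h' := congrArg (specPt hL f).2.toMonoidHom h
  rw [map_mul, specPt_locHom, specPt_locHom] at h'
  rw [← h']
  exact hx.mul ((notMem_specPt hL).1 s.2)

/-- As `P` is local, its prime ideal consists of the elements of `B` with non-invertible image in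
`L`; so both the prime and the map on the localization are recovered from `B → L`. -/
theorem eq_specPt (P : (PreSp.specC B).Pt L) (hP : IsLoc P.2) {f : B ⟶ L}
    (h : B.locHom P.1.compl ≫ P.2 = f) : P = specPt hL f := by
  have key : ∀ {p p' : PrimeSpec B} (_ : p = p') (g : B.atPrime p ⟶ L) (g' : B.atPrime p' ⟶ L),
      B.locHom p.compl ≫ g = B.locHom p'.compl ≫ g' →
      (⟨p, g⟩ : (PreSp.specC B).Pt L) = ⟨p', g'⟩ := by
    rintro p _ rfl g g' e
    rw [localization_hom_ext e]
  refine key (PrimeSpec.ext (Set.ext fun a => ?_)) _ _ (h.trans (locHom_specPt hL f).symm)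
  rw [← not_iff_not, ← isUnit_atPrime_iff]
  refine Iff.trans ?_ (notMem_specPt hL).symm
  rw [← h]
  exact ⟨fun ha => ha.map P.2.toMonoidHom, fun ha => hP _ ha⟩

end SpecPt

/-! ### Morphisms into a spectrum from regular values -/

section SpecHom

variable {B : Blpr.{u}} {Y : PreSp.{u}} (hY : Y.IsGood) (hYL : ∀ y, (Y.A y).IsStrictlyLocal)
  {V : Opens Y} {f : ∀ y : V, B ⟶ Y.A y.1}
  (hf : ∀ b, (fun y => f y b) ∈ Y.secSubmonoid V)

include hY hf in
-- Lying in a basic open set `U_b` means that `f y b` is a unit, and a regular function with a unit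
-- value is invertible nearby.
theorem isOpen_specPt_preimage {W : Set (PrimeSpec B)} (hW : IsOpen W) :
    IsOpen {y : Y | ∃ h : y ∈ V, (specPt (hYL y) (f ⟨y, h⟩)).1 ∈ W} := by
  rw [isOpen_iff_mem_nhds]
  rintro y ⟨hy, hyW⟩
  obtain ⟨b, hb, hbW⟩ := exists_basicOpen_subset hW hyW
  have hb' : IsUnit (Y.extend V (fun y => f y b) y) := by
    rw [Y.extend_apply V _ ⟨y, hy⟩]
    exact (notMem_specPt (hYL y)).1 hb
  obtain ⟨t, -, ht⟩ := hY.isUnit (PreSp.mem_secSubmonoid.1 (hf b) ⟨y, hy⟩) hb'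
  filter_upwards [ht, V.isOpen.mem_nhds hy] with y' hy' hV
  refine ⟨hV, hbW ((notMem_specPt (hYL y')).2 ?_)⟩
  rw [Y.extend_apply V _ ⟨y', hV⟩] at hy'
  exact IsUnit.of_mul_eq_one _ hy'

include hY hf in
-- Near the image point `s` is a fraction `a / h`, so its pullback is `f a` times a regular inverse
-- of `f h`.
theorem specPt_reg {y : V} {s : ∀ q, B.atPrime q}
    (hs : s ∈ (PreSp.specC B).regAt (specPt (hYL y.1) (f y)).1) :
    Y.extend V (fun y => (specPt (hYL y.1) (f y)).eval s) ∈ Y.regAt y.1 := by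
  obtain ⟨a, h, hp, e⟩ := hs
  obtain ⟨W, hW, ho, hyW⟩ := eventually_nhds_iff.1 e
  have hu : IsUnit (Y.extend V (fun y => f y h) y.1) := by
    rw [Y.extend_apply V _ y]
    exact (notMem_specPt (hYL y.1)).1 hp
  obtain ⟨t, ht, e'⟩ := hY.isUnit (PreSp.mem_secSubmonoid.1 (hf h) y) hu
  refine Y.reg_congr (mul_mem (PreSp.mem_secSubmonoid.1 (hf a) y) ht) ?_
  filter_upwards [e', (isOpen_specPt_preimage hY hYL hf ho).mem_nhds ⟨y.2, hyW⟩] with z hz hz'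
  obtain ⟨hzV, hzW⟩ := hz'
  have h₁ := congrArg (specPt (hYL z) (f ⟨z, hzV⟩)).2.toMonoidHom (hW _ hzW)
  rw [map_mul, specPt_locHom, specPt_locHom] at h₁
  rw [Y.extend_apply V _ ⟨z, hzV⟩] at hz
  rw [Pi.mul_apply, Y.extend_apply V _ ⟨z, hzV⟩, Y.extend_apply V _ ⟨z, hzV⟩, ← h₁, mul_assoc]
  exact (congrArg _ hz).trans (mul_one _)

end SpecHom

/-- The morphism to the spectrum of `B` that is defined by a morphism from `B` to the regular
functions. -/
noncomputable def specHom {B : Blpr.{u}} {Y : PreSp.{u}} (hY : Y.IsGood)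
    (hYL : ∀ y, (Y.A y).IsStrictlyLocal) (f : ∀ y, B ⟶ Y.A y)
    (hf : ∀ b y, (fun y => f y b) ∈ Y.regAt y) : Y ⟶ PreSp.specC B :=
  have hf' : ∀ b, (fun y : (⊤ : Opens Y) => f y.1 b) ∈ Y.secSubmonoid ⊤ :=
    fun b y => ⟨_, hf b y.1, fun _ => rfl⟩
  { pt := fun y => specPt (hYL y) (f y)
    continuous := ⟨fun W hW => by
      have := isOpen_specPt_preimage (V := ⊤) hY hYL hf' hW
      refine Eq.subst (motive := IsOpen) (Set.ext fun y => ?_) this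
      exact ⟨fun h => h.2, fun h => ⟨trivial, h⟩⟩⟩
    reg := fun {y s} hs => by
      refine Y.reg_congr (specPt_reg (V := ⊤) hY hYL hf' (y := ⟨y, trivial⟩) hs)
        (Filter.Eventually.of_forall fun z => ?_)
      exact Y.extend_apply ⊤ _ ⟨z, trivial⟩ }

/-- The morphism of spectra that is defined by a morphism of blueprints. -/
noncomputable def specMap {B D : Blpr.{u}} (g : B ⟶ D) : PreSp.specC D ⟶ PreSp.specC B :=
  specHom (PreSp.specC_isGood D) (fun p => atPrime_isStrictlyLocal p)
    (fun p => g ≫ D.locHom p.compl) fun b p => PreSp.specC_const_mem D p (g b)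

theorem specMap_isLocal {B D : Blpr.{u}} (g : B ⟶ D) : PreSp.IsLocal (specMap g) := fun p =>
  specPt_isLoc (atPrime_isStrictlyLocal p) (g ≫ D.locHom p.compl)

theorem locHom_specMap_onPt {B D L : Blpr.{u}} (g : B ⟶ D) (P : (PreSp.specC D).Pt L) :
    B.locHom ((specMap g).onPt P).1.compl ≫ ((specMap g).onPt P).2 =
      g ≫ D.locHom P.1.compl ≫ P.2 := by
  have := locHom_specPt (atPrime_isStrictlyLocal P.1) (g ≫ D.locHom P.1.compl)
  refine (Category.assoc _ _ _).symm.trans ?_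
  refine (congrArg (· ≫ P.2) this).trans (Category.assoc _ _ _)

end Blpr

namespace PreSp

/-! ### Points and open immersions -/

/-- Points that are given by local morphisms. -/
def Pt.IsLoc {X : PreSp.{u}} {L : Blpr.{u}} (P : X.Pt L) : Prop := Blpr.IsLoc P.2

theorem IsLocal.onPt {X Y : PreSp.{u}} {f : Y ⟶ X} (hf : IsLocal f) {L : Blpr.{u}} {P : Y.Pt L}
    (hP : P.IsLoc) : (f.onPt P).IsLoc := (hf P.1).comp hP

theorem IsOpenImm.exists_onPt_eq {X Y : PreSp.{u}} {f : Y ⟶ X} (hf : IsOpenImm f) {L : Blpr.{u}}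
    {P : X.Pt L} (h : P.1 ∈ Set.range f.base) (hP : P.IsLoc) :
    ∃ Q : Y.Pt L, Q.IsLoc ∧ f.onPt Q = P := by
  obtain ⟨x, g⟩ := P
  obtain ⟨y, rfl⟩ := h
  have := hf.isIso y
  refine ⟨⟨y, CategoryTheory.inv (f.map y) ≫ g⟩, (Blpr.isLoc_of_isIso _).comp hP,
    Sigma.ext rfl (heq_of_eq ?_)⟩
  exact IsIso.hom_inv_id_assoc _ _

theorem IsOpenImm.onPt_injective {X Y : PreSp.{u}} {f : Y ⟶ X} (hf : IsOpenImm f) {L : Blpr.{u}} :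
    Function.Injective (f.onPt (L := L)) := by
  rintro ⟨y, g⟩ ⟨y', g'⟩ h
  obtain rfl : y = y' := hf.isOpenEmbedding.injective (congrArg Sigma.fst h)
  have := hf.isIso y
  have hcomp : f.map y ≫ g = f.map y ≫ g' := eq_of_heq (Sigma.ext_iff.1 h).2
  rw [(cancel_epi _).1 hcomp]

/-- Every function on an open subspace is the pullback of a function. -/
theorem IsOpenImm.exists_eval_eq {X Y : PreSp.{u}} {f : Y ⟶ X} (hf : IsOpenImm f)
    (t : ∀ y, Y.A y) : ∃ s : ∀ x, X.A x, ∀ y, (f.pt y).eval s = t y := by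
  have key : ∀ x, ∃ a : X.A x, ∀ (y : Y) (e : f.base y = x), f.map y (e ▸ a) = t y := fun x => by
    by_cases h : x ∈ Set.range f.base
    · obtain ⟨y, rfl⟩ := h
      have := hf.isIso y
      refine ⟨CategoryTheory.inv (f.map y) (t y), fun y' e => ?_⟩
      obtain rfl := hf.isOpenEmbedding.injective e
      exact Blpr.apply_inv_apply _ _
    · exact ⟨1, fun y e => (h ⟨y, e⟩).elim⟩
  choose s hs using key
  exact ⟨s, fun y => hs _ y rfl⟩

/-- The pullback of regular functions at a point. -/
def Hom.pullReg {X Y : PreSp.{u}} (f : Y ⟶ X) (y : Y) : X.regAt (f.base y) →* Y.regAt y where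
  toFun s := ⟨fun y' => (f.pt y').eval s.1, f.reg s.2⟩
  map_one' := Subtype.ext (funext fun y' => map_one (f.map y').toMonoidHom)
  map_mul' _ _ := Subtype.ext (funext fun y' => map_mul (f.map y').toMonoidHom _ _)

/-- A space that is covered by open subspaces in which the stalks are blueprints of germs. -/
theorem isGood_of_cover {X : PreSp.{u}} (h : ∀ x : X, ∃ (Y : PreSp.{u}) (f : Y ⟶ X), Y.IsGood ∧
    IsOpenImm f ∧ x ∈ Set.range f.base ∧ ∀ (y : Y) (s : ∀ x, X.A x),
      (fun y' => (f.pt y').eval s) ∈ Y.regAt y → s ∈ X.regAt (f.base y)) : X.IsGood where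
  surj x a := by
    obtain ⟨Y, f, hY, hf, ⟨y, rfl⟩, hr⟩ := h x
    obtain ⟨t, ht, e⟩ := hY.surj y (f.map y a)
    obtain ⟨s, hs⟩ := hf.exists_eval_eq t
    have := hf.isIso y
    refine ⟨s, hr y s ?_, (Blpr.bijective_of_isIso (f.map y)).1 ((hs y).trans e)⟩
    exact Eq.subst (motive := (· ∈ Y.regAt y)) (funext hs).symm ht
  eq {x s t} hs ht e := by
    obtain ⟨Y, f, hY, hf, ⟨y, rfl⟩, -⟩ := h x
    refine hf.eventually ?_
    filter_upwards [hY.eq (f.reg hs) (f.reg ht) (congrArg (f.map y) e)] with y' hy'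
    have := hf.isIso y'
    exact (Blpr.bijective_of_isIso (f.map y')).1 hy'
  rel {x} v w e := by
    obtain ⟨Y, f, hY, hf, ⟨y, rfl⟩, -⟩ := h x
    have key : ∀ (y' : Y) (v : MonoidAlgebra ℕ (X.regAt (f.base y))),
        Blpr.mapSum (Y.evalReg y y') (Blpr.mapSum (Hom.pullReg f y) v) =
          Blpr.mapSum (f.map y').toMonoidHom (Blpr.mapSum (X.evalReg (f.base y) (f.base y')) v) :=
      fun y' v => by
        rw [Blpr.mapSum_mapSum, Blpr.mapSum_mapSum]
        rfl
    refine hf.eventually ?_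
    have e' := (f.map y).map_rel _ _ e
    rw [← key y, ← key y] at e'
    filter_upwards [hY.rel _ _ e'] with y' hy'
    have := hf.isIso y'
    refine Blpr.rel_of_isIso (f.map y') ?_
    rw [← key y', ← key y']
    exact hy'

end PreSp

/-! ### The universal space -/

namespace Reflection

variable {C : ObjectProperty Blpr.{u}} (hC : StableUnderLocalization C) (ρ : Reflection C)
  (X : PreSp.{u})

/-- The points of the universal space: a point of `X` with a prime ideal of the reflection of the
stalk that lies over the maximal ideal. -/
abbrev ZPoint : Type u :=
  Σ x : X, {q : Blpr.PrimeSpec (ρ.G (X.A x)) // ∀ a, ¬ IsUnit a → ρ.η (X.A x) a ∈ q.ideal}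

/-- The stalks of the universal space. -/
noncomputable abbrev ZStalk (z : ρ.ZPoint X) : Blpr.{u} := (ρ.G (X.A z.1)).atPrime z.2.1

variable {X}

/-- The map of stalks from `X` to the universal space. -/
noncomputable def ZMap (z : ρ.ZPoint X) : X.A z.1 ⟶ ρ.ZStalk X z :=
  ρ.η (X.A z.1) ≫ (ρ.G (X.A z.1)).locHom z.2.1.compl

theorem ZMap_isLoc (z : ρ.ZPoint X) : Blpr.IsLoc (ρ.ZMap z) := fun a ha =>
  not_not.1 fun h => Blpr.isUnit_atPrime_iff.1 ha (z.2.2 a h)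

include hC in
theorem isoClosure_ZStalk (z : ρ.ZPoint X) : C.isoClosure (ρ.ZStalk X z) :=
  hC.isoClosure (ρ.mem_isoClosure _) _

/-! ### Unique lifting of local points to the universal space -/

section Pt

variable {L : Blpr.{u}} (hL : L.IsStrictlyLocal) (hLC : C.isoClosure L)

/-- The lift of a local point to the universal space. -/
noncomputable def zPt (P : X.Pt L) (hP : P.IsLoc) : Σ z : ρ.ZPoint X, (ρ.ZStalk X z ⟶ L) :=
  ⟨⟨P.1, (Blpr.specPt hL (ρ.lift hLC P.2)).1, fun a ha h =>
    ha (hP a (by rw [← ρ.fac_apply hLC P.2]; exact h))⟩, (Blpr.specPt hL (ρ.lift hLC P.2)).2⟩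

theorem zPt_isLoc (P : X.Pt L) (hP : P.IsLoc) : Blpr.IsLoc (ρ.zPt hL hLC P hP).2 :=
  Blpr.specPt_isLoc hL _

theorem ZMap_zPt (P : X.Pt L) (hP : P.IsLoc) :
    ρ.ZMap (ρ.zPt hL hLC P hP).1 ≫ (ρ.zPt hL hLC P hP).2 = P.2 := by
  refine (Category.assoc _ _ _).trans ?_
  refine (congrArg (ρ.η _ ≫ ·) (Blpr.locHom_specPt hL (ρ.lift hLC P.2))).trans ?_
  exact ρ.fac hLC P.2

include hL hLC in
-- Over a fixed `x`, the morphism `G(O_x) → L` is determined by its restriction to `O_x`, and a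
-- local point of a spectrum is determined by such a morphism (`eq_specPt`).
theorem zPt_ext {Q Q' : Σ z : ρ.ZPoint X, (ρ.ZStalk X z ⟶ L)} (hQ : Blpr.IsLoc Q.2)
    (hQ' : Blpr.IsLoc Q'.2) (h : (⟨Q.1.1, ρ.ZMap Q.1 ≫ Q.2⟩ : X.Pt L) =
      ⟨Q'.1.1, ρ.ZMap Q'.1 ≫ Q'.2⟩) : Q = Q' := by
  obtain ⟨⟨x, q, hq⟩, g⟩ := Q
  obtain ⟨⟨x', q', hq'⟩, g'⟩ := Q'
  obtain rfl : x = x' := congrArg Sigma.fst h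
  have h₁ := eq_of_heq (Sigma.ext_iff.1 h).2
  have h₂ : (ρ.G (X.A x)).locHom q.compl ≫ g = (ρ.G (X.A x)).locHom q'.compl ≫ g' := by
    refine ρ.hom_ext hLC ?_
    rw [← Category.assoc, ← Category.assoc]
    exact h₁
  have h₃ : (⟨q, g⟩ : (PreSp.specC (ρ.G (X.A x))).Pt L) = ⟨q', g'⟩ :=
    (Blpr.eq_specPt hL _ hQ h₂).trans (Blpr.eq_specPt hL ⟨q', g'⟩ hQ' rfl).symm
  obtain rfl : q = q' := congrArg Sigma.fst h₃
  have h₄ := eq_of_heq (Sigma.ext_iff.1 h₃).2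
  exact Sigma.ext rfl (heq_of_eq h₄)

/-- Both sides are local lifts of the same point of `X`, so uniqueness applies. This naturality
makes pointwise lifts compatible with restriction to charts. -/
theorem zPt_push {L' : Blpr.{u}} (hL' : L'.IsStrictlyLocal) (hLC' : C.isoClosure L')
    (P : X.Pt L) (hP : P.IsLoc) (g : L ⟶ L') (hg : Blpr.IsLoc g) :
    ρ.zPt hL' hLC' (P.push g) (hP.comp hg) =
      ⟨(ρ.zPt hL hLC P hP).1, (ρ.zPt hL hLC P hP).2 ≫ g⟩ := by
  refine ρ.zPt_ext hL' hLC' (ρ.zPt_isLoc _ _ _ _) ((ρ.zPt_isLoc hL hLC P hP).comp hg) ?_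
  refine Sigma.ext rfl (heq_of_eq ?_)
  refine (ρ.ZMap_zPt hL' hLC' (P.push g) (hP.comp hg)).trans ?_
  refine Eq.trans ?_ (Category.assoc _ _ _)
  exact congrArg (· ≫ g) (ρ.ZMap_zPt hL hLC P hP).symm

end Pt

/-! ### The final topology and regular functions -/

section Final

variable {D : Blpr.{u}} (hD : C D) (φ : PreSp.specC D ⟶ X) (hφ : PreSp.IsLocal φ)

/-- The lift of a morphism from a spectrum to the universal space, as a map of points. -/
noncomputable def testPt (y : Blpr.PrimeSpec D) :
    Σ z : ρ.ZPoint X, (ρ.ZStalk X z ⟶ D.atPrime y) :=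
  ρ.zPt (Blpr.atPrime_isStrictlyLocal y) (hC.isoClosure (C.le_isoClosure _ hD) _) (φ.pt y) (hφ y)

variable (X)

/-- The final topology with respect to all morphisms from spectra of blueprints in `C`. -/
noncomputable abbrev univTop : TopologicalSpace (ρ.ZPoint X) where
  IsOpen W := ∀ (D : Blpr.{u}) (hD : C D) (φ : PreSp.specC D ⟶ X) (hφ : PreSp.IsLocal φ),
    IsOpen {y | (ρ.testPt hC hD φ hφ y).1 ∈ W}
  isOpen_univ _ _ _ _ := isOpen_univ
  isOpen_inter _ _ h h' D hD φ hφ := (h D hD φ hφ).inter (h' D hD φ hφ)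
  isOpen_sUnion S h D hD φ hφ := by
    have : {y | (ρ.testPt hC hD φ hφ y).1 ∈ ⋃₀ S} =
        ⋃ W ∈ S, {y | (ρ.testPt hC hD φ hφ y).1 ∈ W} := by
      ext y
      simp
    rw [this]
    exact isOpen_biUnion fun W hW => h W hW D hD φ hφ

/-- The universal space, with the final structure with respect to all morphisms from spectra of
blueprints in `C`. -/
noncomputable def univSp : PreSp.{u} where
  X := ρ.ZPoint X
  A := ρ.ZStalk X
  top := ρ.univTop hC X
  regAt z :=
    -- `W` is an open neighbourhood of `z`, with openness spelled out in the final topology.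
    -- Regularity is demanded on all of `W` after pullback to every test spectrum.
    { carrier := {s | ∃ W : Set (ρ.ZPoint X), z ∈ W ∧ ∀ (D : Blpr.{u}) (hD : C D)
        (φ : PreSp.specC D ⟶ X) (hφ : PreSp.IsLocal φ),
          IsOpen {y | (ρ.testPt hC hD φ hφ y).1 ∈ W} ∧ ∀ y, (ρ.testPt hC hD φ hφ y).1 ∈ W →
          (fun y' => (ρ.testPt hC hD φ hφ y').2 (s (ρ.testPt hC hD φ hφ y').1)) ∈
            (PreSp.specC D).regAt y}
      one_mem' := ⟨Set.univ, trivial, fun D hD φ hφ => ⟨isOpen_univ, fun y _ => by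
        refine Eq.subst (motive := (· ∈ (PreSp.specC D).regAt y)) (funext fun y' => ?_)
          (one_mem _)
        exact (map_one (ρ.testPt hC hD φ hφ y').2.toMonoidHom).symm⟩⟩
      mul_mem' := by
        rintro s t ⟨W, hz, h⟩ ⟨W', hz', h'⟩
        refine ⟨W ∩ W', ⟨hz, hz'⟩, fun D hD φ hφ =>
          ⟨(h D hD φ hφ).1.inter (h' D hD φ hφ).1, fun y hy => ?_⟩⟩
        refine Eq.subst (motive := (· ∈ (PreSp.specC D).regAt y)) (funext fun y' => ?_)
          (mul_mem ((h D hD φ hφ).2 y hy.1) ((h' D hD φ hφ).2 y hy.2))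
        exact (map_mul (ρ.testPt hC hD φ hφ y').2.toMonoidHom _ _).symm }
  reg_nhds := by
    rintro z s ⟨W, hz, h⟩
    refine (@mem_nhds_iff _ (ρ.univTop hC X) _ _).2 ⟨W, fun z' hz' => ⟨W, hz', h⟩, fun D hD φ hφ => (h D hD φ hφ).1, hz⟩
  reg_congr := by
    rintro z s t ⟨W, hz, h⟩ e
    obtain ⟨W', hW', ho, hz'⟩ := (@mem_nhds_iff _ (ρ.univTop hC X) _ _).1 e
    refine ⟨W ∩ W', ⟨hz, hz'⟩, fun D hD φ hφ =>
      ⟨(h D hD φ hφ).1.inter (ho D hD φ hφ), fun y hy => ?_⟩⟩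
    refine (PreSp.specC D).reg_congr ((h D hD φ hφ).2 y hy.1) ?_
    filter_upwards [(ho D hD φ hφ).mem_nhds hy.2] with y' hy'
    exact congrArg (ρ.testPt hC hD φ hφ y').2 (hW' hy')

theorem univSp_isOpen {W : Set (ρ.univSp hC X)} : IsOpen W ↔
    ∀ (D : Blpr.{u}) (hD : C D) (φ : PreSp.specC D ⟶ X)
      (hφ : PreSp.IsLocal φ), IsOpen {y | (ρ.testPt hC hD φ hφ y).1 ∈ W} := Iff.rfl

theorem mem_univSp_regAt {z : ρ.univSp hC X} {s : ∀ z, (ρ.univSp hC X).A z} :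
    s ∈ (ρ.univSp hC X).regAt z ↔ ∃ W : Set (ρ.univSp hC X), z ∈ W ∧ ∀ (D : Blpr.{u}) (hD : C D)
        (φ : PreSp.specC D ⟶ X) (hφ : PreSp.IsLocal φ),
          IsOpen {y | (ρ.testPt hC hD φ hφ y).1 ∈ W} ∧ ∀ y, (ρ.testPt hC hD φ hφ y).1 ∈ W →
          (fun y' => (ρ.testPt hC hD φ hφ y').2 (s (ρ.testPt hC hD φ hφ y').1)) ∈
            (PreSp.specC D).regAt y := Iff.rfl

variable {X}

/-- The lift of a morphism from a spectrum to the universal space. -/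
noncomputable def testHom : PreSp.specC D ⟶ ρ.univSp hC X where
  pt y := ρ.testPt hC hD φ hφ y
  continuous := ⟨fun _ hW => hW D hD φ hφ⟩
  reg {y s} hs := by
    obtain ⟨W, hz, h⟩ := (ρ.mem_univSp_regAt hC X).1 hs
    exact (h D hD φ hφ).2 y hz

theorem testHom_isLocal : PreSp.IsLocal (ρ.testHom hC hD φ hφ) := fun y =>
  ρ.zPt_isLoc _ _ (φ.pt y) (hφ y)

variable (X)

/-- The universal morphism. -/
noncomputable def univHom : ρ.univSp hC X ⟶ X where
  pt z := ⟨z.1, ρ.ZMap z⟩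
  continuous := ⟨fun W hW D hD φ hφ => hW.preimage φ.continuous⟩
  reg {z s} hs := by
    obtain ⟨W, hW, ho, hz⟩ := eventually_nhds_iff.1 (X.reg_nhds hs)
    refine (ρ.mem_univSp_regAt hC X).2 ⟨{z' | z'.1 ∈ W}, hz, fun D hD φ hφ =>
      ⟨ho.preimage φ.continuous, fun y hy => ?_⟩⟩
    refine Eq.subst (motive := (· ∈ (PreSp.specC D).regAt y)) (funext fun y' => ?_)
      (φ.reg (hW _ hy))
    exact (Blpr.hom_congr (ρ.ZMap_zPt _ _ (φ.pt y') (hφ y')) (s (φ.pt y').1)).symm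

variable {X}

theorem univHom_isLocal : PreSp.IsLocal (ρ.univHom hC X) := fun z => ρ.ZMap_isLoc z

theorem testHom_univHom : ρ.testHom hC hD φ hφ ≫ ρ.univHom hC X = φ :=
  PreSp.hom_ext fun y => Sigma.ext rfl (heq_of_eq (ρ.ZMap_zPt _ _ (φ.pt y) (hφ y)))

theorem univSp_pt_ext {L : Blpr.{u}} (hL : L.IsStrictlyLocal) (hLC : C.isoClosure L)
    {P Q : (ρ.univSp hC X).Pt L} (hP : P.IsLoc) (hQ : Q.IsLoc)
    (h : (ρ.univHom hC X).onPt P = (ρ.univHom hC X).onPt Q) : P = Q :=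
  ρ.zPt_ext hL hLC hP hQ h

theorem univSp_isStrictlyLocal (z : ρ.univSp hC X) :
    ((ρ.univSp hC X).A z).IsStrictlyLocal := Blpr.atPrime_isStrictlyLocal _

theorem univSp_isoClosure (z : ρ.univSp hC X) : C.isoClosure ((ρ.univSp hC X).A z) :=
  ρ.isoClosure_ZStalk hC z

end Final

/-- Local morphisms from spaces that are covered by spectra of blueprints in `C` lift uniquely to
the universal space. -/
theorem existsUnique_lift {Y : PreSp.{u}} (hY : Y.IsSch C) (φ : Y ⟶ X) (hφ : PreSp.IsLocal φ) :
    ∃ ψ : Y ⟶ ρ.univSp hC X, PreSp.IsLocal ψ ∧ ψ ≫ ρ.univHom hC X = φ ∧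
      ∀ ψ' : Y ⟶ ρ.univSp hC X, PreSp.IsLocal ψ' → ψ' ≫ ρ.univHom hC X = φ → ψ' = ψ := by
  have hYL := fun y => hY.isStrictlyLocal y
  have hYC : ∀ y, C.isoClosure (Y.A y) := fun y => by
    obtain ⟨D, hD, i, hi, d, rfl⟩ := hY.cover y
    have := hi.isIso d
    exact C.isoClosure.prop_of_iso (asIso (i.map d)).symm
      (hC.isoClosure (C.le_isoClosure _ hD) d.compl)
  let pt : ∀ y, (ρ.univSp hC X).Pt (Y.A y) := fun y => ρ.zPt (hYL y) (hYC y) (φ.pt y) (hφ y)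
  -- On an affine chart of `Y` the pointwise lift agrees with the test morphism of the restricted
  -- `φ`, which is continuous and preserves regularity by construction.
  have key : ∀ {D : Blpr.{u}} (hD : C D) (i : PreSp.specC D ⟶ Y) (hi : PreSp.IsOpenImm i)
      (d : Blpr.PrimeSpec D), (ρ.testHom hC hD (i ≫ φ) (hi.isLocal.comp hφ)).pt d =
        (pt (i.base d)).push (i.map d) := fun hD i hi d =>
    ρ.zPt_push (hYL _) (hYC _) (Blpr.atPrime_isStrictlyLocal d) _ (φ.pt (i.base d)) (hφ _) (i.map d)
      (hi.isLocal d)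
  let ψ : Y ⟶ ρ.univSp hC X :=
    { pt := pt
      continuous := continuous_iff_continuousAt.2 fun y => by
        obtain ⟨D, hD, i, hi, d, rfl⟩ := hY.cover y
        rw [← hi.isOpenEmbedding.continuousAt_iff]
        have h := (ρ.testHom hC hD (i ≫ φ) (hi.isLocal.comp hφ)).continuous.continuousAt (x := d)
        refine Eq.subst (motive := fun k => ContinuousAt k d) (funext fun d' => ?_) h
        exact congrArg Sigma.fst (key hD i hi d')
      reg := fun {y s} hs => by
        obtain ⟨D, hD, i, hi, d, rfl⟩ := hY.cover y
        refine (hi.reg_iff hY.isGood (PreSp.specC_isGood D)).2 ?_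
        have hs' : s ∈ (ρ.univSp hC X).regAt
            ((ρ.testHom hC hD (i ≫ φ) (hi.isLocal.comp hφ)).base d) := by
          rw [show (ρ.testHom hC hD (i ≫ φ) (hi.isLocal.comp hφ)).base d = (pt (i.base d)).1 from
            congrArg Sigma.fst (key hD i hi d)]
          exact hs
        refine Eq.subst (motive := (· ∈ (PreSp.specC D).regAt d)) (funext fun d' => ?_)
          ((ρ.testHom hC hD (i ≫ φ) (hi.isLocal.comp hφ)).reg hs')
        exact congrArg (fun P => PreSp.Pt.eval P s) (key hD i hi d') }
  have hψ : PreSp.IsLocal ψ := fun y => ρ.zPt_isLoc (hYL y) (hYC y) (φ.pt y) (hφ y)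
  have hψφ : ψ ≫ ρ.univHom hC X = φ :=
    PreSp.hom_ext fun y => Sigma.ext rfl (heq_of_eq (ρ.ZMap_zPt _ _ (φ.pt y) (hφ y)))
  refine ⟨ψ, hψ, hψφ, fun ψ' hψ' e => PreSp.hom_ext fun y => ?_⟩
  refine ρ.univSp_pt_ext hC (hYL y) (hYC y) (hψ' y) (hψ y) ?_
  exact congrArg (fun k => PreSp.Hom.pt k y) (e.trans hψφ.symm)

end Reflection

/-! ### Charts of the universal space -/

namespace Reflection

variable {C : ObjectProperty Blpr.{u}} (hC : StableUnderLocalization C) (ρ : Reflection C)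
  {X : PreSp.{u}} {B : Blpr.{u}} {i : PreSp.specC B ⟶ X} (hi : PreSp.IsOpenImm i)

/-- The chart of the universal space that is defined by a chart of `X`. -/
noncomputable def chart : PreSp.specC (ρ.G B) ⟶ ρ.univSp hC X :=
  ρ.testHom hC (ρ.mem B) (Blpr.specMap (ρ.η B) ≫ i)
    ((Blpr.specMap_isLocal _).comp hi.isLocal)

theorem chart_isLocal : PreSp.IsLocal (ρ.chart hC hi) := ρ.testHom_isLocal hC _ _ _

theorem univHom_chart_onPt {L : Blpr.{u}} (Q : (PreSp.specC (ρ.G B)).Pt L) :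
    (ρ.univHom hC X).onPt ((ρ.chart hC hi).onPt Q) =
      i.onPt ((Blpr.specMap (ρ.η B)).onPt Q) := by
  rw [← PreSp.onPt_comp, ← PreSp.onPt_comp]
  exact congrArg (fun k => PreSp.Hom.onPt k Q) (ρ.testHom_univHom hC _ _ _)

/-! ### Local points of a chart -/

section Pt

variable {L : Blpr.{u}} (hL : L.IsStrictlyLocal) (hLC : C.isoClosure L)

theorem specMap_onPt_specPt (f : B ⟶ L) :
    (Blpr.specMap (ρ.η B)).onPt (Blpr.specPt hL (ρ.lift hLC f)) = Blpr.specPt hL f := by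
  refine Blpr.eq_specPt hL _ ((Blpr.specMap_isLocal _).onPt (Blpr.specPt_isLoc hL _)) ?_
  rw [Blpr.locHom_specMap_onPt, Blpr.locHom_specPt, ρ.fac]

theorem chart_onPt_specPt {P : (ρ.univSp hC X).Pt L} (hP : P.IsLoc) {f : B ⟶ L}
    (h : (ρ.univHom hC X).onPt P = i.onPt (Blpr.specPt hL f)) :
    (ρ.chart hC hi).onPt (Blpr.specPt hL (ρ.lift hLC f)) = P := by
  refine ρ.univSp_pt_ext hC hL hLC ((ρ.chart_isLocal hC hi).onPt (Blpr.specPt_isLoc hL _)) hP ?_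
  rw [univHom_chart_onPt, ρ.specMap_onPt_specPt hL hLC, h]

include hL hLC in
-- The image of `P` in `X` lifts to a point of `Spec B`, hence to a morphism `B → L`. Its extension
-- to `G B` gives the required point.
theorem exists_chart_onPt_eq {P : (ρ.univSp hC X).Pt L} (hP : P.IsLoc)
    (h : ((ρ.univHom hC X).onPt P).1 ∈ Set.range i.base) :
    ∃ Q : (PreSp.specC (ρ.G B)).Pt L, Q.IsLoc ∧ (ρ.chart hC hi).onPt Q = P := by
  obtain ⟨R, hR, e⟩ := hi.exists_onPt_eq h ((ρ.univHom_isLocal hC).onPt hP)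
  rw [Blpr.eq_specPt hL R hR rfl] at e
  exact ⟨_, Blpr.specPt_isLoc hL _, ρ.chart_onPt_specPt hC hi hL hLC hP e.symm⟩

include hL hLC in
-- Equal images give equal points of `Spec B`; the two morphisms `G B → L` then agree on `B`, hence
-- everywhere.
theorem chart_onPt_injective {Q Q' : (PreSp.specC (ρ.G B)).Pt L} (hQ : Q.IsLoc) (hQ' : Q'.IsLoc)
    (h : (ρ.chart hC hi).onPt Q = (ρ.chart hC hi).onPt Q') : Q = Q' := by
  have h₁ := congrArg (ρ.univHom hC X).onPt h
  rw [univHom_chart_onPt, univHom_chart_onPt] at h₁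
  have h₂ := hi.onPt_injective h₁
  have h₃ := Blpr.locHom_specMap_onPt (ρ.η B) Q
  rw [h₂, Blpr.locHom_specMap_onPt (ρ.η B) Q'] at h₃
  exact (Blpr.eq_specPt hL Q hQ (ρ.hom_ext hLC h₃).symm).trans (Blpr.eq_specPt hL Q' hQ' rfl).symm

end Pt

/-- A Yoneda argument: the tautological point `(z, 𝟙)` at `z`, the image of `q`, lifts to a local
point `(q', g)` of the chart. Pushing it to the stalk at `q` gives a point with the same image as
`(q, 𝟙)`, so `q' = q` and `g` is a two-sided inverse. -/
theorem exists_chart_inverse (q : Blpr.PrimeSpec (ρ.G B)) :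
    ∃ g : (ρ.G B).atPrime q ⟶ (ρ.univSp hC X).A ((ρ.chart hC hi).base q),
      Blpr.IsLoc g ∧ (ρ.chart hC hi).map q ≫ g = 𝟙 _ ∧ g ≫ (ρ.chart hC hi).map q = 𝟙 _ := by
  let z := (ρ.chart hC hi).base q
  have hz : ((ρ.univHom hC X).onPt (⟨z, 𝟙 _⟩ : (ρ.univSp hC X).Pt _)).1 ∈ Set.range i.base :=
    ⟨((Blpr.specMap (ρ.η B)).onPt (⟨q, 𝟙 _⟩ : (PreSp.specC (ρ.G B)).Pt _)).1,
      (congrArg Sigma.fst (ρ.univHom_chart_onPt hC hi ⟨q, 𝟙 _⟩)).symm⟩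
  obtain ⟨Q, hQ, e⟩ := ρ.exists_chart_onPt_eq hC hi (ρ.univSp_isStrictlyLocal hC z)
    (ρ.univSp_isoClosure hC z) (P := ⟨z, 𝟙 _⟩) (Blpr.isLoc_id _) hz
  have hl := ρ.chart_isLocal hC hi q
  have e' : Q.push ((ρ.chart hC hi).map q) = ⟨q, 𝟙 _⟩ := by
    refine ρ.chart_onPt_injective hC hi (Blpr.atPrime_isStrictlyLocal q)
      (hC.isoClosure (ρ.mem_isoClosure B) q.compl) (hQ.comp hl) (Blpr.isLoc_id _) ?_
    rw [PreSp.onPt_push, e]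
    exact Sigma.ext rfl (heq_of_eq ((Category.id_comp _).trans (Category.comp_id _).symm))
  obtain ⟨q', g⟩ := Q
  obtain rfl : q' = q := congrArg Sigma.fst e'
  exact ⟨g, hQ, eq_of_heq (Sigma.ext_iff.1 e).2, eq_of_heq (Sigma.ext_iff.1 e').2⟩

theorem chart_isIso (q : Blpr.PrimeSpec (ρ.G B)) : IsIso ((ρ.chart hC hi).map q) := by
  obtain ⟨g, -, h₁, h₂⟩ := ρ.exists_chart_inverse hC hi q
  exact ⟨g, h₁, h₂⟩

theorem chart_injective : Function.Injective (ρ.chart hC hi).base := by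
  intro q q' h
  obtain ⟨g, hg, h₁, -⟩ := ρ.exists_chart_inverse hC hi q
  obtain ⟨g', hg', h₁', -⟩ := ρ.exists_chart_inverse hC hi q'
  -- The image points are generalized to variables so that their equality can be substituted; then
  -- both inverses define points over the same tautological point.
  have key : ∀ {z z' : ρ.univSp hC X} (_ : z = z') (g : (ρ.G B).atPrime q ⟶ (ρ.univSp hC X).A z)
      (k : (ρ.univSp hC X).A z ⟶ (ρ.G B).atPrime q)
      (g' : (ρ.G B).atPrime q' ⟶ (ρ.univSp hC X).A z')
      (k' : (ρ.univSp hC X).A z' ⟶ (ρ.G B).atPrime q'), (ρ.chart hC hi).pt q = ⟨z, k⟩ →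
      (ρ.chart hC hi).pt q' = ⟨z', k'⟩ → Blpr.IsLoc g → Blpr.IsLoc g' → k ≫ g = 𝟙 _ →
      k' ≫ g' = 𝟙 _ → q = q' := by
    rintro z _ rfl g k g' k' e e' hg hg' h h'
    have h₂ : (ρ.chart hC hi).onPt (⟨q, g⟩ : (PreSp.specC (ρ.G B)).Pt _) =
        (ρ.chart hC hi).onPt (⟨q', g'⟩ : (PreSp.specC (ρ.G B)).Pt _) := by
      change ((ρ.chart hC hi).pt q).push g = ((ρ.chart hC hi).pt q').push g'
      rw [e, e']
      exact Sigma.ext rfl (heq_of_eq (h.trans h'.symm))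
    exact congrArg Sigma.fst (ρ.chart_onPt_injective hC hi (ρ.univSp_isStrictlyLocal hC z)
      (ρ.univSp_isoClosure hC z) (Q := ⟨q, g⟩) (Q' := ⟨q', g'⟩) hg hg' h₂)
  exact key h g _ g' _ rfl rfl hg hg' h₁ h₁'

variable (hX : X.IsGood)
  (h : (∀ B : Blpr.{u}, C B → B.IsProper) ∨ StableUnderDirectedColimits C)

include hX h in
/-- Over the domain of a chart of `X`, the lift of a morphism to the universal space is given by a
morphism to the regular functions. -/
theorem exists_lift_chart {D : Blpr.{u}} (hD : C D) (φ : PreSp.specC D ⟶ X)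
    (hφ : PreSp.IsLocal φ) : ∃ (V : Opens (Blpr.PrimeSpec D))
      (f : ∀ y : V, ρ.G B ⟶ D.atPrime y.1),
      (∀ y, y ∈ V ↔ φ.base y ∈ Set.range i.base) ∧
      (∀ c, (fun y => f y c) ∈ (PreSp.specC D).secSubmonoid V) ∧
      ∀ y : V, (ρ.chart hC hi).onPt (Blpr.specPt (Blpr.atPrime_isStrictlyLocal y.1) (f y)) =
        ρ.testPt hC hD φ hφ y.1 := by
  let V : Opens (Blpr.PrimeSpec D) := ⟨φ.base ⁻¹' Set.range i.base,
    hi.isOpenEmbedding.isOpen_range.preimage φ.continuous⟩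
  have hst : ∀ y : Blpr.PrimeSpec D, C.isoClosure (D.atPrime y) :=
    fun y => hC.isoClosure (C.le_isoClosure _ hD) _
  have hP : ∀ y : V, ∃ Q : (PreSp.specC B).Pt (D.atPrime y.1), Q.IsLoc ∧ i.onPt Q = φ.pt y.1 :=
    fun y => hi.exists_onPt_eq y.2 (hφ y.1)
  choose P hPl hP using hP
  let f : ∀ y : V, B ⟶ D.atPrime y.1 := fun y => B.locHom (P y).1.compl ≫ (P y).2
  have hf : ∀ b, (fun y => f y b) ∈ (PreSp.specC D).secSubmonoid V := fun b y => by
    -- The element `b` is regarded as a function on `X`, regular at the points of the chart; the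
    -- value `f y b` is its pullback along `φ`.
    obtain ⟨s, hs⟩ := hi.exists_eval_eq fun p : Blpr.PrimeSpec B => B.locHom p.compl b
    have hs' : s ∈ X.regAt (φ.base y.1) := by
      obtain ⟨p, hp⟩ := y.2
      rw [← hp]
      refine (hi.reg_iff hX (PreSp.specC_isGood B)).2 ?_
      exact Eq.subst (motive := (· ∈ (PreSp.specC B).regAt p)) (funext hs).symm
        (PreSp.specC_const_mem B p b)
    refine ⟨_, φ.reg hs', fun y' => ?_⟩
    rw [← hP y', PreSp.onPt_eval]
    exact congrArg (P y').2 (hs (P y').1)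
  refine ⟨V, fun y => ρ.lift (hst y.1) (f y), fun y => Iff.rfl,
    Blpr.lift_mem_secSubmonoid hC ρ h (C.le_isoClosure _ hD) f hf, fun y => ?_⟩
  refine ρ.chart_onPt_specPt hC hi _ (hst y.1) (ρ.testHom_isLocal hC hD φ hφ y.1) ?_
  rw [← Blpr.eq_specPt (Blpr.atPrime_isStrictlyLocal y.1) (P y) (hPl y) rfl, hP y]
  exact congrArg (fun k => PreSp.Hom.pt k y.1) (ρ.testHom_univHom hC hD φ hφ)

/-- Describes the preimage of a chart image inside a test spectrum by the morphisms `f y`, so that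
openness can be decided there. -/
theorem chart_preimage {D : Blpr.{u}} (hD : C D) (φ : PreSp.specC D ⟶ X)
    (hφ : PreSp.IsLocal φ) {V : Opens (Blpr.PrimeSpec D)} {f : ∀ y : V, ρ.G B ⟶ D.atPrime y.1}
    (hV : ∀ y, y ∈ V ↔ φ.base y ∈ Set.range i.base)
    (hf : ∀ y : V, (ρ.chart hC hi).onPt
      (Blpr.specPt (Blpr.atPrime_isStrictlyLocal y.1) (f y)) = ρ.testPt hC hD φ hφ y.1)
    (W : Set (Blpr.PrimeSpec (ρ.G B))) (y : Blpr.PrimeSpec D) :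
    (ρ.testPt hC hD φ hφ y).1 ∈ (ρ.chart hC hi).base '' W ↔
      ∃ hy : y ∈ V, (Blpr.specPt (Blpr.atPrime_isStrictlyLocal y) (f ⟨y, hy⟩)).1 ∈ W := by
  constructor
  · rintro ⟨q, hq, e⟩
    have hy : y ∈ V := by
      rw [hV]
      have e₁ := congrArg Sigma.fst (ρ.univHom_chart_onPt hC hi ⟨q, 𝟙 _⟩)
      refine ⟨_, e₁.symm.trans ?_⟩
      exact congrArg (ρ.univHom hC X).base e
    refine ⟨hy, ?_⟩
    have e₂ := congrArg Sigma.fst (hf ⟨y, hy⟩)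
    rwa [← ρ.chart_injective hC hi (e.trans e₂.symm)]
  · rintro ⟨hy, hW⟩
    exact ⟨_, hW, congrArg Sigma.fst (hf ⟨y, hy⟩)⟩

include hX h in
-- Openness in the final topology is tested on each `Spec D`. There the preimage is open because the
-- extended morphisms have regular values, which is what `exists_lift_chart` provides.
theorem chart_isOpenMap : IsOpenMap (ρ.chart hC hi).base := by
  intro W hW
  refine (ρ.univSp_isOpen hC X).2 fun D hD φ hφ => ?_
  obtain ⟨V, f, hV, hf, e⟩ := ρ.exists_lift_chart hC hi hX h hD φ hφ
  refine Eq.subst (motive := IsOpen) (Set.ext fun y => ?_) (Blpr.isOpen_specPt_preimage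
    (PreSp.specC_isGood D) (fun y => Blpr.atPrime_isStrictlyLocal y) hf hW)
  exact (ρ.chart_preimage hC hi hD φ hφ hV e W y).symm

include hX h in
theorem chart_isOpenImm : PreSp.IsOpenImm (ρ.chart hC hi) :=
  ⟨Topology.IsOpenEmbedding.of_continuous_injective_isOpenMap (ρ.chart hC hi).continuous
    (ρ.chart_injective hC hi) (ρ.chart_isOpenMap hC hi hX h), ρ.chart_isIso hC hi⟩

include hX h in
-- The image under the chart of the set where the pullback of `s` is regular serves as
-- neighbourhood; on a test spectrum over it, the pullback is regular by `specPt_reg`.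
theorem chart_reg (q : Blpr.PrimeSpec (ρ.G B)) (s : ∀ z, (ρ.univSp hC X).A z)
    (hs : (fun q' => ((ρ.chart hC hi).pt q').eval s) ∈ (PreSp.specC (ρ.G B)).regAt q) :
    s ∈ (ρ.univSp hC X).regAt ((ρ.chart hC hi).base q) := by
  obtain ⟨W, hW, ho, hq⟩ := eventually_nhds_iff.1 ((PreSp.specC (ρ.G B)).reg_nhds hs)
  refine (ρ.mem_univSp_regAt hC X).2 ⟨(ρ.chart hC hi).base '' W, ⟨q, hq, rfl⟩,
    fun D hD φ hφ => ⟨ρ.chart_isOpenMap hC hi hX h W ho D hD φ hφ, fun y hy => ?_⟩⟩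
  obtain ⟨V, f, hV, hf, e⟩ := ρ.exists_lift_chart hC hi hX h hD φ hφ
  obtain ⟨hyV, hyW⟩ := (ρ.chart_preimage hC hi hD φ hφ hV e W y).1 hy
  refine (PreSp.specC D).reg_congr (Blpr.specPt_reg (PreSp.specC_isGood D)
    (fun y => Blpr.atPrime_isStrictlyLocal y) hf (y := ⟨y, hyV⟩) (hW _ hyW)) ?_
  filter_upwards [V.isOpen.mem_nhds hyV] with y' hy'
  refine ((PreSp.specC D).extend_apply V _ ⟨y', hy'⟩).trans ?_
  exact congrArg (fun P : (ρ.univSp hC X).Pt (D.atPrime y') => P.eval s) (e ⟨y', hy'⟩)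

include h in
theorem univSp_isSch {C' : ObjectProperty Blpr.{u}} (hX : X.IsSch C') :
    (ρ.univSp hC X).IsSch C := by
  have key : ∀ z : ρ.univSp hC X, ∃ (B : Blpr.{u}) (i : PreSp.specC B ⟶ X)
      (hi : PreSp.IsOpenImm i), z ∈ Set.range (ρ.chart hC hi).base := fun z => by
    obtain ⟨B, -, i, hi, hz⟩ := hX.cover ((ρ.univHom hC X).base z)
    obtain ⟨Q, -, e⟩ := ρ.exists_chart_onPt_eq hC hi (ρ.univSp_isStrictlyLocal hC z)
      (ρ.univSp_isoClosure hC z) (P := ⟨z, 𝟙 _⟩) (Blpr.isLoc_id _) hz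
    exact ⟨B, i, hi, Q.1, congrArg Sigma.fst e⟩
  refine ⟨PreSp.isGood_of_cover fun z => ?_, fun z => ?_⟩
  · obtain ⟨B, i, hi, hz⟩ := key z
    exact ⟨_, _, PreSp.specC_isGood _, ρ.chart_isOpenImm hC hi hX.isGood h, hz,
      ρ.chart_reg hC hi hX.isGood h⟩
  · obtain ⟨B, i, hi, hz⟩ := key z
    exact ⟨_, ρ.mem B, _, ρ.chart_isOpenImm hC hi hX.isGood h, hz⟩

end Reflection

/-- The universal morphism from a `C`-scheme to a blue scheme. -/
theorem exists_isUniversalFrom {C : ObjectProperty Blpr.{u}} (hC : StableUnderLocalization C)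
    (hadj : C.ι.IsRightAdjoint)
    (h : (∀ B : Blpr.{u}, C B → B.IsProper) ∨ StableUnderDirectedColimits C) (X : BSch.{u}) :
    ∃ (GX : BSch.{u}) (β : GX ⟶ X), IsUniversalFrom C β := by
  obtain ⟨ρ⟩ := Reflection.nonempty hadj
  exact PreSp.exists_universal X (ρ.univSp_isSch hC h (PreSp.isSch_conc X.property))
    (ρ.univHom hC _) (ρ.univHom_isLocal hC) fun Y hY φ hφ => ρ.existsUnique_lift hC hY φ hφ

/-! ### Construction of reflections -/

theorem isRightAdjoint_of_exists {C : ObjectProperty Blpr.{u}}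
    (h : ∀ B : Blpr.{u}, ∃ (G : Blpr.{u}) (_ : C G) (η : B ⟶ G), ∀ R : Blpr.{u}, C R →
      ∀ f : B ⟶ R, ∃ g : G ⟶ R, η ≫ g = f ∧ ∀ g', η ≫ g' = f → g' = g) :
    C.ι.IsRightAdjoint := by
  refine @isRightAdjointOfStructuredArrowInitials _ _ _ _ C.ι fun B => ?_
  obtain ⟨G, hG, η, hη⟩ := h B
  choose lift fac uniq using hη
  exact (IsInitial.ofUniqueHom
    (X := StructuredArrow.mk (Y := (⟨G, hG⟩ : C.FullSubcategory)) (T := C.ι) η)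
    (fun A => StructuredArrow.homMk (ObjectProperty.homMk (lift _ A.right.property A.hom))
      (fac _ A.right.property A.hom))
    fun A m => StructuredArrow.ext _ _ (ObjectProperty.hom_ext _
      (uniq _ A.right.property A.hom _ (StructuredArrow.w m)))).hasInitial

namespace Blpr

/-! ### Blueprints of submonoids of semirings -/

section Sub

variable {R : Type u} [CommSemiring R] (M : Submonoid R)

/-- The blueprint of a submonoid of a semiring. -/
noncomputable def sub : Blpr.{u} where
  carrier := M
  rel := RingCon.ker (sumLift M.subtype)

/-- The elements of the blueprint of a submonoid. -/
def unSub : sub M →* R := M.subtype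

variable {M}

theorem sub_rel {x y : MonoidAlgebra ℕ (sub M)} :
    (sub M).rel x y ↔ sumLift (unSub M) x = sumLift (unSub M) y := RingCon.ker_apply _

theorem sub_isProper : (sub M).IsProper := fun a b h => by
  rw [sub_rel, sumLift_el, sumLift_el] at h
  exact Subtype.ext h

/-- The morphism to the blueprint of a submonoid of `R` that is defined by a morphism to `R`. -/
noncomputable def toSub {B : Blpr.{u}} (φ : B.Plus →+* R) (hM : ∀ b, φ (B.toPlus b) ∈ M) :
    B ⟶ sub M where
  toMonoidHom := ((φ : B.Plus →* R).comp B.toPlus).codRestrict M hM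
  map_rel x y h := sub_rel.2 (by
    have e : ∀ x, sumLift (unSub M) (mapSum (A₂ := sub M)
        (((φ : B.Plus →* R).comp B.toPlus).codRestrict M hM) x) = φ (B.rel.mk' x) := fun x => by
      refine (sumLift_mapSum (A' := sub M) _ _ x).trans ?_
      rw [← sumLift_toPlus, map_sumLift]
      rfl
    rw [e, e, B.rel_iff.1 h])

theorem toPlus_injective {B : Blpr.{u}} (hB : B.IsProper) : Function.Injective B.toPlus :=
  fun _ _ h => hB _ _ (B.rel_iff.2 h)

/-- Extension of morphisms to the blueprint of a submonoid. -/
theorem exists_sub_lift {B R' : Blpr.{u}} (φ : B.Plus →+* R) (hM : ∀ b, φ (B.toPlus b) ∈ M)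
    (hR' : R'.IsProper) (f : B ⟶ R') (g : R →+* R'.Plus)
    (hg : ∀ b, g (φ (B.toPlus b)) = R'.toPlus (f b)) (hgM : ∀ m ∈ M, ∃ a, R'.toPlus a = g m)
    (hgen : ∀ m ∈ M, ∃ x y : B.Plus, m + φ x = φ y ∧ (x = 0 ∨ IsCancelAdd R'.Plus)) :
    ∃ h : sub M ⟶ R', toSub φ hM ≫ h = f ∧ ∀ h', toSub φ hM ≫ h' = f → h' = h := by
  have hinj := toPlus_injective hR'
  -- Since `R'` is proper it embeds in its semiring, so `g` restricted to `M` can be read as a map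
  -- to `R'`.
  choose k hk using fun m : sub M => hgM m.1 m.2
  let h₀ : sub M →* R' :=
    { toFun := k
      map_one' := hinj (by rw [hk, map_one]; exact map_one g)
      map_mul' := fun m m' => hinj (by rw [hk, map_mul, hk, hk]; exact map_mul g _ _) }
  have hsum : ∀ x, sumLift R'.toPlus (mapSum h₀ x) = g (sumLift (unSub M) x) := fun x => by
    rw [sumLift_mapSum, map_sumLift]
    congr 2
    ext m
    exact hk m
  let h : sub M ⟶ R' := ⟨h₀, fun x y hxy => by
    rw [rel_iff_sumLift, hsum, hsum, sub_rel.1 hxy]⟩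
  refine ⟨h, hom_ext fun b => hinj ((hk _).trans (hg b)), fun h' e => ?_⟩
  have key : ∀ h' : sub M ⟶ R', toSub φ hM ≫ h' = f → ∀ x : B.Plus,
      plusMap h' (plusMap (toSub φ hM) x) = plusMap f x := fun h' e x => by
    rw [← e, plusMap_comp]
    rfl
  have hP : ∀ (m : sub M) (x y : B.Plus), m.1 + φ x = φ y →
      (sub M).toPlus m + plusMap (toSub φ hM) x = plusMap (toSub φ hM) y := fun m x y e => by
    obtain ⟨v, rfl⟩ := B.rel.mk'_surjective x
    obtain ⟨w, rfl⟩ := B.rel.mk'_surjective y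
    rw [plusMap_mk, plusMap_mk, toPlus_apply, ← map_add, ← rel_iff, sub_rel, map_add, sumLift_el,
      sumLift_mapSum, sumLift_mapSum]
    rw [← sumLift_toPlus, map_sumLift, map_sumLift] at e
    exact e
  refine hom_ext fun m => hinj ?_
  -- For uniqueness, `m + φ x = φ y` is a relation in the blueprint, so any extension sends `m` to
  -- an element whose sum with the image of `x` is the image of `y`; the term of `x` vanishes or can
  -- be cancelled.
  obtain ⟨x, y, hxy, hc⟩ := hgen m.1 m.2
  have e₁ : ∀ h' : sub M ⟶ R', toSub φ hM ≫ h' = f →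
      R'.toPlus (h' m) + plusMap f x = plusMap f y := fun h' e => by
    have := congrArg (plusMap h') (hP m x y hxy)
    rwa [map_add, plusMap_toPlus, key h' e, key h' e] at this
  have e₂ := (e₁ h' e).trans (e₁ h (hom_ext fun b => hinj ((hk _).trans (hg b)))).symm
  rcases hc with rfl | hc
  · simpa using e₂
  · exact add_right_cancel e₂

end Sub

/-! ### Properties of blueprints -/

/-- Every formal sum is related to an element. -/
def IsSumClosed (B : Blpr.{u}) : Prop := ∀ v : MonoidAlgebra ℕ B, ∃ a : B, B.rel v (el a)

theorem IsSumClosed.toPlus_surjective {B : Blpr.{u}} (hB : B.IsSumClosed) :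
    Function.Surjective B.toPlus := fun x => by
  obtain ⟨v, rfl⟩ := B.rel.mk'_surjective x
  obtain ⟨a, ha⟩ := hB v
  exact ⟨a, (B.rel_iff.1 ha).symm⟩

/-- Properness makes `A → ℕ[A]/≡` injective, and closure under sums makes it surjective. The
resulting intrinsic criteria for semirings and rings are easy to check on localizations. -/
theorem nonempty_iso_ofSemiring {B : Blpr.{u}} (hB : B.IsProper) (hB' : B.IsSumClosed) :
    Nonempty (B ≅ ofSemiring B.Plus) := by
  let f : B ⟶ ofSemiring B.Plus := plusEquiv B B.Plus (RingHom.id _)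
  have : IsIso f := by
    refine isIso_of_bijective f ⟨toPlus_injective hB, hB'.toPlus_surjective⟩ fun x y h => ?_
    rw [ofSemiring_rel, sumLift_mapSum, sumLift_mapSum] at h
    exact B.rel_iff_sumLift.2 h
  exact ⟨asIso f⟩

theorem ofSemiring_isProper (R : Type u) [CommSemiring R] : (ofSemiring R).IsProper :=
  fun a b h => by
    rw [ofSemiring_rel, sumLift_el, sumLift_el] at h
    exact h

theorem ofSemiring_isSumClosed (R : Type u) [CommSemiring R] : (ofSemiring R).IsSumClosed :=
  fun v => ⟨(sumLift (unSemiring R) v : R), ofSemiring_rel.2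
    (sumLift_el (A := ofSemiring R) (unSemiring R) _).symm⟩

theorem ofSemiring_hasInverses (R : Type u) [CommRing R] : (ofSemiring R).HasInverses :=
  fun a => ⟨(-unSemiring R a : R), ofSemiring_rel.2 (by
    rw [map_add, map_zero, sumLift_el]
    refine (congrArg (unSemiring R a + ·) (sumLift_el (A := ofSemiring R) (unSemiring R) _)).trans ?_
    exact add_neg_cancel (unSemiring R a))⟩

theorem IsSumClosed.of_iso {B B' : Blpr.{u}} (hB : B.IsSumClosed) (e : B' ≅ B) :
    B'.IsSumClosed := fun v => by
  obtain ⟨a, ha⟩ := hB (mapSum e.hom.toMonoidHom v)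
  obtain ⟨a, rfl⟩ := (bijective_of_isIso e.hom).2 a
  refine ⟨a, rel_of_isIso e.hom ?_⟩
  rwa [mapSum_el]

theorem HasInverses.of_iso {B B' : Blpr.{u}} (hB : B.HasInverses) (e : B' ≅ B) :
    B'.HasInverses := fun a => by
  obtain ⟨b, hb⟩ := hB (e.hom a)
  obtain ⟨b, rfl⟩ := (bijective_of_isIso e.hom).2 b
  refine ⟨b, rel_of_isIso e.hom ?_⟩
  rwa [map_add, mapSum_el, mapSum_el, map_zero]

theorem HasInverses.exists_add_eq_zero {B : Blpr.{u}} (hB : B.HasInverses) (x : B.Plus) :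
    ∃ y, x + y = 0 := by
  obtain ⟨v, rfl⟩ := B.rel.mk'_surjective x
  induction v using induction_sum with
  | zero => exact ⟨0, by rw [map_zero, add_zero]⟩
  | add v w hv hw =>
    obtain ⟨v', hv⟩ := hv
    obtain ⟨w', hw⟩ := hw
    exact ⟨v' + w', by rw [map_add, add_add_add_comm, hv, hw, add_zero]⟩
  | el a =>
    obtain ⟨b, hb⟩ := hB a
    refine ⟨B.rel.mk' (el b), ?_⟩
    rw [← map_add, ← map_zero B.rel.mk']
    exact B.rel_iff.1 hb

/-- A semiring with additive inverses is a ring. -/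
noncomputable abbrev commRingOfNeg (S : Type u) [inst : CommSemiring S]
    (h : ∀ x : S, ∃ y, x + y = 0) : CommRing S :=
  letI : Neg S := ⟨fun x => (h x).choose⟩
  { inst with
    zsmul := zsmulRec
    neg_add_cancel := fun x => (add_comm _ _).trans (h x).choose_spec }

theorem rings_iff {B : Blpr.{u}} : rings B ↔ B.IsProper ∧ B.IsSumClosed ∧ B.HasInverses := by
  constructor
  · rintro ⟨R, _, ⟨e⟩⟩
    exact ⟨(ofSemiring_isProper R).of_iso e, (ofSemiring_isSumClosed R).of_iso e,
      (ofSemiring_hasInverses R).of_iso e⟩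
  · rintro ⟨h₁, h₂, h₃⟩
    exact ⟨B.Plus, commRingOfNeg _ h₃.exists_add_eq_zero, nonempty_iso_ofSemiring h₁ h₂⟩

theorem semirings_iff {B : Blpr.{u}} : semirings B ↔ B.IsProper ∧ B.IsSumClosed := by
  constructor
  · rintro ⟨R, _, ⟨e⟩⟩
    exact ⟨(ofSemiring_isProper R).of_iso e, (ofSemiring_isSumClosed R).of_iso e⟩
  · rintro ⟨h₁, h₂⟩
    exact ⟨B.Plus, inferInstance, nonempty_iso_ofSemiring h₁ h₂⟩

/-! ### Localizations -/

section Localization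

variable {B : Blpr.{u}} (S : Submonoid B)

theorem IsProper.localization (hB : B.IsProper) : (B.localization S).IsProper := by
  intro x y h
  obtain ⟨a, s, e⟩ := exists_mul_locHom x
  obtain ⟨b, t, e'⟩ := exists_mul_locHom y
  have h' := (B.localization S).rel.mul h ((B.localization S).rel.refl (el (B.locHom S (s * t))))
  rw [← el_mul, ← el_mul] at h'
  have e₁ : x * B.locHom S (s * t) = B.locHom S (a * t) := by
    rw [map_mul, map_mul, ← e, mul_assoc]
  have e₂ : y * B.locHom S (s * t) = B.locHom S (b * s) := by
    rw [map_mul, map_mul, ← e', mul_assoc, mul_comm (B.locHom S s)]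
  rw [e₁, e₂, ← mapSum_el, ← mapSum_el] at h'
  obtain ⟨r, hr⟩ := localization_rel_iff.1 h'
  rw [← el_mul, ← el_mul] at hr
  refine (isUnit_locHom B S (s * t)).mul_right_cancel ?_
  exact (e₁.trans (locHom_eq_iff.2 ⟨r, hB _ _ hr⟩)).trans e₂.symm

theorem HasZeroElem.localization (hB : B.HasZeroElem) : (B.localization S).HasZeroElem := by
  obtain ⟨e, he⟩ := hB
  have := (B.locHom S).map_rel _ _ he
  rw [mapSum_el, map_zero] at this
  exact ⟨_, this⟩

theorem HasInverses.localization (hB : B.HasInverses) : (B.localization S).HasInverses := by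
  intro x
  obtain ⟨a, s, e⟩ := exists_mul_locHom x
  obtain ⟨b, hb⟩ := hB a
  refine ⟨frac b s, rel_of_isUnit_mul (isUnit_locHom B S s) ?_⟩
  have := (B.locHom S).map_rel _ _ hb
  rwa [map_add, mapSum_el, mapSum_el, map_zero, ← e, ← frac_mul b s, mul_comm x, el_mul,
    mul_comm (frac b s), el_mul, ← mul_add,
    ← mul_zero (el (B.locHom S s) : MonoidAlgebra ℕ (B.localization S))] at this

theorem IsSumClosed.localization (hB : B.IsSumClosed) : (B.localization S).IsSumClosed := by
  intro v
  obtain ⟨t, v', e⟩ := B.exists_common_denominator S v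
  obtain ⟨a, ha⟩ := hB v'
  refine ⟨frac a t, rel_of_isUnit_mul (isUnit_locHom B S t) ?_⟩
  have := (B.locHom S).map_rel _ _ ha
  rw [mapSum_el, ← frac_mul a t, mul_comm (frac a t), el_mul] at this
  exact Eq.subst (motive := fun z => (B.localization S).rel z _) e.symm this

theorem exists_denominator (v : MonoidAlgebra ℕ (B.localization S)) :
    ∃ (t : S) (v' : MonoidAlgebra ℕ B),
      el (B.locHom S t) * v = mapSum (B.locHom S).toMonoidHom v' :=
  B.exists_common_denominator S v

theorem IsCancellative.localization (hB : B.IsCancellative) :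
    (B.localization S).IsCancellative := by
  intro x y z h
  obtain ⟨r, x', hx⟩ := exists_denominator S x
  obtain ⟨s, y', hy⟩ := exists_denominator S y
  obtain ⟨t, z', hz⟩ := exists_denominator S z
  have h' := (B.localization S).rel.mul
    ((B.localization S).rel.refl (el (B.locHom S (r * s * t : S)))) h
  have ex : el (B.locHom S (r * s * t : S)) * x =
      mapSum (B.locHom S).toMonoidHom (el (s * t : B) * x') := by
    rw [map_mul, ← hx, mapSum_el, Submonoid.coe_mul, Submonoid.coe_mul]
    simp only [map_mul, el_mul]
    ring
  have ey : el (B.locHom S (r * s * t : S)) * y =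
      mapSum (B.locHom S).toMonoidHom (el (r * t : B) * y') := by
    rw [map_mul, ← hy, mapSum_el, Submonoid.coe_mul, Submonoid.coe_mul]
    simp only [map_mul, el_mul]
    ring
  have ez : el (B.locHom S (r * s * t : S)) * z =
      mapSum (B.locHom S).toMonoidHom (el (r * s : B) * z') := by
    rw [map_mul, ← hz, mapSum_el, Submonoid.coe_mul, Submonoid.coe_mul]
    simp only [map_mul, el_mul]
    ring
  rw [mul_add, mul_add, ex, ey, ez, ← map_add, ← map_add] at h'
  obtain ⟨q, hq⟩ := localization_rel_iff.1 h'
  rw [mul_add, mul_add] at hq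
  refine rel_of_isUnit_mul (isUnit_locHom B S (r * s * t)) ?_
  rw [ex, ey]
  exact localization_rel_iff.2 ⟨q, hB _ _ _ hq⟩

end Localization

end Blpr

namespace Blpr

open scoped TensorProduct

/-! ### Ring completions -/

section RingCompletion

variable {S : Type u} [CommSemiring S]

/-- The morphism to the ring completion. -/
noncomputable def toRing (S : Type u) [CommSemiring S] : S →+* ℤ ⊗[ℕ] S :=
  (Algebra.TensorProduct.includeRight : S →ₐ[ℕ] ℤ ⊗[ℕ] S).toRingHom

/-- Every element of the completion is a formal difference; in this form a morphism to a
cancellative target is determined by its restriction to `S`. -/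
theorem exists_add_toRing_eq (m : ℤ ⊗[ℕ] S) : ∃ x y : S, m + toRing S x = toRing S y := by
  induction m using TensorProduct.induction_on with
  | zero => exact ⟨0, 0, zero_add _⟩
  | add m m' h h' =>
    obtain ⟨x, y, h⟩ := h
    obtain ⟨x', y', h'⟩ := h'
    exact ⟨x + x', y + y', by rw [map_add, map_add, add_add_add_comm, h, h']⟩
  | tmul n s =>
    have key : ∀ k : ℕ, toRing S (k • s) = (k : ℤ) ⊗ₜ[ℕ] s := fun k => by
      change (1 : ℤ) ⊗ₜ[ℕ] (k • s) = _
      rw [← TensorProduct.smul_tmul]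
      simp
    obtain ⟨k, rfl | rfl⟩ := n.eq_nat_or_neg
    · exact ⟨0, k • s, by rw [key, map_zero, add_zero]⟩
    · exact ⟨k • s, 0, by rw [key, ← TensorProduct.add_tmul, neg_add_cancel, map_zero,
        TensorProduct.zero_tmul]⟩

theorem exists_ringHom_of_neg {S' : Type u} [CommSemiring S'] (h : ∀ x : S', ∃ y, x + y = 0)
    (f : S →+* S') : ∃ g : ℤ ⊗[ℕ] S →+* S', ∀ s, g (toRing S s) = f s := by
  let _ : CommRing S' := commRingOfNeg S' h
  refine ⟨(Algebra.TensorProduct.productMap (Int.castRingHom S').toNatAlgHom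
    f.toNatAlgHom).toRingHom, fun s => ?_⟩
  exact Algebra.TensorProduct.productMap_right_apply _ _ s

end RingCompletion

theorem HasInverses.isCancelAdd {B : Blpr.{u}} (hB : B.HasInverses) : IsCancelAdd B.Plus := by
  have key : ∀ x y z : B.Plus, x + z = y + z → x = y := fun x y z h => by
    obtain ⟨w, hw⟩ := hB.exists_add_eq_zero z
    have := congrArg (· + w) h
    simpa only [add_assoc, hw, add_zero] using this
  exact { add_left_cancel := fun z x y h => key x y z (by
            rw [add_comm x, add_comm y]; exact h)
          add_right_cancel := fun z x y h => key x y z h }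

theorem HasInverses.exists_toPlus_eq_neg {B : Blpr.{u}} (hB : B.HasInverses) {R : Type u} [CommRing R]
    (g : R →+* B.Plus) {m : R} {a : B} (h : B.toPlus a = g (-m)) : ∃ b, B.toPlus b = g m := by
  obtain ⟨b, hb⟩ := hB a
  refine ⟨b, ?_⟩
  have := hB.isCancelAdd
  refine add_left_cancel (a := B.toPlus a) ?_
  rw [toPlus_apply, toPlus_apply, ← map_add, B.rel_iff.1 hb, ← toPlus_apply, h, ← map_add,
    neg_add_cancel, map_zero, map_zero]

theorem sub_hasInverses {R : Type u} [CommRing R] {M : Submonoid R} (hM : ∀ m ∈ M, -m ∈ M) :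
    (sub M).HasInverses := fun a => by
  refine ⟨(⟨-a.1, hM _ a.2⟩ : M), sub_rel.2 ?_⟩
  rw [map_add, map_zero, sumLift_el]
  refine (congrArg (unSub M a + ·) (sumLift_el (A := sub M) (unSub M) _)).trans ?_
  exact add_neg_cancel (unSub M a)

theorem sub_isSumClosed {R : Type u} [CommSemiring R] : (sub (⊤ : Submonoid R)).IsSumClosed :=
  fun v =>
    let a : sub (⊤ : Submonoid R) := (⟨sumLift (unSub ⊤) v, trivial⟩ : (⊤ : Submonoid R))
    ⟨a, sub_rel.2 (sumLift_el (unSub ⊤) a).symm⟩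

/-! ### The reflections -/

/-- The reflection is the image of `A` in `ℕ[A]/≡`: related elements are identified. -/
theorem prop_isRightAdjoint : prop.{u}.ι.IsRightAdjoint := by
  refine isRightAdjoint_of_exists fun B => ⟨sub (MonoidHom.mrange B.toPlus), sub_isProper,
    toSub (RingHom.id _) fun b => ⟨b, rfl⟩, fun R hR f => ?_⟩
  refine exists_sub_lift _ _ hR f (plusMap f) (plusMap_toPlus f) ?_ ?_
  · rintro _ ⟨b, rfl⟩
    exact ⟨f b, (plusMap_toPlus f b).symm⟩
  · rintro _ ⟨b, rfl⟩
    exact ⟨0, B.toPlus b, add_zero _, Or.inl rfl⟩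

/-- The reflection is the image of `A` in `ℕ[A]/≡` together with `0`. -/
theorem zero_isRightAdjoint : zero.{u}.ι.IsRightAdjoint := by
  refine isRightAdjoint_of_exists fun B => ?_
  let M : Submonoid B.Plus :=
    { carrier := {x | x ∈ MonoidHom.mrange B.toPlus ∨ x = 0}
      one_mem' := Or.inl (one_mem _)
      mul_mem' := by
        rintro x y (hx | rfl) (hy | rfl)
        · exact Or.inl (mul_mem hx hy)
        · exact Or.inr (mul_zero _)
        · exact Or.inr (zero_mul _)
        · exact Or.inr (mul_zero _) }
  have hM : (sub M).HasZeroElem := ⟨(⟨0, Or.inr rfl⟩ : M), sub_rel.2 (by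
    rw [map_zero]
    exact sumLift_el (A := sub M) (unSub M) _)⟩
  refine ⟨sub M, ⟨sub_isProper, hM⟩, toSub (RingHom.id _) fun b => Or.inl ⟨b, rfl⟩,
    fun R hR f => ?_⟩
  refine exists_sub_lift _ _ hR.1 f (plusMap f) (plusMap_toPlus f) ?_ ?_
  · rintro _ (⟨b, rfl⟩ | rfl)
    · exact ⟨f b, (plusMap_toPlus f b).symm⟩
    · obtain ⟨e, he⟩ := hR.2
      refine ⟨e, ?_⟩
      rw [map_zero, ← map_zero R.rel.mk']
      exact R.rel_iff.1 he
  · exact fun x _ => ⟨0, x, add_zero _, Or.inl rfl⟩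

/-- The reflection is all of `ℕ[A]/≡`; a proper target closed under sums contains the images of all
sums. -/
theorem semirings_isRightAdjoint : semirings.{u}.ι.IsRightAdjoint := by
  refine isRightAdjoint_of_exists fun B => ⟨sub (⊤ : Submonoid B.Plus),
    semirings_iff.2 ⟨sub_isProper, sub_isSumClosed⟩, toSub (RingHom.id _) fun b => trivial,
    fun R hR f => ?_⟩
  rw [semirings_iff] at hR
  exact exists_sub_lift _ _ hR.1 f (plusMap f) (plusMap_toPlus f)
    (fun x _ => hR.2.toPlus_surjective _) fun x _ => ⟨0, x, add_zero _, Or.inl rfl⟩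

/-- The reflection consists of the images of the elements of `A` and their negatives in the ring
completion of `ℕ[A]/≡`. -/
theorem inv_isRightAdjoint : inv.{u}.ι.IsRightAdjoint := by
  refine isRightAdjoint_of_exists fun B => ?_
  let M : Submonoid (ℤ ⊗[ℕ] B.Plus) :=
    { carrier := {x | (∃ b, toRing _ (B.toPlus b) = x) ∨ ∃ b, toRing _ (B.toPlus b) = -x}
      one_mem' := Or.inl ⟨1, by rw [map_one, map_one]⟩
      mul_mem' := by
        rintro x y (⟨a, hx⟩ | ⟨a, hx⟩) (⟨b, hy⟩ | ⟨b, hy⟩)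
        · exact Or.inl ⟨a * b, by rw [map_mul, map_mul, hx, hy]⟩
        · exact Or.inr ⟨a * b, by rw [map_mul, map_mul, hx, hy]; exact mul_neg x y⟩
        · exact Or.inr ⟨a * b, by rw [map_mul, map_mul, hx, hy]; exact neg_mul x y⟩
        · exact Or.inl ⟨a * b, by rw [map_mul, map_mul, hx, hy]; exact neg_mul_neg x y⟩ }
  have hM : (sub M).HasInverses := sub_hasInverses fun m hm =>
    hm.elim (fun h => Or.inr (by rwa [neg_neg])) Or.inl
  refine ⟨sub M, ⟨sub_isProper, hM⟩, toSub (toRing _) fun b => Or.inl ⟨b, rfl⟩, fun R hR f => ?_⟩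
  obtain ⟨g, hg⟩ := exists_ringHom_of_neg hR.2.exists_add_eq_zero (plusMap f)
  have hg' : ∀ b, g (toRing _ (B.toPlus b)) = R.toPlus (f b) := fun b => by
    rw [hg, plusMap_toPlus]
  refine exists_sub_lift _ _ hR.1 f g hg' ?_ fun m _ => ?_
  · rintro m (⟨b, rfl⟩ | ⟨b, hb⟩)
    · exact ⟨f b, (hg' b).symm⟩
    · exact hR.2.exists_toPlus_eq_neg g (a := f b) (by rw [← hg', hb])
  · obtain ⟨x, y, h⟩ := exists_add_toRing_eq m
    exact ⟨x, y, h, Or.inr hR.2.isCancelAdd⟩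

/-- The reflection is the whole ring completion of `ℕ[A]/≡`. -/
theorem rings_isRightAdjoint : rings.{u}.ι.IsRightAdjoint := by
  refine isRightAdjoint_of_exists fun B => ⟨sub (⊤ : Submonoid (ℤ ⊗[ℕ] B.Plus)),
    rings_iff.2 ⟨sub_isProper, sub_isSumClosed, sub_hasInverses fun _ _ => trivial⟩,
    toSub (toRing _) fun b => trivial, fun R hR f => ?_⟩
  rw [rings_iff] at hR
  obtain ⟨g, hg⟩ := exists_ringHom_of_neg hR.2.2.exists_add_eq_zero (plusMap f)
  refine exists_sub_lift _ _ hR.1 f g (fun b => by rw [hg, plusMap_toPlus])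
    (fun x _ => hR.2.1.toPlus_surjective _) fun m _ => ?_
  obtain ⟨x, y, h⟩ := exists_add_toRing_eq m
  exact ⟨x, y, h, Or.inr hR.2.2.isCancelAdd⟩

/-- The cancellative blueprint of a blueprint. -/
noncomputable def cancOf (B : Blpr.{u}) : Blpr.{u} where
  carrier := B
  rel :=
    { r := fun x y => ∃ z, B.rel (x + z) (y + z)
      iseqv :=
        { refl := fun x => ⟨0, B.rel.refl _⟩
          symm := fun ⟨z, h⟩ => ⟨z, B.rel.symm h⟩
          trans := by
            rintro x y w ⟨z, h⟩ ⟨z', h'⟩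
            refine ⟨z + z', ?_⟩
            have h₁ := B.rel.add h (B.rel.refl z')
            have h₂ := B.rel.add h' (B.rel.refl z)
            rw [add_assoc, add_assoc] at h₁
            rw [add_assoc, add_assoc, add_comm z' z] at h₂
            exact B.rel.trans h₁ h₂ }
      add' := by
        rintro x y x' y' ⟨z, h⟩ ⟨z', h'⟩
        refine ⟨z + z', ?_⟩
        rw [add_add_add_comm, add_add_add_comm y]
        exact B.rel.add h h'
      mul' := by
        rintro x y x' y' ⟨z, h⟩ ⟨z', h'⟩
        -- The factors are replaced one at a time, `x` by `y` next to `x'` and then `x'` by `y'`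
        -- next to `y`; the witness collects the two correction terms.
        refine ⟨z * x' + y * z', ?_⟩
        have h₁ := B.rel.add (B.rel.mul h (B.rel.refl x')) (B.rel.refl (y * z'))
        have h₂ := B.rel.add (B.rel.mul (B.rel.refl y) h') (B.rel.refl (z * x'))
        have e₁ : (x + z) * x' + y * z' = x * x' + (z * x' + y * z') := by ring
        have e₂ : (y + z) * x' + y * z' = y * (x' + z') + z * x' := by ring
        have e₃ : y * (y' + z') + z * x' = y * y' + (z * x' + y * z') := by ring
        rw [e₁, e₂] at h₁
        rw [e₃] at h₂
        exact B.rel.trans h₁ h₂ }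

theorem cancOf_rel {B : Blpr.{u}} {x y : MonoidAlgebra ℕ B} :
    (cancOf B).rel x y ↔ ∃ z, B.rel (x + z) (y + z) := Iff.rfl

theorem canc_isRightAdjoint : canc.{u}.ι.IsRightAdjoint := by
  refine isRightAdjoint_of_exists fun B => ?_
  have hc : (cancOf B).IsCancellative := by
    intro (x : MonoidAlgebra ℕ B) (y : MonoidAlgebra ℕ B) (z : MonoidAlgebra ℕ B) h
    obtain ⟨w, h⟩ := cancOf_rel.1 h
    have h' : B.rel (x + z + w) (y + z + w) := h
    rw [add_assoc, add_assoc] at h'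
    exact ⟨z + w, h'⟩
  have hid : ∀ x : MonoidAlgebra ℕ B, mapSum (A₂ := cancOf B) (MonoidHom.id B) x = x := mapSum_id
  let η : B ⟶ cancOf B := ⟨MonoidHom.id B, fun x y h => ⟨0, by
    have e := hid
    rw [e x, e y]
    exact B.rel.add h (B.rel.refl 0)⟩⟩
  refine ⟨cancOf B, hc, η, fun R hR f => ?_⟩
  let g : cancOf B ⟶ R := ⟨f.toMonoidHom, by
    intro (x : MonoidAlgebra ℕ B) (y : MonoidAlgebra ℕ B) h
    obtain ⟨z, h⟩ := cancOf_rel.1 h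
    have h' := f.map_rel _ _ h
    rw [map_add (mapSum f.toMonoidHom), map_add (mapSum f.toMonoidHom)] at h'
    exact hR _ _ _ h'⟩
  exact ⟨g, rfl, fun g' e => hom_ext fun a => hom_congr e a⟩

/-! ### Directed colimits of cancellative blueprints -/

theorem IsCancellative.of_iso {B B' : Blpr.{u}} (hB : B.IsCancellative) (e : B' ≅ B) :
    B'.IsCancellative := by
  intro x y z h
  have h' := e.hom.map_rel _ _ h
  rw [map_add (mapSum _), map_add (mapSum _)] at h'
  exact rel_of_isIso e.hom (hB _ _ _ h')

section Filtered

variable {J : Type u} [SmallCategory J] [IsFiltered J] {F : J ⥤ Blpr.{u}} {c : Cocone F}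
  (hc : IsColimit c)

omit [IsFiltered J] in
theorem mapSum_map_ι {j k : J} (f : j ⟶ k) (v : MonoidAlgebra ℕ (F.obj j)) :
    mapSum (c.ι.app k).toMonoidHom (mapSum (F.map f).toMonoidHom v) =
      mapSum (c.ι.app j).toMonoidHom v := by
  rw [← mapSum_comp, c.w]

include hc in
theorem filtered_exists_sum (v : MonoidAlgebra ℕ c.pt) :
    ∃ (j : J) (v' : MonoidAlgebra ℕ (F.obj j)), mapSum (c.ι.app j).toMonoidHom v' = v := by
  induction v using induction_sum with
  | zero => exact ⟨IsFiltered.nonempty.some, 0, map_zero _⟩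
  | add v w hv hw =>
    obtain ⟨j, v, rfl⟩ := hv
    obtain ⟨k, w, rfl⟩ := hw
    refine ⟨IsFiltered.max j k, mapSum (F.map (IsFiltered.leftToMax j k)).toMonoidHom v +
      mapSum (F.map (IsFiltered.rightToMax j k)).toMonoidHom w, ?_⟩
    rw [map_add, mapSum_map_ι, mapSum_map_ι]
  | el a =>
    obtain ⟨j, b, rfl⟩ := filtered_exists_rep hc a
    exact ⟨j, el b, mapSum_el _ _⟩

include hc in
-- The three formal sums and the relation between them come from one stage of the system, where the
-- common summand can be cancelled.
theorem isCancellative_of_isColimit (hF : ∀ j, (F.obj j).IsCancellative) :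
    c.pt.IsCancellative := by
  intro x y z h
  obtain ⟨i, x, rfl⟩ := filtered_exists_sum hc x
  obtain ⟨j, y, rfl⟩ := filtered_exists_sum hc y
  obtain ⟨k, z, rfl⟩ := filtered_exists_sum hc z
  rw [← mapSum_map_ι (IsFiltered.firstToMax₃ i j k), ← mapSum_map_ι (IsFiltered.secondToMax₃ i j k),
    ← mapSum_map_ι (IsFiltered.thirdToMax₃ i j k), ← map_add, ← map_add] at h
  obtain ⟨l, f, h⟩ := filtered_exists_rel hc h
  rw [map_add (mapSum _), map_add (mapSum _)] at h
  have := (c.ι.app l).map_rel _ _ (hF l _ _ _ h)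
  simp only [mapSum_map_ι] at this
  exact this

end Filtered

theorem canc_stableUnderDirectedColimits : StableUnderDirectedColimits canc.{u} := by
  intro J _ _ _
  refine ⟨fun X ⟨p⟩ => canc.le_isoClosure _ ?_⟩
  refine isCancellative_of_isColimit p.isColimit fun j => ?_
  obtain ⟨R, hR, ⟨e⟩⟩ := p.prop_diag_obj j
  exact IsCancellative.of_iso hR e

end Blpr

/-- In the examples, properness supplies the alternative hypothesis except for cancellative
blueprints, where closure under directed colimits is used. -/
theorem mainTheorem8 :
    (∀ C : ObjectProperty Blpr.{u}, StableUnderLocalization C → C.ι.IsRightAdjoint →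
      ((∀ B : Blpr.{u}, C B → B.IsProper) ∨ StableUnderDirectedColimits C) →
      ∀ X : BSch.{u}, ∃ (GX : BSch.{u}) (β : GX ⟶ X), IsUniversalFrom C β) ∧
    (∀ C ∈ ({Blpr.rings, Blpr.semirings, Blpr.canc, Blpr.prop, Blpr.inv, Blpr.zero} :
        Set (ObjectProperty Blpr.{u})),
      StableUnderLocalization C ∧ C.ι.IsRightAdjoint ∧
      ∀ X : BSch.{u}, ∃ (XC : BSch.{u}) (β : XC ⟶ X), IsUniversalFrom C β) := by
  refine ⟨fun C hC hadj h X => exists_isUniversalFrom hC hadj h X, ?_⟩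
  have key : ∀ C : ObjectProperty Blpr.{u},
      (∀ B : Blpr.{u}, C B → ∀ S : Submonoid B, C (B.localization S)) → C.ι.IsRightAdjoint →
      ((∀ B : Blpr.{u}, C B → B.IsProper) ∨ StableUnderDirectedColimits C) →
      StableUnderLocalization C ∧ C.ι.IsRightAdjoint ∧
      ∀ X : BSch.{u}, ∃ (XC : BSch.{u}) (β : XC ⟶ X), IsUniversalFrom C β := fun C h₁ h₂ h₃ =>
    have hC : StableUnderLocalization C := fun B hB S => C.le_isoClosure _ (h₁ B hB S)
    ⟨hC, h₂, exists_isUniversalFrom hC h₂ h₃⟩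
  rintro C (rfl | rfl | rfl | rfl | rfl | rfl)
  · refine key _ (fun B hB S => ?_) Blpr.rings_isRightAdjoint
      (Or.inl fun B hB => (Blpr.rings_iff.1 hB).1)
    rw [Blpr.rings_iff] at hB ⊢
    exact ⟨hB.1.localization S, hB.2.1.localization S, hB.2.2.localization S⟩
  · refine key _ (fun B hB S => ?_) Blpr.semirings_isRightAdjoint
      (Or.inl fun B hB => (Blpr.semirings_iff.1 hB).1)
    rw [Blpr.semirings_iff] at hB ⊢
    exact ⟨hB.1.localization S, hB.2.localization S⟩
  · exact key _ (fun B hB S => Blpr.IsCancellative.localization S hB) Blpr.canc_isRightAdjoint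
      (Or.inr Blpr.canc_stableUnderDirectedColimits)
  · exact key _ (fun B hB S => Blpr.IsProper.localization S hB) Blpr.prop_isRightAdjoint
      (Or.inl fun B hB => hB)
  · exact key _ (fun B hB S => ⟨hB.1.localization S, hB.2.localization S⟩)
      Blpr.inv_isRightAdjoint (Or.inl fun B hB => hB.1)
  · exact key _ (fun B hB S => ⟨hB.1.localization S, hB.2.localization S⟩)
      Blpr.zero_isRightAdjoint (Or.inl fun B hB => hB.1)
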